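/- **Conventions.** $H$ and $D$ are (finite-dimensional) Lie groups and $H$ is a crossed $D$-module: there are smooth $\alpha:H\to D$ and a smooth action $(d,h)\mapsto{}^dh$ of $D$ on $H$ by automorphisms with ${}^{\alpha(h)}h'=hh'h^{-1}$, $\alpha({}^dh)=d\,\alpha(h)d^{-1}$. An *$H$-bibundle* is a smooth left and right principal $H$-bundle $E$ with commuting actions; $\varphi_e\in Aut(H)$ is defined by $\varphi_e(h)e=e\triangleleft h$. A section $s$ is *central* if $hs=s\triangleleft h$; a *trivial* bibundle is one with a global smooth central section. A *$D$-$H$ bundle* is a left principal $D$-bundle $Q$ with a smooth map $\psi:Q\to Aut(H)$, $\psi_{dq}={}^d\circ\psi_q$ (a trivialization of $Aut(H)\times_DQ$), and right $H$-action $q\triangleleft h=\alpha(\psi_q(h))q$. Products are formed by $[q,he]=[q\triangleleft h,e]$; $E^{-1}$ is $E$ with $he^{-1}=(e\triangleleft h^{-1})^{-1}$, $e^{-1}\triangleleft h=(h^{-1}e)^{-1}$. $QE$ is a $D$-$H$ bundle with $\psi_{[q,e]}=\psi_q\varphi_e$; if $Z$ is a trivial $D$-bibundle with central section $s$, $ZQ$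 is a $D$-$H$ bundle with $\psi_{[ds,q]}={}^d\circ\psi_q$. If $T$ is a trivial $H$-bibundle with section $t$, then $\xi_Q(T)$ is the trivial $D$-bibundle, with section $\xi_Q(t)$, such that $QT=\xi_Q(T)Q$ and $[q,t]=[\xi_Q(t),q]$. Lower indices denote pull-backs along projections; isomorphisms of $D$-$H$ bundles preserve $\psi$. Let $\wp:Y\to M$ be a surjective submersion of smooth manifolds, $Y^{[n]}$ its fibre powers. A *bundle gerbe* $(\mathcal E,Y,M,f)$ is an $H$-bibundle $\mathcal E$ on $Y^{[2]}$ with a global central section $f^{-1}$ of $\mathcal E_{12}\mathcal E_{23}\mathcal E_{13}^{-1}$, such that the isomorphism $\mathcal E_{12}\mathcal E_{23}\to\mathcal E_{13}$ given by $f^{-1}$ is associative on $Y^{[4]}$ (i.e. $f_{124}\varphi_{12}(f_{234})=f_{134}f_{123}$). An *$\mathcal E$-module* $(\mathcal Q,\mathcal Z,z)$ is a $D$-$H$ bundle $\mathcal Q$ on $Y$ and a trivial $D$-bibundle $\mathcal Z$ on $Y^{[2]}$ with global central section $z^{-1}$, with an isomorphism of $D$-$H$ bundles $\mathcal Q_1\mathcal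 E=\mathcal Z\mathcal Q_2$, such that the resulting isomorphism $\hat z:\mathcal Q_1\mathcal E\to\mathcal Q_2$, determined by $[q_1,e]=[z^{-1},\hat z(q_1,e)]$, is compatible with the gerbe product: the two isomorphisms $\mathcal Q_1\mathcal E_{12}\mathcal E_{23}\to\mathcal Q_3$ agree (i.e. $z_{23}z_{12}=z_{13}\xi_1(f)$). Two modules are *equivalent* if there is an isomorphism $\mathcal Q\to\mathcal Q'$ of $D$-$H$ bundles intertwining $\hat z$ and $\hat z'$. For gerbes $\mathcal E,\mathcal E'$ over the same $Y$, a *stable isomorphism over $Y$* consists of an $H$-bibundle $\mathcal N$ on $Y$, a trivial $H$-bibundle $\eta$ on $Y^{[2]}$ with global central section $\ell^{-1}$, and an isomorphism of bibundles $\mathcal N_1\mathcal E'\mathcal N_2^{-1}=\eta\,\mathcal E$, such that the resulting isomorphism $\mathcal N_1\mathcal E'\mathcal N_2^{-1}\to\mathcal E$ is compatible with the products given by $f'$ and $f$ (i.e. $\varphi_1(f')=\ell_{13}^{-1}f\varphi_{12}(\ell_{23})\ell_{12}$). A *stable isomorphism* of gerbes over $Y\to M$ and $Y'\to M$ is one over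 $Y\times_MY'$ between the pulled back gerbes $q^*\mathcal E$ and $q'^*\mathcal E'$, where $q,q'$ are the projections of $Y\times_MY'$; gerbes are *stably equivalent* if one exists. **Proposition.** Stably equivalent gerbes have the same equivalence classes of modules (for every fixed crossed module). Precisely: 1. Let $\mathcal E,\mathcal E'$ be bundle gerbes over the same $Y$, with a stable isomorphism $(\mathcal N,\eta,\ell)$ over $Y$. Let $(\mathcal Q,\mathcal Z,z)$ be an $\mathcal E$-module and $\mathcal I$ a trivial $D$-bibundle on $Y$ with global central section $i^{-1}$. Then $\mathcal I\mathcal Q\mathcal N$ is an $\mathcal E'$-module with $\mathcal Z'_{12}=\mathcal I_1\,\xi_1(\eta_{12})\,\mathcal Z_{12}\,\mathcal I_2^{-1}$ and $z'_{12}=i_2^{-1}\,z_{12}\,\xi_1(\ell_{12})\,i_1$. Its identification $(\mathcal I\mathcal Q\mathcal N)_1\mathcal E'=\mathcal Z'(\mathcal I\mathcal Q\mathcal N)_2$ is the unique one such that $[[[i_1^{-1},q_1],n_1],e']=[z'^{-1},[[i_2^{-1},q_2],n_2]]$ whenever $[q_1,e]=[z^{-1},q_2]$ and $[[n_1,e'],n_2^{-1}]=[\ell^{-1},e]$.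 The assignment $\mathcal Q\mapsto\mathcal I\mathcal Q\mathcal N$ induces a well-defined bijection, independent of $\mathcal I$, from the equivalence classes of $\mathcal E$-modules to those of $\mathcal E'$-modules. 2. Let $\mathcal E$ over $Y$ and $\mathcal E'$ over $Y'$ be bundle gerbes with a stable isomorphism $(\mathcal N,\eta,\ell)$ over $Y\times_MY'$. There is a bijection from the equivalence classes of $\mathcal E$-modules to those of $\mathcal E'$-modules under which the classes of $\mathcal Q$ and $\mathcal Q'$ correspond if and only if $q'^*\mathcal Q'$ is equivalent, as a $q'^*\mathcal E'$-module, to a module $\mathcal I\,(q^*\mathcal Q)\,\mathcal N$ as in 1. -/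

import Mathlib

open scoped Manifold ContDiff Topology
open MulOpposite (op)
open Diffeology (IsPlot DSmooth dTopology)

universe u

namespace NonabelianGerbe

/-! ### Smooth bases

A base space carries a diffeology. For a smooth manifold the plots are the smooth maps from the
Euclidean spaces, and a fibre product of manifolds over a submersion, which is an embedded
submanifold of the product, carries the subspace diffeology: its plots are the smooth maps from
Euclidean spaces into the product that land in it. -/

abbrev Euc (n : ℕ) : Type := EuclideanSpace ℝ (Fin n)

instance subtypeDiffeology {X : Type*} [DiffeologicalSpace X] (P : X → Prop) :
    DiffeologicalSpace {x // P x} where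
  plots n := {p | IsPlot fun v => (p v : X)}
  constant_plots x := DiffeologicalSpace.constant_plots (x : X)
  plot_reparam hp hf := DiffeologicalSpace.plot_reparam (X := X) hp hf
  locality hp := DiffeologicalSpace.locality (X := X) hp

instance prodDiffeology {X Y : Type*} [DiffeologicalSpace X] [DiffeologicalSpace Y] :
    DiffeologicalSpace (X × Y) where
  plots n := {p | IsPlot (fun v => (p v).1) ∧ IsPlot (fun v => (p v).2)}
  constant_plots x := ⟨DiffeologicalSpace.constant_plots x.1,
    DiffeologicalSpace.constant_plots x.2⟩
  plot_reparam hp hf := ⟨DiffeologicalSpace.plot_reparam (X := X) hp.1 hf,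
    DiffeologicalSpace.plot_reparam (X := Y) hp.2 hf⟩
  locality hp := by
    refine ⟨DiffeologicalSpace.locality (X := X) fun x => ?_,
      DiffeologicalSpace.locality (X := Y) fun x => ?_⟩
    · obtain ⟨w, hw, hx, h⟩ := hp x
      exact ⟨w, hw, hx, fun hf hs => (h hf hs).1⟩
    · obtain ⟨w, hw, hx, h⟩ := hp x
      exact ⟨w, hw, hx, fun hf hs => (h hf hs).2⟩

/-- The diffeology on `X` is the one of the smooth manifold `X`. -/
class IsManifoldDiffeology (n : ℕ) (X : Type*) [TopologicalSpace X] [ChartedSpace (Euc n) X]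
    [DiffeologicalSpace X] : Prop where
  isPlot_iff : ∀ {r : ℕ} (p : Euc r → X), IsPlot p ↔ ContMDiff (𝓡 r) (𝓡 n) ∞ p

/-- Every manifold carries a (necessarily unique) diffeology as in `IsManifoldDiffeology`. -/
theorem exists_isManifoldDiffeology (n : ℕ) (X : Type*) [TopologicalSpace X]
    [ChartedSpace (Euc n) X] :
    ∃ d : DiffeologicalSpace X, @IsManifoldDiffeology n X _ _ d := by
  refine ⟨DiffeologicalSpace.ofCorePlotsOn
    { isPlotOn := fun {_ w} _ p => ContMDiffOn (𝓡 _) (𝓡 n) ∞ p w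
      isPlotOn_congr := fun _ _ _ h => contMDiffOn_congr fun y hy => h hy
      isPlot := fun p => ContMDiff (𝓡 _) (𝓡 n) ∞ p
      isPlotOn_univ := contMDiffOn_univ
      isPlot_const := fun _ => contMDiff_const
      isPlotOn_reparam := fun _ _ _ h hp hf => hp.comp hf.contMDiffOn h
      locality := fun _ _ h => fun x hx => by
        obtain ⟨v, hv, hxv, hv'⟩ := h x hx
        exact ((hv' x hxv).contMDiffAt (hv.mem_nhds hxv)).contMDiffWithinAt }, ?_⟩
  exact @IsManifoldDiffeology.mk _ _ _ _ (_) fun p => Iff.rfl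

/-- Smooth maps between base spaces. -/
structure SmoothMap (A B : Type*) [DiffeologicalSpace A] [DiffeologicalSpace B] where
  toFun : A → B
  smooth : DSmooth toFun

instance (A B : Type*) [DiffeologicalSpace A] [DiffeologicalSpace B] :
    CoeFun (SmoothMap A B) fun _ => A → B := ⟨SmoothMap.toFun⟩

section Smooth

variable {A B : Type*} [DiffeologicalSpace A] [DiffeologicalSpace B]

/-- Open subsets of a base space (for a manifold, and for a fibre product over a submersion, these
are the open sets of the usual topology). -/
def DOpen (U : Set B) : Prop := IsOpen[dTopology] U

/-- `g` is a smooth map from the subset `W` of the base to the manifold `G`. -/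
def SmoothOn (k : ℕ) {G : Type*} [TopologicalSpace G] [ChartedSpace (Euc k) G]
    (g : B → G) (W : Set B) : Prop :=
  ∀ (n : ℕ) (p : Euc n → B), IsPlot p → (∀ v, p v ∈ W) →
    ContMDiff (𝓡 n) (𝓡 k) ∞ fun v => g (p v)

/-- `(x, h) ↦ a x h` is a smooth map from `W × H` to the manifold `G`. -/
def SmoothFamilyOn (k m : ℕ) {H G : Type*} [TopologicalSpace H] [ChartedSpace (Euc k) H]
    [TopologicalSpace G] [ChartedSpace (Euc m) G] (a : B → H → G) (W : Set B) : Prop :=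
  ∀ (n : ℕ) (p : Euc n → B) (c : Euc n → H), IsPlot p → (∀ v, p v ∈ W) →
    ContMDiff (𝓡 n) (𝓡 k) ∞ c → ContMDiff (𝓡 n) (𝓡 m) ∞ fun v => a (p v) (c v)

theorem DOpen.inter {U V : Set B} (hU : DOpen U) (hV : DOpen V) : DOpen (U ∩ V) :=
  @IsOpen.inter B dTopology U V hU hV

theorem DOpen.preimage {U : Set B} (hU : DOpen U) (φ : SmoothMap A B) : DOpen (φ ⁻¹' U) :=
  @IsOpen.preimage _ _ dTopology dTopology _ φ.smooth.continuous _ hU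

variable {k m : ℕ} {G H : Type*} [TopologicalSpace G] [ChartedSpace (Euc k) G]
  [TopologicalSpace H] [ChartedSpace (Euc m) H]

theorem SmoothOn.mono {g : B → G} {W W' : Set B} (hg : SmoothOn k g W) (h : W' ⊆ W) :
    SmoothOn k g W' :=
  fun n p hp hW => hg n p hp fun v => h (hW v)

theorem SmoothOn.comp {g : B → G} {W : Set B} (hg : SmoothOn k g W) (φ : SmoothMap A B) :
    SmoothOn k (fun x => g (φ x)) (φ ⁻¹' W) :=
  fun n p hp hW => hg n (fun v => φ (p v)) (φ.smooth n p hp) hW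

theorem SmoothFamilyOn.comp {a : B → H → G} {W : Set B} (ha : SmoothFamilyOn m k a W)
    (φ : SmoothMap A B) : SmoothFamilyOn m k (fun x => a (φ x)) (φ ⁻¹' W) :=
  fun n p c hp hW hc => ha n (fun v => φ (p v)) c (φ.smooth n p hp) hW hc

theorem SmoothFamilyOn.mono {a : B → H → G} {W W' : Set B} (ha : SmoothFamilyOn m k a W)
    (h : W' ⊆ W) : SmoothFamilyOn m k a W' :=
  fun n p c hp hW hc => ha n p c hp (fun v => h (hW v)) hc

theorem SmoothFamilyOn.apply {a : B → H → G} {g : B → H} {W : Set B}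
    (ha : SmoothFamilyOn m k a W) (hg : SmoothOn m g W) : SmoothOn k (fun x => a x (g x)) W :=
  fun n p hp hW => ha n p _ hp hW (hg n p hp hW)

theorem SmoothFamilyOn.apply₂ {l : ℕ} {K : Type*} [TopologicalSpace K] [ChartedSpace (Euc l) K]
    {a : B → H → G} {b : B → K → H} {W : Set B}
    (ha : SmoothFamilyOn m k a W) (hb : SmoothFamilyOn l m b W) :
    SmoothFamilyOn l k (fun x c => a x (b x c)) W :=
  fun n p c hp hW hc => ha n p _ hp hW (hb n p c hp hW hc)

theorem SmoothOn.congr {g g' : B → G} {W : Set B} (hg : SmoothOn k g W)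
    (h : ∀ x ∈ W, g' x = g x) : SmoothOn k g' W := by
  intro n p hp hW
  have : (fun v => g' (p v)) = fun v => g (p v) := funext fun v => h _ (hW v)
  rw [this]
  exact hg n p hp hW

theorem SmoothOn.of_local {g : B → G} {W : Set B}
    (h : ∀ x ∈ W, ∃ V : Set B, DOpen V ∧ x ∈ V ∧ SmoothOn k g (W ∩ V)) : SmoothOn k g W := by
  intro n p hp hW v
  obtain ⟨V, hV, hx, hg⟩ := h (p v) (hW v)
  have ho : IsOpen (p ⁻¹' V) := Diffeology.isOpen_iff_preimages_plots.1 hV n p hp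
  obtain ⟨ε, hε, hsub⟩ := Metric.isOpen_iff.mp ho v hx
  let c := OpenPartialHomeomorph.univBall v ε
  have hc : ∀ w, c w ∈ Metric.ball v ε := fun w => by
    have := c.map_source (x := w) (by simp [c])
    rwa [OpenPartialHomeomorph.univBall_target v hε] at this
  have h1 : ContMDiff (𝓡 n) (𝓡 k) ∞ fun w => g (p (c w)) :=
    hg n (fun w => p (c w))
      (Diffeology.isPlot_reparam hp OpenPartialHomeomorph.contDiff_univBall)
      fun w => ⟨hW _, hsub (hc w)⟩
  have h2 : ContMDiffOn (𝓡 n) (𝓡 n) ∞ c.symm (Metric.ball v ε) :=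
    (OpenPartialHomeomorph.contDiffOn_univBall_symm (c := v) (r := ε)).contMDiffOn
  have h3 : ContMDiffOn (𝓡 n) (𝓡 k) ∞ (fun w => g (p w)) (Metric.ball v ε) := by
    refine (h1.comp_contMDiffOn h2).congr fun w hw => ?_
    have : c (c.symm w) = w :=
      c.right_inv (by rwa [OpenPartialHomeomorph.univBall_target v hε])
    simp [Function.comp, this]
  exact h3.contMDiffAt (Metric.ball_mem_nhds v hε)

end Smooth

/-! ### Principal bundles -/

/-- A section over an open set `dom`; the values outside `dom` are irrelevant. -/
structure LocalSection {B : Type*} [DiffeologicalSpace B] (F : B → Type u) where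
  dom : Set B
  isOpen_dom : DOpen dom
  val : ∀ x, F x

/-- The sections `s` and `t` differ over `W` by a smooth function with values in the group. -/
def SmoothRel (k : ℕ) (G : Type u) [Group G] [TopologicalSpace G] [ChartedSpace (Euc k) G]
    {B : Type*} [DiffeologicalSpace B] {F : B → Type u} [∀ x, MulAction G (F x)]
    (s t : ∀ x, F x) (W : Set B) : Prop :=
  ∃ g : B → G, SmoothOn k g W ∧ ∀ x ∈ W, s x = g x • t x

/-- A left principal `G`-bundle over `B`: fibres on which `G` acts freely and transitively, and
an atlas of local sections over a cover of `B` whose transition functions are smooth. (The local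
section `t` over `U` gives the trivialization `U × G ∋ (x, g) ↦ g • t x`; smoothness on the total
space means smoothness in these trivializations.) -/
structure PrincipalBundle (k : ℕ) (G : Type u) [Group G] [TopologicalSpace G]
    [ChartedSpace (Euc k) G] (B : Type*) [DiffeologicalSpace B] where
  Fiber : B → Type u
  [action : ∀ x, MulAction G (Fiber x)]
  torsor : ∀ x (p q : Fiber x), ∃! g : G, g • q = p
  atlas : Set (LocalSection Fiber)
  cover : ∀ x, ∃ t ∈ atlas, x ∈ t.dom
  transition : ∀ s ∈ atlas, ∀ t ∈ atlas, SmoothRel k G s.val t.val (s.dom ∩ t.dom)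

attribute [instance] PrincipalBundle.action

/-- A left principal `D`-bundle with a smooth fibre preserving right `H`-action which commutes with
the left `D`-action. The right action `q ◁ h` is written `op h • q`. -/
structure RightBundle (m : ℕ) (D : Type u) [Group D] [TopologicalSpace D] [ChartedSpace (Euc m) D]
    (k : ℕ) (H : Type u) [Group H] [TopologicalSpace H] [ChartedSpace (Euc k) H]
    (B : Type*) [DiffeologicalSpace B] extends PrincipalBundle m D B where
  [rightAction : ∀ x, MulAction Hᵐᵒᵖ (Fiber x)]
  [smulComm : ∀ x, SMulCommClass D Hᵐᵒᵖ (Fiber x)]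
  right_smooth : ∀ t ∈ atlas, ∃ a : B → H → D, SmoothFamilyOn k m a t.dom ∧
    ∀ x ∈ t.dom, ∀ h : H, op h • t.val x = a x h • t.val x

attribute [instance] RightBundle.rightAction RightBundle.smulComm

/-- A principal `H`-bibundle: both a left and a right principal bundle, with commuting actions. -/
structure Bibundle (k : ℕ) (H : Type u) [Group H] [TopologicalSpace H] [ChartedSpace (Euc k) H]
    (B : Type*) [DiffeologicalSpace B] extends RightBundle k H k H B where
  right_torsor : ∀ x (p q : Fiber x), ∃! h : H, op h • q = p
  left_smooth : ∀ t ∈ atlas, ∃ b : B → H → H, SmoothFamilyOn k k b t.dom ∧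
    ∀ x ∈ t.dom, ∀ h : H, h • t.val x = op (b x h) • t.val x

/-- A Lie crossed module: `H` is a crossed `D`-module. -/
structure CrossedModule (k : ℕ) (H : Type u) [Group H] [TopologicalSpace H]
    [ChartedSpace (Euc k) H] (m : ℕ) (D : Type u) [Group D] [TopologicalSpace D]
    [ChartedSpace (Euc m) D] where
  α : H →* D
  act : D →* MulAut H
  act_α : ∀ h h' : H, act (α h) h' = h * h' * h⁻¹
  α_act : ∀ (d : D) (h : H), α (act d h) = d * α h * d⁻¹
  smooth_α : ContMDiff (𝓡 k) (𝓡 m) ∞ α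
  smooth_act : ContMDiff ((𝓡 m).prod (𝓡 k)) (𝓡 k) ∞ fun p : D × H => act p.1 p.2

section Structures

variable {k : ℕ} {H : Type u} [Group H] [TopologicalSpace H] [ChartedSpace (Euc k) H]
  {m : ℕ} {D : Type u} [Group D] [TopologicalSpace D] [ChartedSpace (Euc m) D]

/-- A `D`-`H` bundle: a left principal `D`-bundle `Q` with a trivialization of `Aut(H) ×_D Q`. The
global section of `Aut(H) ×_D Q` is given by the smooth `D`-equivariant map `ψ : Q → Aut(H)`,
and the induced right action is `q ◁ h = α(ψ_q(h)) q`. (Smoothness of a map to `Aut(H)` means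
smoothness of the evaluations of the automorphism and of its inverse.) -/
structure DHBundle (X : CrossedModule k H m D) (B : Type*) [DiffeologicalSpace B]
    extends RightBundle m D k H B where
  ψ : ∀ {x}, Fiber x → MulAut H
  ψ_smul : ∀ {x} (d : D) (q : Fiber x), ψ (d • q) = X.act d * ψ q
  right_eq : ∀ {x} (q : Fiber x) (h : H), op h • q = X.α (ψ q h) • q
  ψ_smooth : ∀ t ∈ atlas, SmoothFamilyOn k k (fun x h => ψ (t.val x) h) t.dom
  ψ_inv_smooth : ∀ t ∈ atlas, SmoothFamilyOn k k (fun x h => (ψ (t.val x))⁻¹ h) t.dom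

variable {A B : Type*} [DiffeologicalSpace A] [DiffeologicalSpace B]

/-- A global smooth section. -/
def PrincipalBundle.IsSmoothSection (P : PrincipalBundle m D B) (s : ∀ x, P.Fiber x) : Prop :=
  ∀ t ∈ P.atlas, SmoothRel m D s t.val t.dom

/-- A global central section of a bibundle. -/
def Bibundle.IsCentralSection (E : Bibundle k H B) (s : ∀ x, E.Fiber x) : Prop :=
  E.IsSmoothSection s ∧ ∀ x (h : H), h • s x = op h • s x

/-- A trivial bibundle with a given global central section. -/
structure TrivialBibundle (k : ℕ) (H : Type u) [Group H] [TopologicalSpace H]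
    [ChartedSpace (Euc k) H] (B : Type*) [DiffeologicalSpace B] extends Bibundle k H B where
  sec : ∀ x, Fiber x
  isCentral : toBibundle.IsCentralSection sec

/-- Isomorphisms of bibundles over the identity of the base. -/
structure BibundleIso (E E' : Bibundle k H B) where
  toFun : ∀ {x}, E.Fiber x → E'.Fiber x
  map_smul : ∀ {x} (h : H) (e : E.Fiber x), toFun (h • e) = h • toFun e
  map_op_smul : ∀ {x} (h : H) (e : E.Fiber x), toFun (op h • e) = op h • toFun e
  smooth : ∀ s ∈ E.atlas, ∀ t ∈ E'.atlas,
    SmoothRel k H (fun x => toFun (s.val x)) t.val (s.dom ∩ t.dom)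

/-- Isomorphisms of `D`-`H` bundles over the identity of the base. -/
structure DHIso {X : CrossedModule k H m D} (Q Q' : DHBundle X B) where
  toFun : ∀ {x}, Q.Fiber x → Q'.Fiber x
  map_smul : ∀ {x} (d : D) (q : Q.Fiber x), toFun (d • q) = d • toFun q
  map_ψ : ∀ {x} (q : Q.Fiber x), Q'.ψ (toFun q) = Q.ψ q
  smooth : ∀ s ∈ Q.atlas, ∀ t ∈ Q'.atlas,
    SmoothRel m D (fun x => toFun (s.val x)) t.val (s.dom ∩ t.dom)

/-! ### Pull-backs -/

/-- The pulled back local section. -/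
def LocalSection.pullback {F : B → Type u} (t : LocalSection F) (φ : SmoothMap A B) :
    LocalSection fun x => F (φ x) where
  dom := φ ⁻¹' t.dom
  isOpen_dom := t.isOpen_dom.preimage φ
  val x := t.val (φ x)

theorem SmoothRel.comp {F : B → Type u} [∀ x, MulAction D (F x)] {s t : ∀ x, F x} {W : Set B}
    (h : SmoothRel m D s t W) (φ : SmoothMap A B) :
    SmoothRel m D (F := fun x => F (φ x)) (fun x => s (φ x)) (fun x => t (φ x)) (φ ⁻¹' W) := by
  obtain ⟨g, hg, hst⟩ := h
  exact ⟨fun x => g (φ x), hg.comp φ, fun x hx => hst _ hx⟩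

def PrincipalBundle.pullback (P : PrincipalBundle m D B) (φ : SmoothMap A B) :
    PrincipalBundle m D A where
  Fiber x := P.Fiber (φ x)
  torsor x := P.torsor (φ x)
  atlas := {t' | ∃ t ∈ P.atlas, t' = t.pullback φ}
  cover x := by
    obtain ⟨t, ht, hx⟩ := P.cover (φ x)
    exact ⟨_, ⟨t, ht, rfl⟩, hx⟩
  transition := by
    rintro _ ⟨s, hs, rfl⟩ _ ⟨t, ht, rfl⟩
    exact (P.transition s hs t ht).comp φ

def RightBundle.pullback (P : RightBundle m D k H B) (φ : SmoothMap A B) :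
    RightBundle m D k H A where
  toPrincipalBundle := P.toPrincipalBundle.pullback φ
  rightAction x := P.rightAction (φ x)
  smulComm x := P.smulComm (φ x)
  right_smooth := by
    rintro _ ⟨t, ht, rfl⟩
    obtain ⟨a, ha, h⟩ := P.right_smooth t ht
    exact ⟨fun x => a (φ x), ha.comp φ, fun x hx => h _ hx⟩

def Bibundle.pullback (E : Bibundle k H B) (φ : SmoothMap A B) : Bibundle k H A where
  toRightBundle := E.toRightBundle.pullback φ
  right_torsor x := E.right_torsor (φ x)
  left_smooth := by
    rintro _ ⟨t, ht, rfl⟩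
    obtain ⟨b, hb, h⟩ := E.left_smooth t ht
    exact ⟨fun x => b (φ x), hb.comp φ, fun x hx => h _ hx⟩

def TrivialBibundle.pullback (T : TrivialBibundle k H B) (φ : SmoothMap A B) :
    TrivialBibundle k H A where
  toBibundle := T.toBibundle.pullback φ
  sec x := T.sec (φ x)
  isCentral := by
    refine ⟨?_, fun x => T.isCentral.2 (φ x)⟩
    rintro _ ⟨t, ht, rfl⟩
    exact (T.isCentral.1 t ht).comp φ

def DHBundle.pullback {X : CrossedModule k H m D} (Q : DHBundle X B) (φ : SmoothMap A B) :
    DHBundle X A where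
  toRightBundle := Q.toRightBundle.pullback φ
  ψ {x} q := Q.ψ (x := φ x) q
  ψ_smul {x} := Q.ψ_smul (x := φ x)
  right_eq {x} := Q.right_eq (x := φ x)
  ψ_smooth := by
    rintro _ ⟨t, ht, rfl⟩
    exact (Q.ψ_smooth t ht).comp φ
  ψ_inv_smooth := by
    rintro _ ⟨t, ht, rfl⟩
    exact (Q.ψ_inv_smooth t ht).comp φ

end Structures

/-! ### Products -/

section ProductFiber

variable {H : Type u} [Group H]

/-- The relation `(q, h e) ∼ (q ◁ h, e)`. -/
def prodSetoid (H : Type u) [Group H] (P E : Type u) [MulAction Hᵐᵒᵖ P] [MulAction H E] :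
    Setoid (P × E) where
  r a b := ∃ h : H, b.1 = op h • a.1 ∧ a.2 = h • b.2
  iseqv :=
    { refl := fun a => ⟨1, by simp, by simp⟩
      symm := by
        rintro a b ⟨h, h1, h2⟩
        refine ⟨h⁻¹, ?_, ?_⟩
        · rw [h1, MulOpposite.op_inv, inv_smul_smul]
        · rw [h2, inv_smul_smul]
      trans := by
        rintro a b c ⟨h, h1, h2⟩ ⟨h', h3, h4⟩
        refine ⟨h * h', ?_, ?_⟩
        · rw [h3, h1, MulOpposite.op_mul, mul_smul]
        · rw [h2, h4, mul_smul] }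

/-- The fibre of the product bundle. -/
def ProdFiber (H : Type u) [Group H] (P E : Type u) [MulAction Hᵐᵒᵖ P] [MulAction H E] : Type u :=
  Quotient (prodSetoid H P E)

/-- The class `[q, e]`. -/
def ProdFiber.mk (H : Type u) [Group H] {P E : Type u} [MulAction Hᵐᵒᵖ P] [MulAction H E]
    (q : P) (e : E) : ProdFiber H P E :=
  Quotient.mk (prodSetoid H P E) (q, e)

namespace ProdFiber

variable {P E : Type u} [MulAction Hᵐᵒᵖ P] [MulAction H E]

theorem mk_eq_mk {q q' : P} {e e' : E} :
    mk H q e = mk H q' e' ↔ ∃ h : H, q' = op h • q ∧ e = h • e' :=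
  Quotient.eq (r := prodSetoid H P E)

theorem mk_op_smul (q : P) (h : H) (e : E) : mk H (op h • q) e = mk H q (h • e) :=
  (mk_eq_mk.2 ⟨h, rfl, rfl⟩).symm

theorem ind {p : ProdFiber H P E → Prop} (h : ∀ q e, p (mk H q e)) (a : ProdFiber H P E) : p a :=
  Quotient.ind (fun x => h x.1 x.2) a

/-- Maps out of the product. -/
def lift {β : Type*} (f : P → E → β) (hf : ∀ q (h : H) e, f (op h • q) e = f q (h • e))
    (a : ProdFiber H P E) : β :=
  Quotient.lift (fun x : P × E => f x.1 x.2) (by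
    rintro ⟨q, e⟩ ⟨q', e'⟩ ⟨h, h1, h2⟩
    dsimp only at h1 h2 ⊢
    rw [h1, h2, hf]) a

/-- The left action `d [q, e] = [d q, e]`. -/
instance {D : Type u} [Group D] [MulAction D P] [SMulCommClass D Hᵐᵒᵖ P] :
    MulAction D (ProdFiber H P E) where
  smul d := lift (fun q e => mk H (d • q) e) fun q h e => by rw [smul_comm, mk_op_smul]
  one_smul := ind fun q e => congrArg (fun z => mk H z e) (one_smul D q)
  mul_smul d d' := ind fun q e => congrArg (fun z => mk H z e) (mul_smul d d' q)

theorem smul_mk {D : Type u} [Group D] [MulAction D P] [SMulCommClass D Hᵐᵒᵖ P] (d : D) (q : P)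
    (e : E) : d • mk H q e = mk H (d • q) e := rfl

/-- The right action `[q, e] ◁ k = [q, e ◁ k]`. -/
instance {K : Type u} [Group K] [MulAction Kᵐᵒᵖ E] [SMulCommClass H Kᵐᵒᵖ E] :
    MulAction Kᵐᵒᵖ (ProdFiber H P E) where
  smul d := lift (fun q e => mk H q (d • e)) fun q h e => by rw [mk_op_smul, smul_comm]
  one_smul := ind fun q e => congrArg (fun z => mk H q z) (one_smul Kᵐᵒᵖ e)
  mul_smul d d' := ind fun q e => congrArg (fun z => mk H q z) (mul_smul d d' e)

theorem op_smul_mk {K : Type u} [Group K] [MulAction Kᵐᵒᵖ E] [SMulCommClass H Kᵐᵒᵖ E] (c : Kᵐᵒᵖ)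
    (q : P) (e : E) : c • mk H q e = mk H q (c • e) := rfl

instance {D K : Type u} [Group D] [Group K] [MulAction D P] [SMulCommClass D Hᵐᵒᵖ P]
    [MulAction Kᵐᵒᵖ E] [SMulCommClass H Kᵐᵒᵖ E] : SMulCommClass D Kᵐᵒᵖ (ProdFiber H P E) :=
  ⟨fun _ _ => ind fun _ _ => rfl⟩

end ProdFiber

end ProductFiber

section Products

variable {k : ℕ} {H : Type u} [Group H] [TopologicalSpace H] [ChartedSpace (Euc k) H]
  {l : ℕ} {K : Type u} [Group K] [TopologicalSpace K] [ChartedSpace (Euc l) K]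
  {m : ℕ} {D : Type u} [Group D] [TopologicalSpace D] [ChartedSpace (Euc m) D]
  {B : Type*} [DiffeologicalSpace B]

/-- The product `[s, t]` of local sections. -/
def LocalSection.prod {F F' : B → Type u} [∀ x, MulAction Hᵐᵒᵖ (F x)] [∀ x, MulAction H (F' x)]
    (s : LocalSection F) (t : LocalSection F') :
    LocalSection fun x => ProdFiber H (F x) (F' x) where
  dom := s.dom ∩ t.dom
  isOpen_dom := s.isOpen_dom.inter t.isOpen_dom
  val x := ProdFiber.mk H (s.val x) (t.val x)

theorem SmoothOn.mul [LieGroup (𝓡 m) ∞ D] {f g : B → D} {W : Set B} (hf : SmoothOn m f W)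
    (hg : SmoothOn m g W) : SmoothOn m (fun x => f x * g x) W :=
  fun n p hp hW => (hf n p hp hW).mul (hg n p hp hW)

theorem SmoothOn.inv [LieGroup (𝓡 m) ∞ D] {f : B → D} {W : Set B} (hf : SmoothOn m f W) :
    SmoothOn m (fun x => (f x)⁻¹) W :=
  fun n p hp hW => (hf n p hp hW).inv

/-- If `s = g s'` and `t = h t'` with smooth `g`, `h`, then `[s, t]` is a smooth multiple of
`[s', t']`, where `s'` is a section of the atlas. -/
theorem RightBundle.smoothRel_mk [LieGroup (𝓡 m) ∞ D] (P : RightBundle m D k H B)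
    {F' : B → Type u} [∀ x, MulAction H (F' x)] {s : ∀ x, P.Fiber x} {s' : LocalSection P.Fiber}
    (hs' : s' ∈ P.atlas) {t t' : ∀ x, F' x} {W : Set B} (hW : W ⊆ s'.dom)
    (hs : SmoothRel m D s s'.val W) (ht : SmoothRel k H t t' W) :
    SmoothRel m D (fun x => ProdFiber.mk H (s x) (t x))
      (fun x => ProdFiber.mk H (s'.val x) (t' x)) W := by
  obtain ⟨g, hg, hgs⟩ := hs
  obtain ⟨h, hh, hht⟩ := ht
  obtain ⟨a, ha, hat⟩ := P.right_smooth s' hs'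
  refine ⟨fun x => g x * a x (h x), hg.mul ((ha.mono hW).apply hh), fun x hx => ?_⟩
  change ProdFiber.mk H (s x) (t x) = ProdFiber.mk H ((g x * a x (h x)) • s'.val x) (t' x)
  rw [hgs x hx, hht x hx, mul_smul, ← hat x (hW hx), ← ProdFiber.mk_op_smul,
    (P.smulComm x).smul_comm]

/-- The product of a left `D`-bundle with right `H`-action and a left principal `H`-bundle. -/
def RightBundle.prod [LieGroup (𝓡 m) ∞ D] (P : RightBundle m D k H B)
    (E : PrincipalBundle k H B) : PrincipalBundle m D B where
  Fiber x := ProdFiber H (P.Fiber x) (E.Fiber x)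
  torsor x := by
    refine ProdFiber.ind fun q e => ProdFiber.ind fun q' e' => ?_
    obtain ⟨h, rfl, -⟩ := E.torsor x e e'
    obtain ⟨d, hd, hu⟩ := P.torsor x (op h • q) q'
    refine ⟨d, ?_, fun d' hd' => hu d' ?_⟩
    · change ProdFiber.mk H (d • q') e' = _
      rw [hd, ProdFiber.mk_op_smul]
    · obtain ⟨g, h1, h2⟩ := ProdFiber.mk_eq_mk.1
        (show ProdFiber.mk H (d' • q') e' = ProdFiber.mk H (op h • q) e' by
          rw [ProdFiber.mk_op_smul]; exact hd')
      have : g = 1 := by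
        obtain ⟨_, _, hu'⟩ := E.torsor x e' e'
        rw [hu' g h2.symm, hu' 1 (one_smul _ _)]
      rw [h1, this, MulOpposite.op_one, one_smul]
  atlas := {r | ∃ s ∈ P.atlas, ∃ t ∈ E.atlas, r = s.prod t}
  cover x := by
    obtain ⟨s, hs, hxs⟩ := P.cover x
    obtain ⟨t, ht, hxt⟩ := E.cover x
    exact ⟨_, ⟨s, hs, t, ht, rfl⟩, hxs, hxt⟩
  transition := by
    rintro _ ⟨s, hs, t, ht, rfl⟩ _ ⟨s', hs', t', ht', rfl⟩
    obtain ⟨g, hg, hgs⟩ := P.transition s hs s' hs'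
    obtain ⟨h, hh, hht⟩ := E.transition t ht t' ht'
    exact P.smoothRel_mk hs' (fun x hx => hx.2.1)
      ⟨g, hg.mono fun x hx => ⟨hx.1.1, hx.2.1⟩, fun x hx => hgs x ⟨hx.1.1, hx.2.1⟩⟩
      ⟨h, hh.mono fun x hx => ⟨hx.1.2, hx.2.2⟩, fun x hx => hht x ⟨hx.1.2, hx.2.2⟩⟩

/-- If the second factor has a right `K`-action, so has the product. -/
def RightBundle.prodRight [LieGroup (𝓡 m) ∞ D] (P : RightBundle m D k H B)
    (E : RightBundle k H l K B) : RightBundle m D l K B where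
  toPrincipalBundle := P.prod E.toPrincipalBundle
  rightAction x := inferInstanceAs (MulAction Kᵐᵒᵖ (ProdFiber H (P.Fiber x) (E.Fiber x)))
  smulComm x := inferInstanceAs (SMulCommClass D Kᵐᵒᵖ (ProdFiber H (P.Fiber x) (E.Fiber x)))
  right_smooth := by
    rintro _ ⟨s, hs, t, ht, rfl⟩
    obtain ⟨a, ha, hat⟩ := P.right_smooth s hs
    obtain ⟨b, hb, hbt⟩ := E.right_smooth t ht
    refine ⟨fun x c => a x (b x c), (ha.mono fun x hx => hx.1).apply₂ (hb.mono fun x hx => hx.2),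
      fun x hx c => ?_⟩
    change ProdFiber.mk H (s.val x) (op c • t.val x) = ProdFiber.mk H (a x (b x c) • s.val x) _
    rw [hbt x hx.2, ← ProdFiber.mk_op_smul, hat x hx.1]

/-- The product of two bibundles. -/
def Bibundle.mul [LieGroup (𝓡 k) ∞ H] (E E' : Bibundle k H B) : Bibundle k H B where
  toRightBundle := E.toRightBundle.prodRight E'.toRightBundle
  right_torsor x := by
    refine ProdFiber.ind fun q e => ProdFiber.ind fun q' e' => ?_
    obtain ⟨h, rfl, -⟩ := E.right_torsor x q q'
    obtain ⟨d, hd, hu⟩ := E'.right_torsor x (h • e) e'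
    refine ⟨d, ?_, fun d' hd' => hu d' ?_⟩
    · change ProdFiber.mk H q' (op d • e') = _
      rw [hd, ProdFiber.mk_op_smul]
    · obtain ⟨g, h1, h2⟩ := ProdFiber.mk_eq_mk.1
        (show ProdFiber.mk H q' (op d' • e') = ProdFiber.mk H q' (h • e) by
          rw [← ProdFiber.mk_op_smul]; exact hd')
      have : g = 1 := by
        obtain ⟨_, _, hu'⟩ := E.right_torsor x q' q'
        rw [hu' g h1.symm, hu' 1 (one_smul Hᵐᵒᵖ q')]
      rw [h2, this, one_smul]
  left_smooth := by
    rintro _ ⟨s, hs, t, ht, rfl⟩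
    obtain ⟨a, ha, hat⟩ := E.left_smooth s hs
    obtain ⟨b, hb, hbt⟩ := E'.left_smooth t ht
    refine ⟨fun x c => b x (a x c), (hb.mono fun x hx => hx.2).apply₂ (ha.mono fun x hx => hx.1),
      fun x hx c => ?_⟩
    change ProdFiber.mk H (c • s.val x) (t.val x) = ProdFiber.mk H (s.val x) (op (b x (a x c)) • _)
    rw [hat x hx.1, ProdFiber.mk_op_smul, hbt x hx.2]

/-- The inverse bundle has the same total space: `Flip.mk e` is `e⁻¹`. -/
structure Flip (F : Type u) where
  val : F

/-- `h e⁻¹ = (e ◁ h⁻¹)⁻¹`. -/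
instance {F : Type u} {H : Type u} [Group H] [MulAction Hᵐᵒᵖ F] : MulAction H (Flip F) where
  smul h e := ⟨op h⁻¹ • e.val⟩
  one_smul e := congrArg Flip.mk (by rw [inv_one, MulOpposite.op_one, one_smul])
  mul_smul h h' e := congrArg Flip.mk (by
    rw [mul_inv_rev, MulOpposite.op_mul, mul_smul]; rfl)

/-- `e⁻¹ ◁ h = (h⁻¹ e)⁻¹`. -/
instance {F : Type u} {H : Type u} [Group H] [MulAction H F] : MulAction Hᵐᵒᵖ (Flip F) where
  smul h e := ⟨(MulOpposite.unop h)⁻¹ • e.val⟩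
  one_smul e := congrArg Flip.mk (by rw [MulOpposite.unop_one, inv_one, one_smul])
  mul_smul h h' e := congrArg Flip.mk (by
    rw [MulOpposite.unop_mul, mul_inv_rev, mul_smul]; rfl)

/-- The inverse local section. -/
def LocalSection.flip {F : B → Type u} (t : LocalSection F) : LocalSection fun x => Flip (F x) where
  dom := t.dom
  isOpen_dom := t.isOpen_dom
  val x := ⟨t.val x⟩

theorem Bibundle.smoothRel_flip [LieGroup (𝓡 k) ∞ H] (E : Bibundle k H B) {s : ∀ x, E.Fiber x}
    {t : LocalSection E.Fiber} (ht : t ∈ E.atlas) {W : Set B} (hW : W ⊆ t.dom)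
    (h : SmoothRel k H s t.val W) :
    SmoothRel k H (fun x => Flip.mk (s x)) (fun x => Flip.mk (t.val x)) W := by
  obtain ⟨g, hg, hgs⟩ := h
  obtain ⟨b, hb, hbt⟩ := E.left_smooth t ht
  refine ⟨fun x => (b x (g x))⁻¹, ((hb.mono hW).apply hg).inv, fun x hx => congrArg Flip.mk ?_⟩
  rw [hgs x hx, hbt x (hW hx), inv_inv]

/-- The inverse bibundle. -/
def Bibundle.inv [LieGroup (𝓡 k) ∞ H] (E : Bibundle k H B) : Bibundle k H B where
  Fiber x := Flip (E.Fiber x)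
  torsor x p q := by
    obtain ⟨h, hh, hu⟩ := E.right_torsor x p.val q.val
    refine ⟨h⁻¹, ?_, fun h' hh' => ?_⟩
    · change Flip.mk (op h⁻¹⁻¹ • q.val) = p
      rw [inv_inv, hh]
    · rw [← hu h'⁻¹ (congrArg Flip.val hh'), inv_inv]
  atlas := {r | ∃ t ∈ E.atlas, r = t.flip}
  cover x := by
    obtain ⟨t, ht, hx⟩ := E.cover x
    exact ⟨_, ⟨t, ht, rfl⟩, hx⟩
  transition := by
    rintro _ ⟨s, hs, rfl⟩ _ ⟨t, ht, rfl⟩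
    exact E.smoothRel_flip ht (fun x hx => hx.2) (E.transition s hs t ht)
  rightAction x := inferInstanceAs (MulAction Hᵐᵒᵖ (Flip (E.Fiber x)))
  smulComm x := ⟨fun h c e => congrArg Flip.mk (smul_comm (MulOpposite.unop c)⁻¹
    (op h⁻¹) e.val).symm⟩
  right_smooth := by
    rintro _ ⟨t, ht, rfl⟩
    obtain ⟨b, hb, hbt⟩ := E.left_smooth t ht
    refine ⟨fun x h => (b x h⁻¹)⁻¹, fun n p c hp hW hc => (hb n p _ hp hW hc.inv).inv,
      fun x hx h => congrArg Flip.mk ?_⟩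
    change h⁻¹ • t.val x = op (b x h⁻¹)⁻¹⁻¹ • t.val x
    rw [inv_inv, ← hbt x hx]
  right_torsor x p q := by
    obtain ⟨h, hh, hu⟩ := E.torsor x p.val q.val
    refine ⟨h⁻¹, ?_, fun h' hh' => ?_⟩
    · change Flip.mk (h⁻¹⁻¹ • q.val) = p
      rw [inv_inv, hh]
    · rw [← hu h'⁻¹ (congrArg Flip.val hh'), inv_inv]
  left_smooth := by
    rintro _ ⟨t, ht, rfl⟩
    obtain ⟨a, ha, hat⟩ := E.right_smooth t ht
    refine ⟨fun x h => (a x h⁻¹)⁻¹, fun n p c hp hW hc => (ha n p _ hp hW hc.inv).inv,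
      fun x hx h => congrArg Flip.mk ?_⟩
    change op h⁻¹ • t.val x = (a x h⁻¹)⁻¹⁻¹ • t.val x
    rw [hat x hx, inv_inv]

/-- The product of trivial bibundles, with the product of the sections. -/
def TrivialBibundle.mul [LieGroup (𝓡 k) ∞ H] (T T' : TrivialBibundle k H B) :
    TrivialBibundle k H B where
  toBibundle := T.toBibundle.mul T'.toBibundle
  sec x := ProdFiber.mk H (T.sec x) (T'.sec x)
  isCentral := by
    refine ⟨?_, fun x h => ?_⟩
    · rintro _ ⟨s, hs, t, ht, rfl⟩
      obtain ⟨g, hg, hgs⟩ := T.isCentral.1 s hs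
      obtain ⟨h, hh, hht⟩ := T'.isCentral.1 t ht
      exact T.smoothRel_mk hs (fun x hx => hx.1) ⟨g, hg.mono fun x hx => hx.1,
        fun x hx => hgs x hx.1⟩ ⟨h, hh.mono fun x hx => hx.2, fun x hx => hht x hx.2⟩
    · change ProdFiber.mk H (h • T.sec x) _ = ProdFiber.mk H _ (op h • T'.sec x)
      rw [T.isCentral.2, ← T'.isCentral.2, ProdFiber.mk_op_smul]

/-- The inverse of a trivial bibundle, with the inverse section. -/
def TrivialBibundle.inv [LieGroup (𝓡 k) ∞ H] (T : TrivialBibundle k H B) :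
    TrivialBibundle k H B where
  toBibundle := T.toBibundle.inv
  sec x := ⟨T.sec x⟩
  isCentral := by
    refine ⟨?_, fun x h => congrArg Flip.mk (T.isCentral.2 x h⁻¹).symm⟩
    rintro _ ⟨t, ht, rfl⟩
    exact T.smoothRel_flip ht (fun x hx => hx) (T.isCentral.1 t ht)

/-- The automorphism `φ_e` of `H`, `φ_e(h) e = e ◁ h`. -/
noncomputable def Bibundle.φ (E : Bibundle k H B) {x : B} (e : E.Fiber x) : MulAut H :=
  MulEquiv.ofBijective
    (MonoidHom.mk' (fun h : H => (E.torsor x (op h • e) e).choose) fun h h' => by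
      have key : ∀ c : H, (E.torsor x (op c • e) e).choose • e = op c • e :=
        fun c => (E.torsor x (op c • e) e).choose_spec.1
      refine ((E.torsor x (op (h * h') • e) e).choose_spec.2 _ ?_).symm
      change (_ * _) • e = _
      rw [mul_smul, key h', smul_comm, key h, MulOpposite.op_mul, mul_smul])
    ⟨fun h h' hh => by
      have h1 := (E.torsor x (op h • e) e).choose_spec.1
      have h2 := (E.torsor x (op h' • e) e).choose_spec.1
      have h3 : op h • e = op h' • e := by
        rw [← h1, ← h2]
        exact congrArg (· • e) hh
      obtain ⟨_, _, hu⟩ := E.right_torsor x (op h' • e) e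
      rw [hu h h3, hu h' rfl], fun c => by
      obtain ⟨h, hh, -⟩ := E.right_torsor x (c • e) e
      exact ⟨h, ((E.torsor x (op h • e) e).choose_spec.2 c hh.symm).symm⟩⟩

theorem Bibundle.φ_smul (E : Bibundle k H B) {x : B} (e : E.Fiber x) (h : H) :
    E.φ e h • e = op h • e :=
  (E.torsor x (op h • e) e).choose_spec.1

theorem Bibundle.φ_eq (E : Bibundle k H B) {x : B} {e : E.Fiber x} {h c : H}
    (hc : c • e = op h • e) : E.φ e h = c :=
  ((E.torsor x (op h • e) e).choose_spec.2 c hc).symm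

theorem Bibundle.φ_inv_eq (E : Bibundle k H B) {x : B} {e : E.Fiber x} {h c : H}
    (hc : h • e = op c • e) : (E.φ e)⁻¹ h = c := by
  rw [MulAut.inv_apply, MulEquiv.symm_apply_eq, E.φ_eq hc]

theorem Bibundle.φ_left (E : Bibundle k H B) {x : B} (e : E.Fiber x) (g h : H) :
    E.φ (g • e) h = g * E.φ e h * g⁻¹ := by
  apply E.φ_eq
  rw [mul_smul, inv_smul_smul, mul_smul, E.φ_smul, smul_comm]

/-- The product `Q E` of a `D`-`H` bundle and an `H`-bibundle, with `ψ_[q,e] = ψ_q ∘ φ_e`. -/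
noncomputable def DHBundle.mul [LieGroup (𝓡 m) ∞ D] {X : CrossedModule k H m D}
    (Q : DHBundle X B) (E : Bibundle k H B) : DHBundle X B where
  toRightBundle := Q.toRightBundle.prodRight E.toRightBundle
  ψ {x} := ProdFiber.lift (fun (q : Q.Fiber x) (e : E.Fiber x) => Q.ψ q * E.φ e) fun q h e => by
    ext c
    rw [Q.right_eq, Q.ψ_smul]
    simp only [MulAut.mul_apply]
    rw [X.act_α, E.φ_left, map_mul, map_mul, map_inv]
  ψ_smul {x} d := ProdFiber.ind fun q e => by
    change Q.ψ (d • q) * E.φ e = X.act d * (Q.ψ q * E.φ e)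
    rw [Q.ψ_smul, mul_assoc]
  right_eq {x} := ProdFiber.ind fun q e h => by
    change ProdFiber.mk H q (op h • e) = ProdFiber.mk H (X.α (Q.ψ q (E.φ e h)) • q) e
    rw [← Q.right_eq, ProdFiber.mk_op_smul, E.φ_smul]
  ψ_smooth := by
    rintro _ ⟨s, hs, t, ht, rfl⟩
    obtain ⟨a, ha, hat⟩ := E.right_smooth t ht
    intro n p c hp hW hc
    have := Q.ψ_smooth s hs n p _ hp (fun v => (hW v).1) (ha n p c hp (fun v => (hW v).2) hc)
    refine this.congr fun v => ?_
    change Q.ψ (s.val (p v)) (E.φ (t.val (p v)) (c v)) = _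
    rw [E.φ_eq (hat _ (hW v).2 _).symm]
  ψ_inv_smooth := by
    rintro _ ⟨s, hs, t, ht, rfl⟩
    obtain ⟨b, hb, hbt⟩ := E.left_smooth t ht
    intro n p c hp hW hc
    have := hb n p _ hp (fun v => (hW v).2) (Q.ψ_inv_smooth s hs n p c hp (fun v => (hW v).1) hc)
    refine this.congr fun v => ?_
    change (Q.ψ (s.val (p v)) * E.φ (t.val (p v)))⁻¹ (c v) = _
    rw [mul_inv_rev, MulAut.mul_apply, E.φ_inv_eq (hbt _ (hW v).2 _)]

/-- The function `T → D` belonging to the section of a trivial bibundle: `t = (coord t) sec`. -/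
noncomputable def TrivialBibundle.coord (T : TrivialBibundle m D B) {x : B} (t : T.Fiber x) : D :=
  (T.torsor x t (T.sec x)).choose

theorem TrivialBibundle.coord_smul (T : TrivialBibundle m D B) {x : B} (t : T.Fiber x) :
    T.coord t • T.sec x = t :=
  (T.torsor x t (T.sec x)).choose_spec.1

theorem TrivialBibundle.coord_eq (T : TrivialBibundle m D B) {x : B} {t : T.Fiber x} {d : D}
    (h : d • T.sec x = t) : T.coord t = d :=
  ((T.torsor x t (T.sec x)).choose_spec.2 d h).symm

/-- The product `Z Q` of a trivial `D`-bibundle with central section and a `D`-`H` bundle, with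
`ψ_[z,q] = act (coord z) ∘ ψ_q`. -/
noncomputable def TrivialBibundle.mulDH [LieGroup (𝓡 k) ∞ H] [LieGroup (𝓡 m) ∞ D]
    {X : CrossedModule k H m D} (Z : TrivialBibundle m D B) (Q : DHBundle X B) :
    DHBundle X B where
  toRightBundle := Z.toRightBundle.prodRight Q.toRightBundle
  ψ {x} := ProdFiber.lift (fun (z : Z.Fiber x) (q : Q.Fiber x) => X.act (Z.coord z) * Q.ψ q)
    fun z d q => by
      have : Z.coord (op d • z) = Z.coord z * d := by
        apply Z.coord_eq
        rw [mul_smul, Z.isCentral.2, smul_comm, Z.coord_smul]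
      rw [this, Q.ψ_smul, map_mul, mul_assoc]
  ψ_smul {x} d := ProdFiber.ind fun z q => by
    change X.act (Z.coord (d • z)) * Q.ψ q = X.act d * (X.act (Z.coord z) * Q.ψ q)
    have : Z.coord (d • z) = d * Z.coord z := by
      apply Z.coord_eq
      rw [mul_smul, Z.coord_smul]
    rw [this, map_mul, mul_assoc]
  right_eq {x} := ProdFiber.ind fun z q h => by
    change ProdFiber.mk D z (op h • q) = ProdFiber.mk D (X.α (X.act (Z.coord z) (Q.ψ q h)) • z) q
    rw [Q.right_eq, X.α_act, ← ProdFiber.mk_op_smul]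
    congr 1
    have key : ∀ c : D, op c • z = (Z.coord z * c * (Z.coord z)⁻¹) • z := fun c => by
      have h1 : (Z.coord z)⁻¹ • z = Z.sec x := by
        rw [inv_smul_eq_iff, Z.coord_smul]
      rw [mul_smul, h1, mul_smul, Z.isCentral.2, smul_comm, Z.coord_smul]
    exact key _
  ψ_smooth := by
    rintro _ ⟨s, hs, t, ht, rfl⟩ n p c hp hW hc
    obtain ⟨g, hg, hgs⟩ := Z.isCentral.1 s hs
    have h1 := (hg n p hp fun v => (hW v).1).inv
    have h2 := Q.ψ_smooth t ht n p c hp (fun v => (hW v).2) hc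
    refine (X.smooth_act.comp (h1.prodMk h2)).congr fun v => ?_
    change X.act (Z.coord (s.val (p v))) (Q.ψ (t.val (p v)) (c v)) = _
    rw [Z.coord_eq (d := (g (p v))⁻¹) (by rw [hgs _ (hW v).1, inv_smul_smul])]
    rfl
  ψ_inv_smooth := by
    rintro _ ⟨s, hs, t, ht, rfl⟩ n p c hp hW hc
    obtain ⟨g, hg, hgs⟩ := Z.isCentral.1 s hs
    have h1 := hg n p hp fun v => (hW v).1
    have h2 := X.smooth_act.comp (h1.prodMk hc)
    refine (Q.ψ_inv_smooth t ht n p _ hp (fun v => (hW v).2) h2).congr fun v => ?_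
    change (X.act (Z.coord (s.val (p v))) * Q.ψ (t.val (p v)))⁻¹ (c v) = _
    rw [Z.coord_eq (d := (g (p v))⁻¹) (by rw [hgs _ (hW v).1, inv_smul_smul]), mul_inv_rev,
      MulAut.mul_apply, map_inv, inv_inv]
    rfl

/-- The class `[e, e']` in a product of bibundles. -/
def Bibundle.mkMul [LieGroup (𝓡 k) ∞ H] {E E' : Bibundle k H B} {x : B} (e : E.Fiber x)
    (e' : E'.Fiber x) : (E.mul E').Fiber x := ProdFiber.mk H e e'

/-- The point `e⁻¹` of the inverse bibundle. -/
def Bibundle.mkInv [LieGroup (𝓡 k) ∞ H] {E : Bibundle k H B} {x : B} (e : E.Fiber x) :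
    E.inv.Fiber x := ⟨e⟩

/-- The class `[q, e]` in `Q E`. -/
def DHBundle.mkMul [LieGroup (𝓡 m) ∞ D] {X : CrossedModule k H m D} {Q : DHBundle X B}
    {E : Bibundle k H B} {x : B} (q : Q.Fiber x) (e : E.Fiber x) : (Q.mul E).Fiber x :=
  ProdFiber.mk H q e

/-- The class `[z, q]` in `Z Q`. -/
def TrivialBibundle.mkMulDH [LieGroup (𝓡 k) ∞ H] [LieGroup (𝓡 m) ∞ D]
    {X : CrossedModule k H m D} {Z : TrivialBibundle m D B} {Q : DHBundle X B} {x : B}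
    (z : Z.Fiber x) (q : Q.Fiber x) : (Z.mulDH Q).Fiber x :=
  ProdFiber.mk D z q

end Products

/-! ### Isomorphisms of `D`-`H` bundles -/

section Iso

variable {k : ℕ} {H : Type u} [Group H] [TopologicalSpace H] [ChartedSpace (Euc k) H]
  {m : ℕ} {D : Type u} [Group D] [TopologicalSpace D] [ChartedSpace (Euc m) D]
  {B : Type*} [DiffeologicalSpace B] {X : CrossedModule k H m D}

def DHIso.refl (Q : DHBundle X B) : DHIso Q Q where
  toFun q := q
  map_smul _ _ := rfl
  map_ψ _ := rfl
  smooth s hs t ht := Q.transition s hs t ht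

def DHIso.trans [LieGroup (𝓡 m) ∞ D] {Q Q' Q'' : DHBundle X B} (a : DHIso Q Q') (b : DHIso Q' Q'') : DHIso Q Q'' where
  toFun q := b.toFun (a.toFun q)
  map_smul d q := by rw [a.map_smul, b.map_smul]
  map_ψ q := by rw [b.map_ψ, a.map_ψ]
  smooth s hs t ht := by
    have hex : ∀ x, ∃ d : D, d • t.val x = b.toFun (a.toFun (s.val x)) := fun x =>
      (Q''.torsor x _ _).exists
    choose g hg using hex
    refine ⟨g, SmoothOn.of_local fun x hx => ?_, fun x _ => (hg x).symm⟩
    obtain ⟨r, hr, hxr⟩ := Q'.cover x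
    obtain ⟨g₁, h₁, e₁⟩ := a.smooth s hs r hr
    obtain ⟨g₂, h₂, e₂⟩ := b.smooth r hr t ht
    refine ⟨r.dom, r.isOpen_dom, hxr, SmoothOn.congr (g := fun y => g₁ y * g₂ y)
      ((h₁.mono fun y hy => ⟨hy.1.1, hy.2⟩).mul (h₂.mono fun y hy => ⟨hy.2, hy.1.2⟩))
      fun y hy => ?_⟩
    obtain ⟨_, _, hu⟩ := Q''.torsor y (b.toFun (a.toFun (s.val y))) (t.val y)
    have e₂' : b.toFun (r.val y) = g₂ y • t.val y := e₂ y ⟨hy.2, hy.1.2⟩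
    have e₁' : a.toFun (s.val y) = g₁ y • r.val y := e₁ y ⟨hy.1.1, hy.2⟩
    rw [hu (g y) (hg y)]
    refine (hu (g₁ y * g₂ y) ?_).symm
    change (g₁ y * g₂ y) • t.val y = _
    rw [e₁', b.map_smul, e₂', mul_smul]

theorem DHIso.bijective {Q Q' : DHBundle X B} (a : DHIso Q Q') (x : B) :
    Function.Bijective (a.toFun (x := x)) := by
  obtain ⟨t, -, -⟩ := Q.cover x
  constructor
  · intro p q h
    obtain ⟨d, hd, -⟩ := Q.torsor x p q
    obtain ⟨_, _, hu⟩ := Q'.torsor x (a.toFun q) (a.toFun q)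
    have h1 : d • a.toFun q = a.toFun q := by rw [← a.map_smul, ← h]; exact congrArg a.toFun hd
    have : d = 1 := by rw [hu d h1, hu 1 (one_smul _ _)]
    have hd' : d • q = p := hd
    rw [← hd', this, one_smul]
  · intro q
    obtain ⟨d, hd, -⟩ := Q'.torsor x q (a.toFun (t.val x))
    exact ⟨d • t.val x, by rw [a.map_smul]; exact hd⟩

noncomputable def DHIso.symm [LieGroup (𝓡 m) ∞ D] {Q Q' : DHBundle X B} (a : DHIso Q Q') : DHIso Q' Q where
  toFun {x} := (Equiv.ofBijective _ (a.bijective x)).symm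
  map_smul {x} d q := by
    rw [Equiv.symm_apply_eq]
    change _ = a.toFun _
    rw [a.map_smul]
    exact congrArg _ ((Equiv.ofBijective _ (a.bijective x)).apply_symm_apply q).symm
  map_ψ {x} q := by
    rw [← a.map_ψ]
    exact congrArg _ ((Equiv.ofBijective _ (a.bijective x)).apply_symm_apply q)
  smooth s hs t ht := by
    obtain ⟨g, hg, h⟩ := a.smooth t ht s hs
    refine ⟨fun x => (g x)⁻¹, (hg.mono fun x hx => ⟨hx.2, hx.1⟩).inv, fun x hx => ?_⟩
    have h' : a.toFun (t.val x) = g x • s.val x := h x ⟨hx.2, hx.1⟩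
    rw [Equiv.symm_apply_eq]
    change _ = a.toFun _
    rw [a.map_smul, h', inv_smul_smul]

theorem DHIso.apply_symm [LieGroup (𝓡 m) ∞ D] {Q Q' : DHBundle X B} (a : DHIso Q Q') {x : B} (q : Q'.Fiber x) :
    a.toFun (a.symm.toFun q) = q :=
  (Equiv.ofBijective _ (a.bijective x)).apply_symm_apply q

end Iso

/-! ### Fibre products over `M` -/

section FibreProducts

variable {M : Type*} {A Y Y' : Type*} [DiffeologicalSpace A] [DiffeologicalSpace Y]
  [DiffeologicalSpace Y']

/-- `Y ×_M Y'`. -/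
abbrev FibreProduct (π : Y → M) (π' : Y' → M) := {p : Y × Y' // π p.1 = π' p.2}

/-- `Y^[2]`. -/
abbrev Y2 (π : Y → M) := FibreProduct π π

/-- `Y^[3]`. -/
abbrev Y3 (π : Y → M) := {p : Y × Y × Y // π p.1 = π p.2.1 ∧ π p.2.1 = π p.2.2}

/-- The projection of `Y ×_M Y'` to `M`. -/
def FibreProduct.proj (π : Y → M) (π' : Y' → M) : FibreProduct π π' → M := fun p => π p.1.1

variable {π : Y → M}

def p₁ : SmoothMap (Y2 π) Y := ⟨fun p => p.1.1, fun _ _ hp => hp.1⟩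

def p₂ : SmoothMap (Y2 π) Y := ⟨fun p => p.1.2, fun _ _ hp => hp.2⟩

def p₁₂ : SmoothMap (Y3 π) (Y2 π) :=
  ⟨fun p => ⟨(p.1.1, p.1.2.1), p.2.1⟩, fun _ _ hp => ⟨hp.1, hp.2.1⟩⟩

def p₂₃ : SmoothMap (Y3 π) (Y2 π) :=
  ⟨fun p => ⟨(p.1.2.1, p.1.2.2), p.2.2⟩, fun _ _ hp => ⟨hp.2.1, hp.2.2⟩⟩

def p₁₃ : SmoothMap (Y3 π) (Y2 π) :=
  ⟨fun p => ⟨(p.1.1, p.1.2.2), p.2.1.trans p.2.2⟩, fun _ _ hp => ⟨hp.1, hp.2.2⟩⟩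

/-- Smooth maps over `M`. -/
structure MapOver (πA : A → M) (π : Y → M) extends SmoothMap A Y where
  comm : ∀ a, π (toFun a) = πA a

/-- The induced map `A^[2] → Y^[2]`. -/
def MapOver.two {πA : A → M} (q : MapOver πA π) : SmoothMap (Y2 πA) (Y2 π) where
  toFun a := ⟨(q.toFun a.1.1, q.toFun a.1.2), by
    rw [q.comm, q.comm]; exact a.2⟩
  smooth n p hp := ⟨q.smooth n _ hp.1, q.smooth n _ hp.2⟩

/-- The induced map `A^[3] → Y^[3]`. -/
def MapOver.three {πA : A → M} (q : MapOver πA π) : SmoothMap (Y3 πA) (Y3 π) where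
  toFun a := ⟨(q.toFun a.1.1, q.toFun a.1.2.1, q.toFun a.1.2.2), by
    rw [q.comm, q.comm, q.comm]; exact a.2⟩
  smooth n p hp := ⟨q.smooth n _ hp.1, q.smooth n _ hp.2.1, q.smooth n _ hp.2.2⟩

/-- The projection `Y ×_M Y' → Y`. -/
def FibreProduct.fst (π : Y → M) (π' : Y' → M) : MapOver (FibreProduct.proj π π') π where
  toFun p := p.1.1
  smooth _ _ hp := hp.1
  comm _ := rfl

/-- The projection `Y ×_M Y' → Y'`. -/
def FibreProduct.snd (π : Y → M) (π' : Y' → M) : MapOver (FibreProduct.proj π π') π' where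
  toFun p := p.1.2
  smooth _ _ hp := hp.2
  comm p := p.2.symm

end FibreProducts

/-! ### Bundle gerbes -/

section Gerbes

variable {k : ℕ} {H : Type u} [Group H] [TopologicalSpace H] [ChartedSpace (Euc k) H]
  [LieGroup (𝓡 k) ∞ H]
  {m : ℕ} {D : Type u} [Group D] [TopologicalSpace D] [ChartedSpace (Euc m) D]
  [LieGroup (𝓡 m) ∞ D]
  {M : Type*} {A Y Y' : Type*} [DiffeologicalSpace A] [DiffeologicalSpace Y]
  [DiffeologicalSpace Y'] {πA : A → M} {π : Y → M} {π' : Y' → M}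

/-- The bibundle `T = E₁₂ E₂₃ E₁₃⁻¹` on `Y^[3]`. -/
def Bibundle.T (E : Bibundle k H (Y2 π)) : Bibundle k H (Y3 π) :=
  ((E.pullback p₁₂).mul (E.pullback p₂₃)).mul (E.pullback p₁₃).inv

/-- For a section `f⁻¹` of `T`: the isomorphism `E₁₂ E₂₃ → E₁₃` determined by `f⁻¹` maps
`[e₁₂, e₂₃]` to `e₁₃`. -/
def Bibundle.Composes (E : Bibundle k H (Y2 π)) (fInv : ∀ y, E.T.Fiber y) {y₁ y₂ y₃ : Y}
    (h₁₂ : π y₁ = π y₂) (h₂₃ : π y₂ = π y₃) (e₁₂ : E.Fiber ⟨(y₁, y₂), h₁₂⟩)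
    (e₂₃ : E.Fiber ⟨(y₂, y₃), h₂₃⟩) (e₁₃ : E.Fiber ⟨(y₁, y₃), h₁₂.trans h₂₃⟩) : Prop :=
  fInv ⟨(y₁, y₂, y₃), h₁₂, h₂₃⟩ =
    Bibundle.mkMul (E := (E.pullback p₁₂).mul (E.pullback p₂₃)) (E' := (E.pullback p₁₃).inv)
      (x := ⟨(y₁, y₂, y₃), h₁₂, h₂₃⟩)
      (Bibundle.mkMul (E := E.pullback p₁₂) (E' := E.pullback p₂₃)
        (x := ⟨(y₁, y₂, y₃), h₁₂, h₂₃⟩) e₁₂ e₂₃)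
      (Bibundle.mkInv (E := E.pullback p₁₃) (x := ⟨(y₁, y₂, y₃), h₁₂, h₂₃⟩) e₁₃)

/-- An `H`-bundle gerbe `(E, Y, M, f)`. A global central section `f` of `T⁻¹` is the same as the
global central section `f⁻¹` of `T` (the total spaces of `T` and `T⁻¹` agree), and the cocycle
condition `f₁₂₄ φ₁₂(f₂₃₄) = f₁₃₄ f₁₂₃` is the associativity of the isomorphism
`E₁₂ E₂₃ → E₁₃` determined by `f`. -/
structure BundleGerbe (k : ℕ) (H : Type u) [Group H] [TopologicalSpace H]
    [ChartedSpace (Euc k) H] [LieGroup (𝓡 k) ∞ H] {M Y : Type*} [DiffeologicalSpace Y]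
    (π : Y → M) where
  E : Bibundle k H (Y2 π)
  fInv : ∀ y, E.T.Fiber y
  isCentral : E.T.IsCentralSection fInv
  cocycle : ∀ {y₁ y₂ y₃ y₄ : Y} (h₁₂ : π y₁ = π y₂) (h₂₃ : π y₂ = π y₃) (h₃₄ : π y₃ = π y₄)
    (e₁₂ : E.Fiber ⟨(y₁, y₂), h₁₂⟩) (e₂₃ : E.Fiber ⟨(y₂, y₃), h₂₃⟩)
    (e₃₄ : E.Fiber ⟨(y₃, y₄), h₃₄⟩) (e₁₃ : E.Fiber ⟨(y₁, y₃), h₁₂.trans h₂₃⟩)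
    (e₂₄ : E.Fiber ⟨(y₂, y₄), h₂₃.trans h₃₄⟩)
    (e₁₄ : E.Fiber ⟨(y₁, y₄), (h₁₂.trans h₂₃).trans h₃₄⟩),
    E.Composes fInv h₁₂ h₂₃ e₁₂ e₂₃ e₁₃ → E.Composes fInv h₂₃ h₃₄ e₂₃ e₃₄ e₂₄ →
    E.Composes fInv (h₁₂.trans h₂₃) h₃₄ e₁₃ e₃₄ e₁₄ →
    E.Composes fInv h₁₂ (h₂₃.trans h₃₄) e₁₂ e₂₄ e₁₄

/-- The pull-back of a bundle gerbe. -/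
def BundleGerbe.pullback (G : BundleGerbe k H π) (q : MapOver πA π) : BundleGerbe k H πA where
  E := G.E.pullback q.two
  fInv y := G.fInv (q.three y)
  isCentral := by
    refine ⟨?_, fun y => G.isCentral.2 (q.three y)⟩
    rintro _ ⟨_, ⟨_, ⟨_, ⟨r, hr, rfl⟩, rfl⟩, _, ⟨_, ⟨s, hs, rfl⟩, rfl⟩, rfl⟩,
      _, ⟨_, ⟨_, ⟨t, ht, rfl⟩, rfl⟩, rfl⟩, rfl⟩
    exact (G.isCentral.1 _ ⟨_, ⟨_, ⟨r, hr, rfl⟩, _, ⟨s, hs, rfl⟩, rfl⟩,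
      _, ⟨_, ⟨t, ht, rfl⟩, rfl⟩, rfl⟩).comp q.three
  cocycle h₁₂ h₂₃ h₃₄ := G.cocycle (by rw [q.comm, q.comm, h₁₂]) (by rw [q.comm, q.comm, h₂₃])
    (by rw [q.comm, q.comm, h₃₄])

/-- For an isomorphism `ι : N₁ E' N₂⁻¹ → η E` with a trivial bibundle `η`: the isomorphism
`N₁ E' N₂⁻¹ → E` determined by `ι` and the section of `η` maps `[n₁, e', n₂⁻¹]` to `e`. -/
def Transfers {E E' : Bibundle k H (Y2 π)} {N : Bibundle k H Y} {η : TrivialBibundle k H (Y2 π)}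
    (ι : BibundleIso (((N.pullback p₁).mul E').mul (N.pullback p₂).inv) (η.toBibundle.mul E))
    {y₁ y₂ : Y} (h : π y₁ = π y₂) (n₁ : N.Fiber y₁) (e' : E'.Fiber ⟨(y₁, y₂), h⟩)
    (n₂ : N.Fiber y₂) (e : E.Fiber ⟨(y₁, y₂), h⟩) : Prop :=
  ι.toFun (x := ⟨(y₁, y₂), h⟩)
    (Bibundle.mkMul (E := (N.pullback p₁).mul E') (E' := (N.pullback p₂).inv)
      (x := ⟨(y₁, y₂), h⟩)
      (Bibundle.mkMul (E := N.pullback p₁) (E' := E') (x := ⟨(y₁, y₂), h⟩) n₁ e')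
      (Bibundle.mkInv (E := N.pullback p₂) (x := ⟨(y₁, y₂), h⟩) n₂)) =
    Bibundle.mkMul (E := η.toBibundle) (E' := E) (x := ⟨(y₁, y₂), h⟩) (η.sec ⟨(y₁, y₂), h⟩) e

/-- A stable isomorphism `N₁ E' N₂⁻¹ = η E` of bundle gerbes over the same `Y → M`, with a bibundle
`N` on `Y` and a trivial bibundle `η` on `Y^[2]` with section `ℓ⁻¹`. -/
structure StableIsoOver (G G' : BundleGerbe k H π) where
  N : Bibundle k H Y
  η : TrivialBibundle k H (Y2 π)
  ι : BibundleIso (((N.pullback p₁).mul G'.E).mul (N.pullback p₂).inv) (η.toBibundle.mul G.E)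
  /-- With the section `ℓ⁻¹` of `η`, the identification `ι` determines isomorphisms
  `N₁ E' N₂⁻¹ → E`, and the condition `φ₁(f') = ℓ₁₃⁻¹ f φ₁₂(ℓ₂₃) ℓ₁₂` says that these
  isomorphisms are compatible with the products `f'` of `E'` and `f` of `E`. -/
  compat : ∀ {y₁ y₂ y₃ : Y} (h₁₂ : π y₁ = π y₂) (h₂₃ : π y₂ = π y₃)
    (n₁ : N.Fiber y₁) (n₂ : N.Fiber y₂) (n₃ : N.Fiber y₃)
    (e'₁₂ : G'.E.Fiber ⟨(y₁, y₂), h₁₂⟩) (e'₂₃ : G'.E.Fiber ⟨(y₂, y₃), h₂₃⟩)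
    (e'₁₃ : G'.E.Fiber ⟨(y₁, y₃), h₁₂.trans h₂₃⟩)
    (e₁₂ : G.E.Fiber ⟨(y₁, y₂), h₁₂⟩) (e₂₃ : G.E.Fiber ⟨(y₂, y₃), h₂₃⟩)
    (e₁₃ : G.E.Fiber ⟨(y₁, y₃), h₁₂.trans h₂₃⟩),
    Transfers ι h₁₂ n₁ e'₁₂ n₂ e₁₂ → Transfers ι h₂₃ n₂ e'₂₃ n₃ e₂₃ →
    G'.E.Composes G'.fInv h₁₂ h₂₃ e'₁₂ e'₂₃ e'₁₃ → G.E.Composes G.fInv h₁₂ h₂₃ e₁₂ e₂₃ e₁₃ →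
    Transfers ι (h₁₂.trans h₂₃) n₁ e'₁₃ n₃ e₁₃

/-- A stable isomorphism of bundle gerbes `(E, Y, M, f)` and `(E', Y', M, f')`: a bibundle `N` on
`Z = Y ×_M Y'` and a trivial bibundle `η` on `Z^[2]` with `N₁ q'^*E' N₂⁻¹ = η q^*E`, compatible with
`q'^*f'` and `q^*f`. -/
abbrev StableIso (G : BundleGerbe k H π) (G' : BundleGerbe k H π') :=
  StableIsoOver (G.pullback (FibreProduct.fst π π')) (G'.pullback (FibreProduct.snd π π'))

/-! ### Modules -/

variable {X : CrossedModule k H m D}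

/-- For an isomorphism `κ : Q₁ E → Z Q₂` with a trivial bibundle `Z`: the isomorphism `Q₁ E → Q₂`
determined by `κ` and the section of `Z` maps `[q₁, e]` to `q₂`. -/
def Acts {E : Bibundle k H (Y2 π)} {Q : DHBundle X Y} {Z : TrivialBibundle m D (Y2 π)}
    (κ : DHIso ((Q.pullback p₁).mul E) (Z.mulDH (Q.pullback p₂)))
    {y₁ y₂ : Y} (h : π y₁ = π y₂) (q₁ : Q.Fiber y₁) (e : E.Fiber ⟨(y₁, y₂), h⟩)
    (q₂ : Q.Fiber y₂) : Prop :=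
  κ.toFun (x := ⟨(y₁, y₂), h⟩)
    (DHBundle.mkMul (Q := Q.pullback p₁) (E := E) (x := ⟨(y₁, y₂), h⟩) q₁ e) =
    TrivialBibundle.mkMulDH (Z := Z) (Q := Q.pullback p₂) (x := ⟨(y₁, y₂), h⟩)
      (Z.sec ⟨(y₁, y₂), h⟩) q₂

/-- The conditions that make `(Q, Z, z)` a module, where `Z` is a trivial `D`-bibundle on `Y^[2]` and
`z⁻¹` is its central section: an identification `Q₁ E = Z Q₂` of `D`-`H` bundles (it respects `ψ`,
which is the condition `φ₁₂ = ψ₁⁻¹ ∘ act(z̄₁₂⁻¹) ∘ ψ₂`) which is compatible with the product of the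
gerbe: the condition `z₂₃ z₁₂ = z₁₃ ξ₁(f)` says that the two isomorphisms `Q₁ E₁₂ E₂₃ → Q₃`
given by `z` and `f` agree. -/
structure ModuleStructure (G : BundleGerbe k H π) (Q : DHBundle X Y)
    (Z : TrivialBibundle m D (Y2 π)) where
  κ : DHIso ((Q.pullback p₁).mul G.E) (Z.mulDH (Q.pullback p₂))
  compat : ∀ {y₁ y₂ y₃ : Y} (h₁₂ : π y₁ = π y₂) (h₂₃ : π y₂ = π y₃)
    (q₁ : Q.Fiber y₁) (q₂ : Q.Fiber y₂) (q₃ : Q.Fiber y₃)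
    (e₁₂ : G.E.Fiber ⟨(y₁, y₂), h₁₂⟩) (e₂₃ : G.E.Fiber ⟨(y₂, y₃), h₂₃⟩)
    (e₁₃ : G.E.Fiber ⟨(y₁, y₃), h₁₂.trans h₂₃⟩),
    Acts κ h₁₂ q₁ e₁₂ q₂ → Acts κ h₂₃ q₂ e₂₃ q₃ → G.E.Composes G.fInv h₁₂ h₂₃ e₁₂ e₂₃ e₁₃ →
    Acts κ (h₁₂.trans h₂₃) q₁ e₁₃ q₃

/-- A module `(Q, Z, z)` of a bundle gerbe. -/
structure GerbeModule (X : CrossedModule k H m D) (G : BundleGerbe k H π) where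
  Q : DHBundle X Y
  Z : TrivialBibundle m D (Y2 π)
  str : ModuleStructure G Q Z

/-- Equivalence of modules: an isomorphism of `D`-`H` bundles that intertwines the isomorphisms
`z : Q₁ E → Q₂` and `z' : Q'₁ E → Q'₂`. -/
def GerbeModule.Equivalent {G : BundleGerbe k H π} (L L' : GerbeModule X G) : Prop :=
  ∃ a : DHIso L.Q L'.Q, ∀ {y₁ y₂ : Y} (h : π y₁ = π y₂) (q₁ : L.Q.Fiber y₁)
    (e : G.E.Fiber ⟨(y₁, y₂), h⟩) (q₂ : L.Q.Fiber y₂),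
    Acts L.str.κ h q₁ e q₂ ↔ Acts L'.str.κ h (a.toFun q₁) e (a.toFun q₂)

instance GerbeModule.setoid (X : CrossedModule k H m D) (G : BundleGerbe k H π) :
    Setoid (GerbeModule X G) where
  r := GerbeModule.Equivalent
  iseqv :=
    { refl := fun L => ⟨DHIso.refl L.Q, fun _ _ _ _ => Iff.rfl⟩
      symm := by
        rintro L L' ⟨a, ha⟩
        refine ⟨a.symm, fun h q₁ e q₂ => ?_⟩
        rw [ha, a.apply_symm, a.apply_symm]
      trans := by
        rintro L L' L'' ⟨a, ha⟩ ⟨b, hb⟩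
        exact ⟨a.trans b, fun h q₁ e q₂ => (ha h q₁ e q₂).trans (hb h _ e _)⟩ }

/-- The equivalence classes of modules. -/
abbrev ModuleClass (X : CrossedModule k H m D) (G : BundleGerbe k H π) : Type _ :=
  Quotient (GerbeModule.setoid X G)

/-- The pull-back of a module to a module of the pulled back gerbe. -/
noncomputable def GerbeModule.pullback {G : BundleGerbe k H π} (L : GerbeModule X G)
    (q : MapOver πA π) : GerbeModule X (G.pullback q) where
  Q := L.Q.pullback q.toSmoothMap
  Z := L.Z.pullback q.two
  str :=
    { κ :=
        { toFun := fun {x} => L.str.κ.toFun (x := q.two x)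
          map_smul := fun {x} => L.str.κ.map_smul (x := q.two x)
          map_ψ := fun {x} => L.str.κ.map_ψ (x := q.two x)
          smooth := by
            rintro _ ⟨_, ⟨_, ⟨s, hs, rfl⟩, rfl⟩, _, ⟨t, ht, rfl⟩, rfl⟩
              _ ⟨_, ⟨r, hr, rfl⟩, _, ⟨_, ⟨s', hs', rfl⟩, rfl⟩, rfl⟩
            exact (L.str.κ.smooth _ ⟨_, ⟨s, hs, rfl⟩, t, ht, rfl⟩
              _ ⟨r, hr, _, ⟨s', hs', rfl⟩, rfl⟩).comp q.two }
      compat := fun h₁₂ h₂₃ => L.str.compat (by rw [q.comm, q.comm, h₁₂])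
        (by rw [q.comm, q.comm, h₂₃]) }

/-- `(Ξ, τ)` is the trivial `D`-bibundle `ξ(T)` of a trivial `H`-bibundle `(T, t)`:
`Q T = Ξ Q` in such a way that `q t = τ q`. -/
def IsXi {B : Type*} [DiffeologicalSpace B] (Q : DHBundle X B) (T : TrivialBibundle k H B)
    (Ξ : TrivialBibundle m D B) : Prop :=
  ∃ w : DHIso (Q.mul T.toBibundle) (Ξ.mulDH Q), ∀ (x : B) (q : Q.Fiber x),
    w.toFun (DHBundle.mkMul (E := T.toBibundle) q (T.sec x)) =
      TrivialBibundle.mkMulDH (Ξ.sec x) q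

section Transform

variable {G G' : BundleGerbe k H π} (S : StableIsoOver G G') (L : GerbeModule X G)
  (I : TrivialBibundle m D Y)

/-- The transformed bundle `I Q N`. -/
noncomputable def transformQ : DHBundle X Y := (I.mulDH L.Q).mul S.N

/-- The transformed trivial bibundle `Z'₁₂ = I₁ ξ₁(η₁₂) Z₁₂ I₂⁻¹`, where `Ξ` is `ξ₁(η₁₂)`, with the
section `z'₁₂⁻¹ = i₁⁻¹ ξ₁(ℓ₁₂⁻¹) z₁₂⁻¹ i₂`; here the section of `I` is `i⁻¹`. -/
def transformZ (Ξ : TrivialBibundle m D (Y2 π)) : TrivialBibundle m D (Y2 π) :=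
  (((I.pullback p₁).mul Ξ).mul L.Z).mul (I.pullback p₂).inv

/-- The point `[[i⁻¹, q], n]` of `I Q N`. -/
noncomputable def transformMk {y : Y} (q : L.Q.Fiber y) (n : S.N.Fiber y) :
    (transformQ S L I).Fiber y :=
  DHBundle.mkMul (Q := I.mulDH L.Q) (E := S.N)
    (TrivialBibundle.mkMulDH (Z := I) (Q := L.Q) (I.sec y) q) n

/-- The identification `(I Q N)₁ E' = Z' (I Q N)₂` is the one induced by
`I₁ Q₁ N₁ E' = I₁ Q₁ η E N₂ = I₁ ξ₁(η) Q₁ E N₂ = I₁ ξ₁(η) Z Q₂ N₂ = Z' I₂ Q₂ N₂`: if `q₁ e = z⁻¹ q₂`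
and `n₁ e' n₂⁻¹ = ℓ⁻¹ e`, then `(i₁⁻¹ q₁ n₁) e' = z'⁻¹ (i₂⁻¹ q₂ n₂)`. -/
def IsTransform {Ξ : TrivialBibundle m D (Y2 π)}
    (K : ModuleStructure G' (transformQ S L I) (transformZ L I Ξ)) : Prop :=
  ∀ {y₁ y₂ : Y} (h : π y₁ = π y₂) (q₁ : L.Q.Fiber y₁) (q₂ : L.Q.Fiber y₂) (n₁ : S.N.Fiber y₁)
    (n₂ : S.N.Fiber y₂) (e' : G'.E.Fiber ⟨(y₁, y₂), h⟩) (e : G.E.Fiber ⟨(y₁, y₂), h⟩),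
    Acts L.str.κ h q₁ e q₂ → Transfers S.ι h n₁ e' n₂ e →
    Acts K.κ h (transformMk S L I q₁ n₁) e' (transformMk S L I q₂ n₂)

/-- The `E'`-module `L'` is equivalent to a module `I Q N` obtained from the `E`-module `L`. -/
def Corresponds (L' : GerbeModule X G') : Prop :=
  ∃ (I : TrivialBibundle m D Y) (Ξ : TrivialBibundle m D (Y2 π))
    (K : ModuleStructure G' (transformQ S L I) (transformZ L I Ξ)),
    IsXi (L.Q.pullback p₁) S.η Ξ ∧ IsTransform S L I K ∧
    GerbeModule.Equivalent ⟨transformQ S L I, transformZ L I Ξ, K⟩ L'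

end Transform

end Gerbes

end NonabelianGerbe

open NonabelianGerbe

set_option linter.unusedSectionVars false

/-! A trivial bibundle with a chosen central section carries no information: its section gives
isomorphisms `Q ≅ Z Q` and `Q ≅ Q T`. So a module is the same as a `D`-`H` bundle with an
associative smooth action `Q₁ × E → Q₂` (`GerbeAction`), and a stable isomorphism is a smooth
relation `n₁ e' = e n₂` between the two gerbe bibundles, compatible with all actions and with the
products (`Intertwiner`). The twists by `I`, `ξ₁(η)` and `Z` only change the target in which the
action is written.

Over a fixed `Y`, the gerbe bibundle `E'` acts on `Q N` by `[q, n₁] e' = [q e, n₂]` whenever `n₁ e'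
= e n₂`. Other choices of `n₁` and `n₂` change `e` by exactly the factors that cancel, so this is
well defined (`exists_transform`, `exists_isIntertwined`). Intertwiners can be inverted, with the
bibundle `N⁻¹`, and any two models of `Q N` are canonically isomorphic. The relation "`L'` is a
model of `L N`" is therefore symmetric under inversion and determines each side from the other up to
equivalence; hence it is the graph of a bijection of classes
(`Intertwiner.exists_moduleClass_equiv`).

For different `Y` and `Y'`, modules descend along the projections of `Y ×_M Y'`. A gerbe has units
over the diagonal, because the idempotent equation can be solved in the torsor over `(y, y)`. Over a
gerbe pulled back along `q`, these units identify the fibres of a module over points with the same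
image under `q`, and the identifications are automatically coherent and smooth. When `q` has smooth
local sections, both bundle and action descend, so pull-back is bijective on classes
(`GerbeModule.exists_pullback_equiv`). Composing the two pull-back bijections with the one over the
fibre product proves the general case.

Smoothness is tested on lifts of plots near a point (`PrincipalBundle.SmoothAt`): the quotient of
two smooth lifts is smooth, and every construction is checked to preserve smooth lifts. -/

namespace NonabelianGerbe

/-! ### Smoothness near a point of a plot -/

section Near

variable {n : ℕ}

/-- Every neighbourhood of `v` contains the image of a smooth self map of the Euclidean space which
is the identity near `v`. -/
theorem exists_localizer {v : Euc n} {U : Set (Euc n)} (hU : U ∈ 𝓝 v) :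
    ∃ c : Euc n → Euc n, ContDiff ℝ ∞ c ∧ (∀ w, c w ∈ U) ∧ ∀ᶠ w in 𝓝 v, c w = w := by
  obtain ⟨ε, hε, hsub⟩ := Metric.mem_nhds_iff.1 hU
  -- The bump function interpolates between the constant map `v` far away and the identity near `v`,
  -- so that displacements from `v` are shrunk to less than `ε`.
  let f : ContDiffBump v := ⟨ε / 2, ε, by linarith, by linarith⟩
  refine ⟨fun w => v + f w • (w - v), ?_, fun w => hsub ?_, ?_⟩
  · exact contDiff_const.add (f.contDiff.smul (contDiff_id.sub contDiff_const))
  · rw [Metric.mem_ball, dist_eq_norm, add_sub_cancel_left, norm_smul, Real.norm_of_nonneg f.nonneg]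
    by_cases hw : w ∈ Metric.ball v ε
    · rw [Metric.mem_ball, dist_eq_norm] at hw
      exact (mul_le_of_le_one_left (norm_nonneg _) f.le_one).trans_lt hw
    · rw [f.zero_of_le_dist (by simpa using hw), zero_mul]
      exact hε
  · filter_upwards [f.eventuallyEq_one] with w hw
    rw [hw]
    simp

/-- `g` is smooth in a neighbourhood of `v`. -/
def SmoothNear (k : ℕ) {G : Type*} [TopologicalSpace G] [ChartedSpace (Euc k) G]
    (g : Euc n → G) (v : Euc n) : Prop :=
  ∀ᶠ w in 𝓝 v, ContMDiffAt (𝓡 n) (𝓡 k) ∞ g w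

/-- `p` is a plot in a neighbourhood of `v`. -/
def PlotNear {B : Type*} [DiffeologicalSpace B] (p : Euc n → B) (v : Euc n) : Prop :=
  ∃ U ∈ 𝓝 v, ∀ (r : ℕ) (c : Euc r → Euc n), ContDiff ℝ ∞ c → (∀ w, c w ∈ U) →
    IsPlot fun w => p (c w)

section

variable {k m : ℕ} {G : Type*} [TopologicalSpace G] [ChartedSpace (Euc k) G]
  {H : Type*} [TopologicalSpace H] [ChartedSpace (Euc m) H]
  {A B : Type*} [DiffeologicalSpace A] [DiffeologicalSpace B] {v : Euc n}

theorem SmoothNear.congr {g g' : Euc n → G} (hg : SmoothNear k g v)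
    (h : ∀ᶠ w in 𝓝 v, g' w = g w) : SmoothNear k g' v := by
  filter_upwards [hg, Filter.Eventually.eventually_nhds h] with w h1 h2
  exact h1.congr_of_eventuallyEq h2

theorem SmoothNear.of_contMDiff {g : Euc n → G} (hg : ContMDiff (𝓡 n) (𝓡 k) ∞ g) :
    SmoothNear k g v :=
  Filter.Eventually.of_forall fun w => hg w

theorem smoothNear_const (g : G) : SmoothNear k (fun _ : Euc n => g) v :=
  .of_contMDiff contMDiff_const

theorem SmoothNear.mul [Group G] [LieGroup (𝓡 k) ∞ G] {f g : Euc n → G} (hf : SmoothNear k f v)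
    (hg : SmoothNear k g v) : SmoothNear k (fun w => f w * g w) v := by
  filter_upwards [hf, hg] with w h1 h2
  exact h1.mul h2

theorem SmoothNear.inv [Group G] [LieGroup (𝓡 k) ∞ G] {f : Euc n → G} (hf : SmoothNear k f v) :
    SmoothNear k (fun w => (f w)⁻¹) v := by
  filter_upwards [hf] with w h1
  exact h1.inv

theorem PlotNear.of_isPlot {p : Euc n → B} (hp : IsPlot p) : PlotNear p v :=
  ⟨Set.univ, Filter.univ_mem, fun _ _ hc _ => Diffeology.isPlot_reparam hp hc⟩

theorem PlotNear.comp {p : Euc n → A} (hp : PlotNear p v) (φ : SmoothMap A B) :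
    PlotNear (fun w => φ (p w)) v := by
  obtain ⟨U, hU, h⟩ := hp
  exact ⟨U, hU, fun r c hc hcU => φ.smooth r _ (h r c hc hcU)⟩

/-- Precomposition with a localizer turns `p` into a global plot, for which preimages of open sets
are open, without changing it near `v`. -/
theorem PlotNear.eventually_mem {p : Euc n → B} (hp : PlotNear p v) {W : Set B} (hW : DOpen W)
    (hv : p v ∈ W) : ∀ᶠ w in 𝓝 v, p w ∈ W := by
  obtain ⟨U, hU, h⟩ := hp
  obtain ⟨c, hc, hcU, hcv⟩ := exists_localizer hU
  have ho : IsOpen ((fun w => p (c w)) ⁻¹' W) :=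
    Diffeology.isOpen_iff_preimages_plots.1 hW n _ (h n c hc hcU)
  have hm : (fun w => p (c w)) ⁻¹' W ∈ 𝓝 v := ho.mem_nhds (by
    change p (c v) ∈ W
    rwa [hcv.self_of_nhds])
  filter_upwards [hm, hcv] with w h1 h2
  change p (c w) ∈ W at h1
  rwa [h2] at h1

/-- Smoothness of `a` is only tested on global plots that stay in `W`; the localizer replaces `p`
and `g` by such global data with the same germ at `v`. -/
theorem SmoothFamilyOn.smoothNear {a : B → H → G} {W : Set B} (ha : SmoothFamilyOn m k a W)
    (hW : DOpen W) {p : Euc n → B} (hp : PlotNear p v) (hv : p v ∈ W) {g : Euc n → H}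
    (hg : SmoothNear m g v) : SmoothNear k (fun w => a (p w) (g w)) v := by
  have hm := hp.eventually_mem hW hv
  obtain ⟨U, hU, h⟩ := hp
  -- The image of `c` has to lie where `p` is a plot, where `p` takes values in `W`, and where `g`
  -- is smooth.
  obtain ⟨c, hc, hcU, hcv⟩ := exists_localizer (Filter.inter_mem hU (Filter.inter_mem hm hg))
  have h1 : ContMDiff (𝓡 n) (𝓡 m) ∞ fun w => g (c w) := fun w =>
    ContMDiffAt.comp w (hcU w).2.2 hc.contMDiff.contMDiffAt
  refine (SmoothNear.of_contMDiff (ha n _ _ (h n c hc fun w => (hcU w).1)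
    (fun w => (hcU w).2.1) h1)).congr ?_
  filter_upwards [hcv] with w hw
  rw [hw]

theorem SmoothOn.smoothNear {g : B → G} {W : Set B} (hg : SmoothOn k g W)
    (hW : DOpen W) {p : Euc n → B} (hp : PlotNear p v) (hv : p v ∈ W) :
    SmoothNear k (fun w => g (p w)) v := by
  -- A function is a family that ignores its second argument.
  have : SmoothFamilyOn (H := G) k k (fun x _ => g x) W := fun n p _ hp hW _ => hg n p hp hW
  exact this.smoothNear hW hp hv (smoothNear_const (g (p v)))

theorem SmoothOn.of_smoothNear {g : B → G} {W : Set B}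
    (h : ∀ (n : ℕ) (p : Euc n → B) (v : Euc n), IsPlot p → (∀ w, p w ∈ W) →
      SmoothNear k (fun w => g (p w)) v) : SmoothOn k g W :=
  fun n p hp hW v => (h n p v hp hW).self_of_nhds

end

end Near

/-! ### Smooth lifts of plots to the total space of a principal bundle -/

section Lifts

variable {k : ℕ} {H : Type u} [Group H] [TopologicalSpace H] [ChartedSpace (Euc k) H]
  {m : ℕ} {D : Type u} [Group D] [TopologicalSpace D] [ChartedSpace (Euc m) D]
  {A B : Type*} [DiffeologicalSpace A] [DiffeologicalSpace B] {n : ℕ}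

/-- The lift `s` of `p` to the total space of `P` is smooth in a neighbourhood of `v`. -/
def PrincipalBundle.SmoothAt (P : PrincipalBundle m D B) (p : Euc n → B) (s : ∀ w, P.Fiber (p w))
    (v : Euc n) : Prop :=
  ∃ t ∈ P.atlas, p v ∈ t.dom ∧ ∃ g : Euc n → D, SmoothNear m g v ∧
    ∀ᶠ w in 𝓝 v, s w = g w • t.val (p w)

variable {v : Euc n} {P : PrincipalBundle m D B} {p : Euc n → B}

theorem PrincipalBundle.smul_left_injective {x : B} (q : P.Fiber x) {d d' : D}
    (h : d • q = d' • q) : d = d' := by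
  obtain ⟨_, _, hu⟩ := P.torsor x (d' • q) q
  rw [hu d h, hu d' rfl]

theorem PrincipalBundle.exists_smul_eq {x : B} (q q' : P.Fiber x) : ∃ d : D, d • q = q' :=
  (P.torsor x q' q).exists

theorem PrincipalBundle.nonempty (P : PrincipalBundle m D B) (x : B) : Nonempty (P.Fiber x) := by
  obtain ⟨t, -, -⟩ := P.cover x
  exact ⟨t.val x⟩

theorem PrincipalBundle.smoothAt_val {t : LocalSection P.Fiber} (ht : t ∈ P.atlas)
    (hv : p v ∈ t.dom) : P.SmoothAt p (fun w => t.val (p w)) v :=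
  ⟨t, ht, hv, fun _ => 1, smoothNear_const 1, Filter.Eventually.of_forall fun _ =>
    (one_smul _ _).symm⟩

theorem PrincipalBundle.SmoothAt.congr {s s' : ∀ w, P.Fiber (p w)} (hs : P.SmoothAt p s v)
    (h : ∀ᶠ w in 𝓝 v, s' w = s w) : P.SmoothAt p s' v := by
  obtain ⟨t, ht, hv, g, hg, hgs⟩ := hs
  refine ⟨t, ht, hv, g, hg, ?_⟩
  filter_upwards [h, hgs] with w h1 h2
  rw [h1, h2]

theorem SmoothRel.smoothAt {s : ∀ x, P.Fiber x} {t : LocalSection P.Fiber} {W : Set B}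
    (h : SmoothRel m D s t.val W) (ht : t ∈ P.atlas) (hW : DOpen W) (hp : PlotNear p v)
    (hv : p v ∈ W) (hvt : p v ∈ t.dom) : P.SmoothAt p (fun w => s (p w)) v := by
  obtain ⟨g, hg, hgs⟩ := h
  refine ⟨t, ht, hvt, _, hg.smoothNear hW hp hv, ?_⟩
  filter_upwards [hp.eventually_mem hW hv] with w hw
  exact hgs _ hw

theorem PrincipalBundle.IsSmoothSection.smoothAt {s : ∀ x, P.Fiber x} (h : P.IsSmoothSection s)
    (hp : PlotNear p v) : P.SmoothAt p (fun w => s (p w)) v := by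
  obtain ⟨t, ht, hv⟩ := P.cover (p v)
  exact (h t ht).smoothAt ht t.isOpen_dom hp hv hv

theorem PrincipalBundle.exists_smoothAt (P : PrincipalBundle m D B) (p : Euc n → B) (v : Euc n) :
    ∃ s : ∀ w, P.Fiber (p w), P.SmoothAt p s v := by
  obtain ⟨t, ht, hv⟩ := P.cover (p v)
  exact ⟨_, smoothAt_val ht hv⟩

theorem PrincipalBundle.SmoothAt.smul [LieGroup (𝓡 m) ∞ D] {s : ∀ w, P.Fiber (p w)}
    (hs : P.SmoothAt p s v) {g : Euc n → D} (hg : SmoothNear m g v) :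
    P.SmoothAt p (fun w => g w • s w) v := by
  obtain ⟨t, ht, hv, g', hg', hgs⟩ := hs
  refine ⟨t, ht, hv, _, hg.mul hg', ?_⟩
  filter_upwards [hgs] with w hw
  rw [hw, mul_smul]

/-- A smooth lift is a smooth multiple of any section of the atlas. -/
theorem PrincipalBundle.SmoothAt.exists_smul_val [LieGroup (𝓡 m) ∞ D] {s : ∀ w, P.Fiber (p w)}
    (hs : P.SmoothAt p s v) (hp : PlotNear p v) {t : LocalSection P.Fiber} (ht : t ∈ P.atlas)
    (hv : p v ∈ t.dom) :
    ∃ g : Euc n → D, SmoothNear m g v ∧ ∀ᶠ w in 𝓝 v, s w = g w • t.val (p w) := by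
  obtain ⟨r, hr, hvr, g, hg, hgs⟩ := hs
  obtain ⟨g', hg', hgs'⟩ := P.transition r hr t ht
  have ho := r.isOpen_dom.inter t.isOpen_dom
  refine ⟨_, hg.mul (hg'.smoothNear ho hp ⟨hvr, hv⟩), ?_⟩
  filter_upwards [hgs, hp.eventually_mem ho ⟨hvr, hv⟩] with w h1 h2
  rw [h1, hgs' _ h2, mul_smul]

/-- The quotient of two smooth lifts is smooth. -/
theorem PrincipalBundle.SmoothAt.smoothNear [LieGroup (𝓡 m) ∞ D] {s s' : ∀ w, P.Fiber (p w)}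
    (hs : P.SmoothAt p s v) (hs' : P.SmoothAt p s' v) (hp : PlotNear p v) {g : Euc n → D}
    (h : ∀ᶠ w in 𝓝 v, s w = g w • s' w) : SmoothNear m g v := by
  obtain ⟨t, ht, hv, a, ha, has⟩ := hs
  obtain ⟨b, hb, hbs⟩ := hs'.exists_smul_val hp ht hv
  refine (ha.mul hb.inv).congr ?_
  filter_upwards [h, has, hbs] with w h1 h2 h3
  rw [h1, h3, smul_smul] at h2
  rw [← P.smul_left_injective _ h2, mul_inv_cancel_right]

theorem PrincipalBundle.SmoothAt.exists_smul [LieGroup (𝓡 m) ∞ D] {s s' : ∀ w, P.Fiber (p w)}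
    (hs : P.SmoothAt p s v) (hs' : P.SmoothAt p s' v) (hp : PlotNear p v) :
    ∃ g : Euc n → D, SmoothNear m g v ∧ ∀ w, s w = g w • s' w := by
  choose g hg using fun w => P.exists_smul_eq (s' w) (s w)
  exact ⟨g, hs.smoothNear hs' hp (Filter.Eventually.of_forall fun w => (hg w).symm),
    fun w => (hg w).symm⟩

/-- Smooth relations can be checked on lifts of plots. -/
theorem SmoothRel.of_smoothAt [LieGroup (𝓡 m) ∞ D] {s : ∀ x, P.Fiber x} {t : LocalSection P.Fiber}
    {W : Set B} (ht : t ∈ P.atlas) (hW : W ⊆ t.dom)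
    (h : ∀ (n : ℕ) (p : Euc n → B) (v : Euc n), IsPlot p → (∀ w, p w ∈ W) →
      P.SmoothAt p (fun w => s (p w)) v) : SmoothRel m D s t.val W := by
  choose g hg using fun x => P.exists_smul_eq (t.val x) (s x)
  have hst : ∀ x, s x = g x • t.val x := fun x => (hg x).symm
  refine ⟨g, SmoothOn.of_smoothNear fun n p v hp hpW => ?_, fun x _ => hst x⟩
  exact (h n p v hp hpW).smoothNear (PrincipalBundle.smoothAt_val ht (hW (hpW v)))
    (.of_isPlot hp) (Filter.Eventually.of_forall fun w => hst (p w))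

/-- An equivariant map which preserves smooth lifts reflects them. -/
theorem PrincipalBundle.SmoothAt.of_equivariant [LieGroup (𝓡 m) ∞ D] {A : Type*}
    [DiffeologicalSpace A] {P' : PrincipalBundle m D A} {p' : Euc n → A}
    (f : ∀ w, P.Fiber (p w) → P'.Fiber (p' w)) (hf : ∀ w (d : D) x, f w (d • x) = d • f w x)
    (hs : ∀ s, P.SmoothAt p s v → P'.SmoothAt p' (fun w => f w (s w)) v)
    (hp' : PlotNear p' v) {s : ∀ w, P.Fiber (p w)}
    (h : P'.SmoothAt p' (fun w => f w (s w)) v) : P.SmoothAt p s v := by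
  -- A comparison lift `r` known to be smooth: equivariance makes the quotient of `s` by `r` the
  -- same before and after `f`, and it is smooth after `f`.
  obtain ⟨r, hr⟩ := P.exists_smoothAt p v
  choose g hg using fun w => P.exists_smul_eq (r w) (s w)
  have hsr : ∀ w, s w = g w • r w := fun w => (hg w).symm
  have : SmoothNear m g v := h.smoothNear (hs r hr) hp' (Filter.Eventually.of_forall fun w => by
    rw [← hf, hg])
  exact (hr.smul this).congr (Filter.Eventually.of_forall hsr)

theorem PrincipalBundle.smoothAt_pullback {φ : SmoothMap A B} {p : Euc n → A}
    {s : ∀ w, P.Fiber (φ (p w))} :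
    (P.pullback φ).SmoothAt p s v ↔ P.SmoothAt (fun w => φ (p w)) s v := by
  constructor
  · rintro ⟨_, ⟨t, ht, rfl⟩, hv, g, hg, hgs⟩
    exact ⟨t, ht, hv, g, hg, hgs⟩
  · rintro ⟨t, ht, hv, g, hg, hgs⟩
    exact ⟨_, ⟨t, ht, rfl⟩, hv, g, hg, hgs⟩

/-- In a local section, `(g t) ◁ h = g (t ◁ h) = g a(h) t`, with `a` the smooth family that
expresses the right action. -/
theorem RightBundle.smoothAt_op_smul [LieGroup (𝓡 m) ∞ D] {P : RightBundle m D k H B}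
    {s : ∀ w, P.Fiber (p w)} (hs : P.SmoothAt p s v) (hp : PlotNear p v) {h : Euc n → H}
    (hh : SmoothNear k h v) : P.SmoothAt p (fun w => op (h w) • s w) v := by
  obtain ⟨t, ht, hv, g, hg, hgs⟩ := hs
  obtain ⟨a, ha, hat⟩ := P.right_smooth t ht
  refine ⟨t, ht, hv, _, hg.mul (ha.smoothNear t.isOpen_dom hp hv hh), ?_⟩
  filter_upwards [hgs, hp.eventually_mem t.isOpen_dom hv] with w h1 h2
  rw [h1, ← smul_comm, hat _ h2, mul_smul]

/-- Writing `e = h t`, the factor moves across the bracket: `[s, h t] = [s ◁ h, t]`. -/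
theorem RightBundle.smoothAt_mk [LieGroup (𝓡 m) ∞ D] {P : RightBundle m D k H B}
    {E : PrincipalBundle k H B} {s : ∀ w, P.Fiber (p w)} {e : ∀ w, E.Fiber (p w)}
    (hs : P.SmoothAt p s v) (he : E.SmoothAt p e v) (hp : PlotNear p v) :
    (P.prod E).SmoothAt p (fun w => ProdFiber.mk H (s w) (e w)) v := by
  obtain ⟨t, ht, hvt, h, hh, hht⟩ := he
  obtain ⟨r, hr, hvr, g, hg, hgs⟩ := RightBundle.smoothAt_op_smul hs hp hh
  refine ⟨_, ⟨r, hr, t, ht, rfl⟩, ⟨hvr, hvt⟩, g, hg, ?_⟩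
  filter_upwards [hht, hgs] with w h1 h2
  rw [h1, ← ProdFiber.mk_op_smul, h2]
  rfl

end Lifts

end NonabelianGerbe
namespace NonabelianGerbe

/-! ### Bibundles and smooth lifts -/

section Bibundles

variable {k : ℕ} {H : Type u} [Group H] [TopologicalSpace H] [ChartedSpace (Euc k) H]
  {m : ℕ} {D : Type u} [Group D] [TopologicalSpace D] [ChartedSpace (Euc m) D]
  {B : Type*} [DiffeologicalSpace B] {n : ℕ} {v : Euc n} {p : Euc n → B}

theorem Bibundle.op_smul_left_injective {E : Bibundle k H B} {x : B} (e : E.Fiber x) {h h' : H}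
    (hh : op h • e = op h' • e) : h = h' := by
  obtain ⟨_, _, hu⟩ := E.right_torsor x (op h' • e) e
  rw [hu h hh, hu h' rfl]

theorem Bibundle.exists_op_smul_eq {E : Bibundle k H B} {x : B} (e e' : E.Fiber x) :
    ∃ h : H, op h • e = e' :=
  (E.right_torsor x e' e).exists

theorem Bibundle.φ_inv [LieGroup (𝓡 k) ∞ H] {E : Bibundle k H B} {x : B} (e : E.Fiber x) :
    E.inv.φ (Bibundle.mkInv e) = (E.φ e)⁻¹ := by
  rw [eq_inv_iff_mul_eq_one]
  ext h
  apply Bibundle.φ_eq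
  change Flip.mk (op h⁻¹ • e) = Flip.mk ((E.φ e h)⁻¹ • e)
  rw [← map_inv, E.φ_smul]

theorem TrivialBibundle.φ_sec (T : TrivialBibundle k H B) (x : B) : T.φ (T.sec x) = 1 := by
  ext h
  exact Bibundle.φ_eq _ (T.isCentral.2 x h)

/-- If `e = g t`, then `e = t ◁ b(g)` with the smooth family `b` of `left_smooth`, and `e⁻¹ = b(g)⁻¹
t⁻¹`. -/
theorem Bibundle.smoothAt_inv [LieGroup (𝓡 k) ∞ H] {E : Bibundle k H B}
    {e : ∀ w, E.Fiber (p w)} (hp : PlotNear p v) (he : E.SmoothAt p e v) :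
    E.inv.SmoothAt p (fun w => Flip.mk (e w)) v := by
  obtain ⟨t, ht, hv, g, hg, hgs⟩ := he
  obtain ⟨b, hb, hbt⟩ := E.left_smooth t ht
  refine ⟨t.flip, ⟨t, ht, rfl⟩, hv, _, (hb.smoothNear t.isOpen_dom hp hv hg).inv, ?_⟩
  filter_upwards [hgs, hp.eventually_mem t.isOpen_dom hv] with w h1 h2
  rw [h1, hbt _ h2]
  exact congrArg Flip.mk (by rw [inv_inv]; rfl)

theorem Bibundle.smoothAt_of_inv [LieGroup (𝓡 k) ∞ H] {E : Bibundle k H B}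
    {e : ∀ w, E.Fiber (p w)} (hp : PlotNear p v)
    (he : E.inv.SmoothAt p (fun w => Flip.mk (e w)) v) : E.SmoothAt p e v := by
  obtain ⟨_, ⟨t, ht, rfl⟩, hv, g, hg, hgs⟩ := he
  obtain ⟨a, ha, hat⟩ := E.right_smooth t ht
  refine ⟨t, ht, hv, _, ha.smoothNear t.isOpen_dom hp hv hg.inv, ?_⟩
  filter_upwards [hgs, hp.eventually_mem t.isOpen_dom hv] with w h1 h2
  exact (congrArg Flip.val h1).trans (hat _ h2 _)

/-- `φ_e(h)` is the quotient of the smooth lifts `e ◁ h` and `e`. The inverse automorphism is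
handled in the same way through `e⁻¹`. -/
theorem Bibundle.smoothNear_φ [LieGroup (𝓡 k) ∞ H] {E : Bibundle k H B} {e : ∀ w, E.Fiber (p w)}
    (he : E.SmoothAt p e v) (hp : PlotNear p v) {h : Euc n → H} (hh : SmoothNear k h v) :
    SmoothNear k (fun w => E.φ (e w) (h w)) v :=
  (RightBundle.smoothAt_op_smul he hp hh).smoothNear he hp
    (Filter.Eventually.of_forall fun w => (E.φ_smul (e w) (h w)).symm)

theorem Bibundle.smoothNear_φ_inv [LieGroup (𝓡 k) ∞ H] {E : Bibundle k H B}
    {e : ∀ w, E.Fiber (p w)} (he : E.SmoothAt p e v) (hp : PlotNear p v) {h : Euc n → H}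
    (hh : SmoothNear k h v) : SmoothNear k (fun w => (E.φ (e w))⁻¹ (h w)) v :=
  (smoothNear_φ (smoothAt_inv hp he) hp hh).congr (Filter.Eventually.of_forall fun w => by
    rw [← φ_inv]; rfl)

/-- The right action on `E` is free and transitive, so a class has exactly one representative with
prescribed first entry. This turns the equations in product bundles that define gerbe products and
transfers into actual maps. -/
theorem Bibundle.existsUnique_mk_eq {E : Bibundle k H B} {F : Type u} [MulAction H F]
    {x : B} (z : ProdFiber H (E.Fiber x) F) (e : E.Fiber x) : ∃! f : F, z = ProdFiber.mk H e f := by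
  induction z using ProdFiber.ind with | _ e₁ f₁
  obtain ⟨c, rfl⟩ := Bibundle.exists_op_smul_eq e e₁
  refine ⟨c • f₁, ProdFiber.mk_op_smul _ _ _, fun f hf => ?_⟩
  obtain ⟨h, h1, h2⟩ := ProdFiber.mk_eq_mk.1 ((ProdFiber.mk_op_smul _ _ _).symm.trans hf)
  have : h = 1 := by
    apply Bibundle.op_smul_left_injective e
    rw [← h1, MulOpposite.op_one, one_smul]
  rw [h2, this, one_smul]

/-- If `[s, e]` and `s` are smooth, then so is `e`. -/
theorem Bibundle.smoothAt_of_mk [LieGroup (𝓡 k) ∞ H] {E : Bibundle k H B}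
    {F : PrincipalBundle k H B} {s : ∀ w, E.Fiber (p w)} {e : ∀ w, F.Fiber (p w)}
    (hp : PlotNear p v) (hs : E.SmoothAt p s v)
    (h : (E.toRightBundle.prod F).SmoothAt p (fun w => ProdFiber.mk H (s w) (e w)) v) :
    F.SmoothAt p e v := by
  obtain ⟨r, hr⟩ := F.exists_smoothAt p v
  choose g hg using fun w => F.exists_smul_eq (r w) (e w)
  have h1 := RightBundle.smoothAt_mk hs hr hp
  -- `[s, g r] = [s ◁ g, r] = φ_s(g) [s, r]`, so `φ_s(g)` is a quotient of smooth lifts; applying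
  -- the smooth inverse of `φ_s` recovers `g`.
  have h2 : SmoothNear k (fun w => E.φ (s w) (g w)) v := by
    refine h.smoothNear h1 hp (Filter.Eventually.of_forall fun w => ?_)
    rw [← hg, ← ProdFiber.mk_op_smul, ← E.φ_smul]
    rfl
  have h3 : SmoothNear k g v := (smoothNear_φ_inv hs hp h2).congr
    (Filter.Eventually.of_forall fun w => by simp)
  have her : ∀ w, e w = g w • r w := fun w => (hg w).symm
  exact (hr.smul h3).congr (Filter.Eventually.of_forall her)

theorem BibundleIso.smoothAt [LieGroup (𝓡 k) ∞ H] {E E' : Bibundle k H B} (a : BibundleIso E E')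
    {e : ∀ w, E.Fiber (p w)} (he : E.SmoothAt p e v) (hp : PlotNear p v) :
    E'.SmoothAt p (fun w => a.toFun (e w)) v := by
  obtain ⟨s, hs, hv, g, hg, hgs⟩ := he
  obtain ⟨t, ht, hvt⟩ := E'.cover (p v)
  refine (((a.smooth s hs t ht).smoothAt ht (s.isOpen_dom.inter t.isOpen_dom) hp ⟨hv, hvt⟩
    hvt).smul hg).congr ?_
  filter_upwards [hgs] with w hw
  rw [hw, a.map_smul]

variable {X : CrossedModule k H m D}

theorem DHIso.smoothAt [LieGroup (𝓡 m) ∞ D] {Q Q' : DHBundle X B} (a : DHIso Q Q')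
    {q : ∀ w, Q.Fiber (p w)} (hq : Q.SmoothAt p q v) (hp : PlotNear p v) :
    Q'.SmoothAt p (fun w => a.toFun (q w)) v := by
  obtain ⟨s, hs, hv, g, hg, hgs⟩ := hq
  obtain ⟨t, ht, hvt⟩ := Q'.cover (p v)
  refine (((a.smooth s hs t ht).smoothAt ht (s.isOpen_dom.inter t.isOpen_dom) hp ⟨hv, hvt⟩
    hvt).smul hg).congr ?_
  filter_upwards [hgs] with w hw
  rw [hw, a.map_smul]

/-- Isomorphisms from maps which preserve smooth lifts. -/
def DHIso.ofSmoothAt [LieGroup (𝓡 m) ∞ D] {Q Q' : DHBundle X B}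
    (f : ∀ x, Q.Fiber x → Q'.Fiber x) (hf : ∀ x (d : D) q, f x (d • q) = d • f x q)
    (hψ : ∀ x (q : Q.Fiber x), Q'.ψ (f x q) = Q.ψ q)
    (hs : ∀ (n : ℕ) (p : Euc n → B) (v : Euc n) (q : ∀ w, Q.Fiber (p w)), IsPlot p →
      Q.SmoothAt p q v → Q'.SmoothAt p (fun w => f _ (q w)) v) : DHIso Q Q' where
  toFun {x} := f x
  map_smul {x} := hf x
  map_ψ {x} := hψ x
  smooth _ hs' _ ht := SmoothRel.of_smoothAt ht (fun _ hx => hx.2) fun n p v hp hW =>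
    hs n p v _ hp (PrincipalBundle.smoothAt_val hs' (hW v).1)

end Bibundles

end NonabelianGerbe
namespace NonabelianGerbe

/-! ### Trivial bibundles -/

section Trivial

variable {k : ℕ} {H : Type u} [Group H] [TopologicalSpace H] [ChartedSpace (Euc k) H]
  {m : ℕ} {D : Type u} [Group D] [TopologicalSpace D] [ChartedSpace (Euc m) D]
  [LieGroup (𝓡 m) ∞ D] {B : Type*} [DiffeologicalSpace B] {n : ℕ} {v : Euc n} {p : Euc n → B}
  {X : CrossedModule k H m D}

theorem RightBundle.exists_of_smoothAt_prod {P : RightBundle m D k H B}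
    {E : PrincipalBundle k H B} {z : ∀ w, (P.prod E).Fiber (p w)}
    (hz : (P.prod E).SmoothAt p z v) :
    ∃ (s : ∀ w, P.Fiber (p w)) (e : ∀ w, E.Fiber (p w)), P.SmoothAt p s v ∧ E.SmoothAt p e v ∧
      ∀ᶠ w in 𝓝 v, z w = ProdFiber.mk H (s w) (e w) := by
  obtain ⟨_, ⟨s, hs, t, ht, rfl⟩, hv, g, hg, hgs⟩ := hz
  exact ⟨_, _, (PrincipalBundle.smoothAt_val hs hv.1).smul hg,
    PrincipalBundle.smoothAt_val ht hv.2, hgs⟩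

/-- The product bibundle `B × D`. -/
def TrivialBibundle.product (m : ℕ) (D : Type u) [Group D] [TopologicalSpace D]
    [ChartedSpace (Euc m) D] (B : Type*) [DiffeologicalSpace B] : TrivialBibundle m D B where
  Fiber _ := D
  torsor _ p q := ⟨p * q⁻¹, inv_mul_cancel_right p q, fun _ h => eq_mul_inv_of_mul_eq h⟩
  atlas := {⟨Set.univ, @isOpen_univ B dTopology, fun _ => 1⟩}
  cover x := ⟨_, rfl, Set.mem_univ x⟩
  transition := by
    rintro _ rfl _ rfl
    exact ⟨fun _ => 1, fun _ _ _ _ => contMDiff_const, fun _ _ => (one_smul D _).symm⟩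
  right_smooth := by
    rintro _ rfl
    exact ⟨fun _ h => h, fun _ _ _ _ _ hc => hc, fun _ _ h => (one_mul h).trans (mul_one h).symm⟩
  right_torsor _ p q := ⟨q⁻¹ * p, mul_inv_cancel_left q p, fun _ h => eq_inv_mul_of_mul_eq h⟩
  left_smooth := by
    rintro _ rfl
    exact ⟨fun _ h => h, fun _ _ _ _ _ hc => hc, fun _ _ h => (mul_one h).trans (one_mul h).symm⟩
  sec _ := 1
  isCentral := by
    refine ⟨?_, fun _ h => (mul_one h).trans (one_mul h).symm⟩
    rintro _ rfl
    exact ⟨fun _ => 1, fun _ _ _ _ => contMDiff_const, fun _ _ => (one_smul D _).symm⟩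

theorem TrivialBibundle.coord_sec (Z : TrivialBibundle m D B) (x : B) : Z.coord (Z.sec x) = 1 :=
  Z.coord_eq (one_smul _ _)

theorem TrivialBibundle.smoothAt_sec (Z : TrivialBibundle m D B) (hp : PlotNear p v) :
    Z.SmoothAt p (fun w => Z.sec (p w)) v :=
  Z.isCentral.1.smoothAt hp

/-- The isomorphism `Q → Z Q`, `q ↦ [z, q]`, given by the section `z` of `Z`. -/
noncomputable def TrivialBibundle.toMulDH [LieGroup (𝓡 k) ∞ H] (Z : TrivialBibundle m D B)
    (Q : DHBundle X B) : DHIso Q (Z.mulDH Q) :=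
  .ofSmoothAt (fun x q => ProdFiber.mk D (Z.sec x) q)
    (fun x d q => by
      -- Centrality of the section `z` gives `[z, d q] = [z ◁ d, q] = [d z, q]`.
      rw [← ProdFiber.mk_op_smul, ← Z.isCentral.2]
      rfl)
    (fun x q => by
      change X.act (Z.coord (Z.sec x)) * Q.ψ q = Q.ψ q
      rw [Z.coord_sec, map_one, one_mul])
    fun _ _ _ _ hp hq => RightBundle.smoothAt_mk (Z.smoothAt_sec (.of_isPlot hp)) hq (.of_isPlot hp)

/-- The isomorphism `Q → Q T`, `q ↦ [q, t]`, given by the section `t` of `T`. -/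
noncomputable def DHBundle.toMul (Q : DHBundle X B) (T : TrivialBibundle k H B) :
    DHIso Q (Q.mul T.toBibundle) :=
  .ofSmoothAt (fun x q => ProdFiber.mk H q (T.sec x)) (fun _ _ _ => rfl)
    (fun x q => by
      change Q.ψ q * T.φ (T.sec x) = Q.ψ q
      rw [T.φ_sec, mul_one])
    fun _ _ _ _ hp hq => RightBundle.smoothAt_mk hq (T.isCentral.1.smoothAt (.of_isPlot hp))
      (.of_isPlot hp)

/-- Both `Q T` and `Ξ Q` are identified with `Q` by their sections, so the product bibundle with
section `1` can serve as `Ξ`. -/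
theorem exists_isXi [LieGroup (𝓡 k) ∞ H] (Q : DHBundle X B) (T : TrivialBibundle k H B) :
    ∃ Ξ : TrivialBibundle m D B, IsXi Q T Ξ := by
  refine ⟨.product m D B, (Q.toMul T).symm.trans (TrivialBibundle.toMulDH _ Q), fun x q => ?_⟩
  change (TrivialBibundle.toMulDH _ Q).toFun ((Q.toMul T).symm.toFun ((Q.toMul T).toFun q)) =
    (TrivialBibundle.toMulDH _ Q).toFun q
  congr 1
  apply ((Q.toMul T).bijective x).1
  exact (Q.toMul T).apply_symm _

end Trivial

/-! ### The product of a bundle gerbe -/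

section Gerbes

variable {k : ℕ} {H : Type u} [Group H] [TopologicalSpace H] [ChartedSpace (Euc k) H]
  [LieGroup (𝓡 k) ∞ H] {M : Type*} {Y : Type*} [DiffeologicalSpace Y] {π : Y → M}
  {n : ℕ} {v : Euc n}

theorem plotNear_pair {A : Type*} [DiffeologicalSpace A] {P : Y × A → Prop} {p : Euc n → Y}
    {p' : Euc n → A} (hp : PlotNear p v) (hp' : PlotNear p' v) (h : ∀ w, P (p w, p' w)) :
    PlotNear (fun w => (⟨(p w, p' w), h w⟩ : {x : Y × A // P x})) v := by
  obtain ⟨U, hU, h1⟩ := hp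
  obtain ⟨U', hU', h2⟩ := hp'
  exact ⟨U ∩ U', Filter.inter_mem hU hU', fun r c hc hm =>
    ⟨h1 r c hc fun w => (hm w).1, h2 r c hc fun w => (hm w).2⟩⟩

theorem plotNear_triple {p₁ p₂ p₃ : Euc n → Y} (hp₁ : PlotNear p₁ v) (hp₂ : PlotNear p₂ v)
    (hp₃ : PlotNear p₃ v) (h₁₂ : ∀ w, π (p₁ w) = π (p₂ w)) (h₂₃ : ∀ w, π (p₂ w) = π (p₃ w)) :
    PlotNear (fun w => (⟨(p₁ w, p₂ w, p₃ w), h₁₂ w, h₂₃ w⟩ : Y3 π)) v := by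
  obtain ⟨U₁, hU₁, h1⟩ := hp₁
  obtain ⟨U₂, hU₂, h2⟩ := hp₂
  obtain ⟨U₃, hU₃, h3⟩ := hp₃
  exact ⟨U₁ ∩ (U₂ ∩ U₃), Filter.inter_mem hU₁ (Filter.inter_mem hU₂ hU₃), fun r c hc hm =>
    ⟨h1 r c hc fun w => (hm w).1, h2 r c hc fun w => (hm w).2.1, h3 r c hc fun w => (hm w).2.2⟩⟩

namespace BundleGerbe

variable (G : BundleGerbe k H π) {y₁ y₂ y₃ y₄ : Y}

theorem existsUnique_composes (h₁₂ : π y₁ = π y₂) (h₂₃ : π y₂ = π y₃)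
    (e₁₂ : G.E.Fiber ⟨(y₁, y₂), h₁₂⟩) (e₂₃ : G.E.Fiber ⟨(y₂, y₃), h₂₃⟩) :
    ∃! e₁₃, G.E.Composes G.fInv h₁₂ h₂₃ e₁₂ e₂₃ e₁₃ := by
  obtain ⟨f, hf, hu⟩ := Bibundle.existsUnique_mk_eq
    (E := (G.E.pullback p₁₂).mul (G.E.pullback p₂₃)) (F := Flip (G.E.Fiber ⟨(y₁, y₃), _⟩))
    (G.fInv ⟨(y₁, y₂, y₃), h₁₂, h₂₃⟩) (ProdFiber.mk H e₁₂ e₂₃)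
  exact ⟨f.val, hf, fun e he => congrArg Flip.val (hu ⟨e⟩ he)⟩

/-- The product `E₁₂ × E₂₃ → E₁₃`. -/
noncomputable def comp (h₁₂ : π y₁ = π y₂) (h₂₃ : π y₂ = π y₃)
    (e₁₂ : G.E.Fiber ⟨(y₁, y₂), h₁₂⟩) (e₂₃ : G.E.Fiber ⟨(y₂, y₃), h₂₃⟩) :
    G.E.Fiber ⟨(y₁, y₃), h₁₂.trans h₂₃⟩ :=
  (G.existsUnique_composes h₁₂ h₂₃ e₁₂ e₂₃).choose

variable {G}

theorem composes_comp (h₁₂ : π y₁ = π y₂) (h₂₃ : π y₂ = π y₃)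
    (e₁₂ : G.E.Fiber ⟨(y₁, y₂), h₁₂⟩) (e₂₃ : G.E.Fiber ⟨(y₂, y₃), h₂₃⟩) :
    G.E.Composes G.fInv h₁₂ h₂₃ e₁₂ e₂₃ (G.comp h₁₂ h₂₃ e₁₂ e₂₃) :=
  (G.existsUnique_composes h₁₂ h₂₃ e₁₂ e₂₃).choose_spec.1

theorem composes_iff {h₁₂ : π y₁ = π y₂} {h₂₃ : π y₂ = π y₃}
    {e₁₂ : G.E.Fiber ⟨(y₁, y₂), h₁₂⟩} {e₂₃ : G.E.Fiber ⟨(y₂, y₃), h₂₃⟩}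
    {e₁₃ : G.E.Fiber ⟨(y₁, y₃), h₁₂.trans h₂₃⟩} :
    G.E.Composes G.fInv h₁₂ h₂₃ e₁₂ e₂₃ e₁₃ ↔ G.comp h₁₂ h₂₃ e₁₂ e₂₃ = e₁₃ :=
  ⟨fun h => ((G.existsUnique_composes h₁₂ h₂₃ e₁₂ e₂₃).choose_spec.2 _ h).symm,
    fun h => h ▸ composes_comp h₁₂ h₂₃ e₁₂ e₂₃⟩

variable (h₁₂ : π y₁ = π y₂) (h₂₃ : π y₂ = π y₃) (h₃₄ : π y₃ = π y₄)
  (e₁₂ : G.E.Fiber ⟨(y₁, y₂), h₁₂⟩) (e₂₃ : G.E.Fiber ⟨(y₂, y₃), h₂₃⟩)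
  (e₃₄ : G.E.Fiber ⟨(y₃, y₄), h₃₄⟩) (c : H)

/-- Centrality of `f⁻¹` is what makes the product left equivariant: it moves `c` from the first
factor to the inverse of the third, where `e⁻¹ ◁ c⁻¹ = (c e)⁻¹`. -/
theorem comp_smul : G.comp h₁₂ h₂₃ (c • e₁₂) e₂₃ = c • G.comp h₁₂ h₂₃ e₁₂ e₂₃ := by
  refine composes_iff.1 ?_
  have h := composes_comp h₁₂ h₂₃ e₁₂ e₂₃
  have h1 := (congrArg (c • ·) (G.isCentral.2 ⟨(y₁, y₂, y₃), h₁₂, h₂₃⟩ c⁻¹))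
  -- This reads `f⁻¹ = c (f⁻¹ ◁ c⁻¹)`, that is, `f⁻¹` is invariant under conjugation.
  simp only [smul_inv_smul] at h1
  have h2 := congrArg (fun z => c • op c⁻¹ • z) h
  refine (h1.trans h2).trans ?_
  refine congrArg (fun z => ProdFiber.mk H (ProdFiber.mk H (c • e₁₂) e₂₃) z) ?_
  exact congrArg (fun z => Flip.mk (z • G.comp h₁₂ h₂₃ e₁₂ e₂₃)) (inv_inv c)

theorem comp_op_smul_left :
    G.comp h₁₂ h₂₃ (op c • e₁₂) e₂₃ = G.comp h₁₂ h₂₃ e₁₂ (c • e₂₃) := by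
  refine composes_iff.1 ((composes_comp h₁₂ h₂₃ e₁₂ (c • e₂₃)).trans ?_)
  exact congrArg (fun z => ProdFiber.mk H z (Flip.mk _)) (ProdFiber.mk_op_smul _ _ _).symm

theorem comp_op_smul :
    G.comp h₁₂ h₂₃ e₁₂ (op c • e₂₃) = op c • G.comp h₁₂ h₂₃ e₁₂ e₂₃ := by
  refine composes_iff.1 ((composes_comp h₁₂ h₂₃ e₁₂ e₂₃).trans ?_)
  refine Eq.trans ?_ (ProdFiber.mk_op_smul (P := ProdFiber H (G.E.Fiber ⟨(y₁, y₂), h₁₂⟩)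
    (G.E.Fiber ⟨(y₂, y₃), h₂₃⟩)) (ProdFiber.mk H e₁₂ e₂₃) c
    (Flip.mk (op c • G.comp h₁₂ h₂₃ e₁₂ e₂₃))).symm
  refine congrArg (ProdFiber.mk H _) (congrArg Flip.mk ?_)
  -- In the inverse bibundle `c (e ◁ c)⁻¹ = e⁻¹`, which cancels the factor coming from `e₂₃ ◁ c`.
  exact (inv_smul_smul (op c) _).symm

theorem comp_assoc : G.comp (h₁₂.trans h₂₃) h₃₄ (G.comp h₁₂ h₂₃ e₁₂ e₂₃) e₃₄ =
    G.comp h₁₂ (h₂₃.trans h₃₄) e₁₂ (G.comp h₂₃ h₃₄ e₂₃ e₃₄) :=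
  (composes_iff.1 (G.cocycle h₁₂ h₂₃ h₃₄ e₁₂ e₂₃ e₃₄ _ _ _ (composes_comp _ _ _ _)
    (composes_comp _ _ _ _) (composes_comp _ _ _ _))).symm

/-- In `f⁻¹ = [[e₁₂, e₂₃], e₁₃⁻¹]` both `f⁻¹` and `[e₁₂, e₂₃]` are smooth, hence so is the remaining
entry. -/
theorem smoothAt_comp {p₁ p₂ p₃ : Euc n → Y} (hp₁ : PlotNear p₁ v) (hp₂ : PlotNear p₂ v)
    (hp₃ : PlotNear p₃ v) (h₁₂ : ∀ w, π (p₁ w) = π (p₂ w)) (h₂₃ : ∀ w, π (p₂ w) = π (p₃ w))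
    {e₁₂ : ∀ w, G.E.Fiber ⟨(p₁ w, p₂ w), h₁₂ w⟩} {e₂₃ : ∀ w, G.E.Fiber ⟨(p₂ w, p₃ w), h₂₃ w⟩}
    (he₁₂ : G.E.SmoothAt (fun w => ⟨(p₁ w, p₂ w), h₁₂ w⟩) e₁₂ v)
    (he₂₃ : G.E.SmoothAt (fun w => ⟨(p₂ w, p₃ w), h₂₃ w⟩) e₂₃ v) :
    G.E.SmoothAt (fun w => ⟨(p₁ w, p₃ w), (h₁₂ w).trans (h₂₃ w)⟩)
      (fun w => G.comp (h₁₂ w) (h₂₃ w) (e₁₂ w) (e₂₃ w)) v := by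
  have hp := plotNear_triple hp₁ hp₂ hp₃ h₁₂ h₂₃
  have h1 := RightBundle.smoothAt_mk (P := (G.E.pullback p₁₂).toRightBundle)
    (E := (G.E.pullback p₂₃).toPrincipalBundle)
    (PrincipalBundle.smoothAt_pullback.2 he₁₂) (PrincipalBundle.smoothAt_pullback.2 he₂₃) hp
  have h2 := G.isCentral.1.smoothAt hp
  exact PrincipalBundle.smoothAt_pullback.1 (Bibundle.smoothAt_of_inv (E := G.E.pullback p₁₃) hp
    (Bibundle.smoothAt_of_mk (E := (G.E.pullback p₁₂).mul (G.E.pullback p₂₃)) hp h1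
    (h2.congr (Filter.Eventually.of_forall fun w => (composes_comp _ _ _ _).symm))))

end BundleGerbe

end Gerbes

end NonabelianGerbe
namespace NonabelianGerbe

section Gerbes

variable {k : ℕ} {H : Type u} [Group H] [TopologicalSpace H] [ChartedSpace (Euc k) H]
  [LieGroup (𝓡 k) ∞ H] {m : ℕ} {D : Type u} [Group D] [TopologicalSpace D]
  [ChartedSpace (Euc m) D] [LieGroup (𝓡 m) ∞ D]
  {M : Type*} {Y : Type*} [DiffeologicalSpace Y] {π : Y → M}

/-! ### The units of a bundle gerbe -/

namespace BundleGerbe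

variable {G : BundleGerbe k H π} {y₁ y₂ y₃ : Y}

theorem comp_right_injective (h₁₂ : π y₁ = π y₂) (h₂₃ : π y₂ = π y₃)
    (e₁₂ : G.E.Fiber ⟨(y₁, y₂), h₁₂⟩) : Function.Injective (G.comp h₁₂ h₂₃ e₁₂) := by
  intro e e' h
  obtain ⟨c, rfl⟩ := Bibundle.exists_op_smul_eq e e'
  rw [comp_op_smul] at h
  have : c = 1 := Bibundle.op_smul_left_injective (E := G.E) (G.comp h₁₂ h₂₃ e₁₂ e)
    (by rw [← h, MulOpposite.op_one, one_smul])
  rw [this, MulOpposite.op_one, one_smul]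

theorem comp_left_injective (h₁₂ : π y₁ = π y₂) (h₂₃ : π y₂ = π y₃)
    (e₂₃ : G.E.Fiber ⟨(y₂, y₃), h₂₃⟩) : Function.Injective fun e => G.comp h₁₂ h₂₃ e e₂₃ := by
  intro e e' h
  dsimp only at h
  obtain ⟨c, rfl⟩ := G.E.exists_smul_eq e e'
  rw [comp_smul] at h
  have : c = 1 := G.E.smul_left_injective (G.comp h₁₂ h₂₃ e e₂₃) (by rw [← h, one_smul])
  rw [this, one_smul]

/-- A right factor `c` is moved to the left through `e₂₃` and then through `e₁₂`, each time at the
cost of applying `φ`. -/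
theorem φ_comp (h₁₂ : π y₁ = π y₂) (h₂₃ : π y₂ = π y₃) (e₁₂ : G.E.Fiber ⟨(y₁, y₂), h₁₂⟩)
    (e₂₃ : G.E.Fiber ⟨(y₂, y₃), h₂₃⟩) :
    G.E.φ (G.comp h₁₂ h₂₃ e₁₂ e₂₃) = G.E.φ e₁₂ * G.E.φ e₂₃ := by
  ext c
  apply Bibundle.φ_eq
  rw [← comp_op_smul, ← G.E.φ_smul, ← comp_op_smul_left, ← G.E.φ_smul, comp_smul]
  rfl

/-- Since `(c e)(c e) = c φ_e(c) (e e) = c φ_e(c) h e`, the element `c e` is idempotent as soon as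
`φ_e(c) = h⁻¹`. The explicit form of `c` also gives smoothness of the units. -/
theorem comp_self_smul {y : Y} (e : G.E.Fiber ⟨(y, y), rfl⟩) {h c : H}
    (he : G.comp rfl rfl e e = h • e) (hc : (G.E.φ e)⁻¹ h⁻¹ = c) :
    G.comp rfl rfl (c • e) (c • e) = c • e := by
  have hc' : G.E.φ e c = h⁻¹ := by
    rw [← hc, MulAut.inv_apply]
    exact (G.E.φ e).apply_symm_apply _
  rw [comp_smul, ← comp_op_smul_left, ← G.E.φ_smul, comp_smul, he, hc', inv_smul_smul]

theorem exists_comp_self (G : BundleGerbe k H π) (y : Y) :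
    ∃ u : G.E.Fiber ⟨(y, y), rfl⟩, G.comp rfl rfl u u = u := by
  obtain ⟨e⟩ := G.E.nonempty ⟨(y, y), rfl⟩
  obtain ⟨h, hh⟩ := G.E.exists_smul_eq e (G.comp rfl rfl e e)
  exact ⟨_, comp_self_smul e hh.symm rfl⟩

/-- The unit in the fibre over the diagonal. -/
noncomputable def unit (G : BundleGerbe k H π) (y : Y) : G.E.Fiber ⟨(y, y), rfl⟩ :=
  (G.exists_comp_self y).choose

theorem comp_unit_unit (y : Y) : G.comp rfl rfl (G.unit y) (G.unit y) = G.unit y :=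
  (G.exists_comp_self y).choose_spec

/-- By associativity `u (u e) = (u u) e = u e`, and left multiplication by `u` is injective.
Idempotents are therefore two-sided units, and hence unique. -/
theorem comp_eq_right {y₁ y₂ : Y} (h : π y₁ = π y₂) {u : G.E.Fiber ⟨(y₁, y₁), rfl⟩}
    (hu : G.comp rfl rfl u u = u) (e : G.E.Fiber ⟨(y₁, y₂), h⟩) : G.comp rfl h u e = e := by
  apply comp_right_injective rfl h u
  have := comp_assoc (G := G) rfl rfl h u u e
  rw [hu] at this
  exact this.symm

theorem comp_eq_left {y₁ y₂ : Y} (h : π y₁ = π y₂) {u : G.E.Fiber ⟨(y₂, y₂), rfl⟩}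
    (hu : G.comp rfl rfl u u = u) (e : G.E.Fiber ⟨(y₁, y₂), h⟩) : G.comp h rfl e u = e := by
  apply comp_left_injective h rfl u
  have := comp_assoc (G := G) h rfl rfl e u u
  rw [hu] at this
  exact this

theorem eq_unit {y : Y} {u : G.E.Fiber ⟨(y, y), rfl⟩} (hu : G.comp rfl rfl u u = u) :
    u = G.unit y :=
  (comp_eq_left rfl (comp_unit_unit y) u).symm.trans (comp_eq_right rfl hu _)

/-- `φ` is multiplicative, so it sends the unit to an idempotent of a group. -/
theorem φ_unit (y : Y) : G.E.φ (G.unit y) = 1 := by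
  have h := φ_comp (G := G) rfl rfl (G.unit y) (G.unit y)
  rw [comp_unit_unit] at h
  exact (mul_eq_left.1 h.symm)

theorem smoothAt_unit {n : ℕ} {v : Euc n} {p : Euc n → Y} (hp : PlotNear p v) :
    G.E.SmoothAt (fun w => ⟨(p w, p w), rfl⟩) (fun w => G.unit (p w)) v := by
  have hpp : PlotNear (fun w => (⟨(p w, p w), rfl⟩ : Y2 π)) v := plotNear_pair hp hp fun _ => rfl
  obtain ⟨e, he⟩ := G.E.exists_smoothAt (fun w => (⟨(p w, p w), rfl⟩ : Y2 π)) v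
  obtain ⟨h, hh, hhe⟩ := (smoothAt_comp hp hp hp (fun _ => rfl) (fun _ => rfl) he he).exists_smul
    he hpp
  -- A smooth lift `e` with `e e = h e` is corrected to the unit by the factor `φ_e⁻¹(h⁻¹)`, which
  -- is smooth because `h` is.
  refine (he.smul (Bibundle.smoothNear_φ_inv he hpp hh.inv)).congr
    (Filter.Eventually.of_forall fun w => ?_)
  exact (eq_unit (comp_self_smul (e w) (hhe w) rfl)).symm

end BundleGerbe

/-! ### Modules as actions -/

/-- The isomorphisms `Q₁ E → Q₂` of a module over a gerbe with bibundle `E`, as a map of pairs. -/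
structure GerbeAction {X : CrossedModule k H m D} (G : BundleGerbe k H π) (Q : DHBundle X Y) where
  act : ∀ {y₁ y₂ : Y} (h : π y₁ = π y₂), Q.Fiber y₁ → G.E.Fiber ⟨(y₁, y₂), h⟩ → Q.Fiber y₂
  act_smul : ∀ {y₁ y₂ : Y} (h : π y₁ = π y₂) (d : D) (q : Q.Fiber y₁)
    (e : G.E.Fiber ⟨(y₁, y₂), h⟩), act h (d • q) e = d • act h q e
  act_op_smul : ∀ {y₁ y₂ : Y} (h : π y₁ = π y₂) (c : H) (q : Q.Fiber y₁)
    (e : G.E.Fiber ⟨(y₁, y₂), h⟩), act h (op c • q) e = act h q (c • e)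
  ψ_act : ∀ {y₁ y₂ : Y} (h : π y₁ = π y₂) (q : Q.Fiber y₁)
    (e : G.E.Fiber ⟨(y₁, y₂), h⟩), Q.ψ (act h q e) = Q.ψ q * G.E.φ e
  act_act : ∀ {y₁ y₂ y₃ : Y} (h₁₂ : π y₁ = π y₂) (h₂₃ : π y₂ = π y₃) (q : Q.Fiber y₁)
    (e₁₂ : G.E.Fiber ⟨(y₁, y₂), h₁₂⟩) (e₂₃ : G.E.Fiber ⟨(y₂, y₃), h₂₃⟩),
    act h₂₃ (act h₁₂ q e₁₂) e₂₃ = act (h₁₂.trans h₂₃) q (G.comp h₁₂ h₂₃ e₁₂ e₂₃)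
  smooth : ∀ {n : ℕ} {v : Euc n} {p₁ p₂ : Euc n → Y} (h : ∀ w, π (p₁ w) = π (p₂ w))
    {q : ∀ w, Q.Fiber (p₁ w)} {e : ∀ w, G.E.Fiber ⟨(p₁ w, p₂ w), h w⟩},
    PlotNear p₁ v → PlotNear p₂ v → Q.SmoothAt p₁ q v →
    G.E.SmoothAt (fun w => ⟨(p₁ w, p₂ w), h w⟩) e v →
    Q.SmoothAt p₂ (fun w => act (h w) (q w) (e w)) v

variable {X : CrossedModule k H m D} {G : BundleGerbe k H π} {Q : DHBundle X Y}

namespace GerbeAction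

variable (K : GerbeAction G Q)

theorem act_injective {y₁ y₂ : Y} (h : π y₁ = π y₂) (e : G.E.Fiber ⟨(y₁, y₂), h⟩) :
    Function.Injective fun q => K.act h q e := by
  intro q q' hq
  dsimp only at hq
  obtain ⟨d, rfl⟩ := Q.exists_smul_eq q q'
  rw [K.act_smul] at hq
  have : d = 1 := Q.smul_left_injective (K.act h q e) (by rw [← hq, one_smul])
  rw [this, one_smul]

/-- Acting twice by the unit is acting once, and the action of a fixed element is injective. -/
theorem act_unit {y : Y} (q : Q.Fiber y) : K.act rfl q (G.unit y) = q := by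
  apply K.act_injective rfl (G.unit y)
  have := K.act_act rfl rfl q (G.unit y) (G.unit y)
  rw [BundleGerbe.comp_unit_unit] at this
  exact this

/-- Right equivariance is forced by `ψ`: `(q e) ◁ c = α(ψ_q φ_e(c)) (q e) = (q ◁ φ_e(c)) e = q
(φ_e(c) e)`. -/
theorem act_op_smul_right {y₁ y₂ : Y} (h : π y₁ = π y₂) (c : H) (q : Q.Fiber y₁)
    (e : G.E.Fiber ⟨(y₁, y₂), h⟩) : K.act h q (op c • e) = op c • K.act h q e := by
  rw [Q.right_eq, K.ψ_act, ← K.act_smul, MulAut.mul_apply, ← Q.right_eq, K.act_op_smul,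
    G.E.φ_smul]

/-- The isomorphism `Q₁ E → Q₂`. -/
noncomputable def iso : DHIso ((Q.pullback p₁).mul G.E) (Q.pullback p₂) :=
  .ofSmoothAt (fun x => ProdFiber.lift (fun q e => K.act x.2 q e) fun q c e =>
      K.act_op_smul x.2 c q e)
    (fun x d => ProdFiber.ind fun q e => K.act_smul x.2 d q e)
    (fun x => ProdFiber.ind fun q e => K.ψ_act x.2 q e)
    fun n p v z hp hz => by
      obtain ⟨q, e, hq, he, hz⟩ := RightBundle.exists_of_smoothAt_prod hz
      refine PrincipalBundle.smoothAt_pullback.2 ((K.smooth (fun w => (p w).2)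
        ((PlotNear.of_isPlot hp).comp p₁) ((PlotNear.of_isPlot hp).comp p₂)
        (PrincipalBundle.smoothAt_pullback.1 hq) he).congr ?_)
      filter_upwards [hz] with w hw
      rw [hw]
      rfl

/-- The module structure given by an action and a trivial bibundle. -/
noncomputable def toModuleStructure (Z : TrivialBibundle m D (Y2 π)) : ModuleStructure G Q Z where
  κ := K.iso.trans (Z.toMulDH _)
  compat := by
    have key : ∀ {y₁ y₂ : Y} (h : π y₁ = π y₂) (q₁ : Q.Fiber y₁) (e : G.E.Fiber ⟨(y₁, y₂), h⟩)
        (q₂ : Q.Fiber y₂), Acts (K.iso.trans (Z.toMulDH _)) h q₁ e q₂ ↔ K.act h q₁ e = q₂ :=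
      fun h q₁ e q₂ => ((Z.toMulDH (Q.pullback p₂)).bijective _).1.eq_iff
    intro y₁ y₂ y₃ h₁₂ h₂₃ q₁ q₂ q₃ e₁₂ e₂₃ e₁₃ h1 h2 h3
    rw [key] at h1 h2 ⊢
    rw [← h2, ← h1, K.act_act, BundleGerbe.composes_iff.1 h3]

theorem toModuleStructure_acts {Z : TrivialBibundle m D (Y2 π)} {y₁ y₂ : Y} {h : π y₁ = π y₂}
    {q₁ : Q.Fiber y₁} {e : G.E.Fiber ⟨(y₁, y₂), h⟩} {q₂ : Q.Fiber y₂} :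
    Acts (K.toModuleStructure Z).κ h q₁ e q₂ ↔ K.act h q₁ e = q₂ :=
  ((Z.toMulDH (Q.pullback p₂)).bijective _).1.eq_iff

end GerbeAction

namespace ModuleStructure

variable {Z : TrivialBibundle m D (Y2 π)} (K : ModuleStructure G Q Z)

/-- The isomorphism `Q₁ E → Q₂`. -/
noncomputable def iso : DHIso ((Q.pullback p₁).mul G.E) (Q.pullback p₂) :=
  K.κ.trans (Z.toMulDH _).symm

/-- The class `[z⁻¹, q₂]` is the image of `q₂` under the isomorphism `Q₂ → Z Q₂` given by the
section, which can be inverted on both sides. -/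
theorem acts_iff {y₁ y₂ : Y} {h : π y₁ = π y₂} {q₁ : Q.Fiber y₁}
    {e : G.E.Fiber ⟨(y₁, y₂), h⟩} {q₂ : Q.Fiber y₂} : Acts K.κ h q₁ e q₂ ↔
      K.iso.toFun (x := ⟨(y₁, y₂), h⟩) (DHBundle.mkMul (Q := Q.pullback p₁) q₁ e) = q₂ := by
  have h1 := (Z.toMulDH (Q.pullback p₂)).apply_symm (K.κ.toFun (x := ⟨(y₁, y₂), h⟩)
    (DHBundle.mkMul (Q := Q.pullback p₁) q₁ e))
  refine Iff.trans ?_ ((Z.toMulDH (Q.pullback p₂)).bijective ⟨(y₁, y₂), h⟩).1.eq_iff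
  change _ = _ ↔ (Z.toMulDH (Q.pullback p₂)).toFun ((Z.toMulDH (Q.pullback p₂)).symm.toFun _) = _
  rw [h1]
  rfl

/-- The action of a module structure. -/
noncomputable def action : GerbeAction G Q where
  act {y₁ y₂} h q e :=
    K.iso.toFun (x := ⟨(y₁, y₂), h⟩) (DHBundle.mkMul (Q := Q.pullback p₁) q e)
  act_smul {y₁ y₂} h d q e := K.iso.map_smul (x := ⟨(y₁, y₂), h⟩) d
    (DHBundle.mkMul (Q := Q.pullback p₁) q e)
  act_op_smul h c q e := congrArg _ (ProdFiber.mk_op_smul _ _ _)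
  ψ_act {y₁ y₂} h q e := K.iso.map_ψ (x := ⟨(y₁, y₂), h⟩) _
  act_act h₁₂ h₂₃ q e₁₂ e₂₃ := (K.acts_iff.1 (K.compat h₁₂ h₂₃ q _ _ e₁₂ e₂₃ _
    (K.acts_iff.2 rfl) (K.acts_iff.2 rfl) (BundleGerbe.composes_comp _ _ _ _))).symm
  smooth h := fun hp₁ hp₂ hq he => by
    have hp := plotNear_pair (P := fun x => π x.1 = π x.2) hp₁ hp₂ h
    exact PrincipalBundle.smoothAt_pullback.1 (K.iso.smoothAt (RightBundle.smoothAt_mk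
      (PrincipalBundle.smoothAt_pullback.2 hq) he hp) hp)

theorem acts_iff_act {y₁ y₂ : Y} {h : π y₁ = π y₂} {q₁ : Q.Fiber y₁}
    {e : G.E.Fiber ⟨(y₁, y₂), h⟩} {q₂ : Q.Fiber y₂} :
    Acts K.κ h q₁ e q₂ ↔ K.action.act h q₁ e = q₂ :=
  K.acts_iff

theorem action_toModuleStructure (K : GerbeAction G Q) {y₁ y₂ : Y} {h : π y₁ = π y₂}
    (q : Q.Fiber y₁) (e : G.E.Fiber ⟨(y₁, y₂), h⟩) :
    (K.toModuleStructure Z).action.act h q e = K.act h q e :=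
  acts_iff_act _ |>.1 (K.toModuleStructure_acts.2 rfl)

/-- Only the underlying map of `κ` is data, and it is determined by the action because every point
of `Q₁ E` is a class `[q, e]`. -/
theorem ext {K K' : ModuleStructure G Q Z}
    (h : ∀ {y₁ y₂ : Y} (h : π y₁ = π y₂) (q : Q.Fiber y₁) (e : G.E.Fiber ⟨(y₁, y₂), h⟩),
      K.action.act h q e = K'.action.act h q e) : K = K' := by
  suffices hκ : K.κ = K'.κ by
    cases K
    cases K'
    cases hκ
    rfl
  have hfun : @DHIso.toFun _ _ _ _ _ _ _ _ _ _ _ _ _ _ _ K.κ =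
      @DHIso.toFun _ _ _ _ _ _ _ _ _ _ _ _ _ _ _ K'.κ := by
    funext x z
    induction z using ProdFiber.ind with | _ q e
    have h1 : Acts K.κ x.2 q e (K'.action.act x.2 q e) := K.acts_iff_act.2 (h x.2 q e)
    have h2 : Acts K'.κ x.2 q e (K'.action.act x.2 q e) := K'.acts_iff_act.2 rfl
    exact h1.trans h2.symm
  generalize K.κ = a at hfun
  generalize K'.κ = a' at hfun
  cases a
  cases a'
  cases hfun
  rfl

end ModuleStructure

theorem GerbeModule.equivalent_iff {L L' : GerbeModule X G} :
    L.Equivalent L' ↔ ∃ a : DHIso L.Q L'.Q, ∀ {y₁ y₂ : Y} (h : π y₁ = π y₂) (q : L.Q.Fiber y₁)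
      (e : G.E.Fiber ⟨(y₁, y₂), h⟩),
      a.toFun (L.str.action.act h q e) = L'.str.action.act h (a.toFun q) e := by
  refine exists_congr fun a => ⟨fun ha y₁ y₂ h q e => ?_, fun ha y₁ y₂ h q₁ e q₂ => ?_⟩
  · exact (L'.str.acts_iff_act.1 ((ha h q e _).1 (L.str.acts_iff_act.2 rfl))).symm
  · rw [ModuleStructure.acts_iff_act, ModuleStructure.acts_iff_act, ← ha,
      (a.bijective y₂).1.eq_iff]

end Gerbes

end NonabelianGerbe
namespace NonabelianGerbe

section Gerbes

variable {k : ℕ} {H : Type u} [Group H] [TopologicalSpace H] [ChartedSpace (Euc k) H]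
  [LieGroup (𝓡 k) ∞ H] {m : ℕ} {D : Type u} [Group D] [TopologicalSpace D]
  [ChartedSpace (Euc m) D] [LieGroup (𝓡 m) ∞ D]
  {M : Type*} {Y : Type*} [DiffeologicalSpace Y] {π : Y → M}

/-! ### Intertwining bibundles -/

/-- A bibundle `N` with a smooth relation `n₁ e' = e n₂` between the bibundles of two gerbes, which
is compatible with all actions and with the products of the gerbes. -/
structure Intertwiner (G G' : BundleGerbe k H π) where
  N : Bibundle k H Y
  rel : ∀ {y₁ y₂ : Y} (h : π y₁ = π y₂), N.Fiber y₁ → G'.E.Fiber ⟨(y₁, y₂), h⟩ → N.Fiber y₂ →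
    G.E.Fiber ⟨(y₁, y₂), h⟩ → Prop
  existsUnique : ∀ {y₁ y₂ : Y} (h : π y₁ = π y₂) n₁ e' (n₂ : N.Fiber y₂), ∃! e, rel h n₁ e' n₂ e
  rel_smul : ∀ {y₁ y₂ : Y} {h : π y₁ = π y₂} {n₁ e'} {n₂ : N.Fiber y₂} {e} (c : H),
    rel h n₁ e' n₂ e → rel h (c • n₁) e' n₂ (c • e)
  rel_op_smul_left : ∀ {y₁ y₂ : Y} {h : π y₁ = π y₂} {n₁ e'} {n₂ : N.Fiber y₂} {e} {c : H},
    rel h (op c • n₁) e' n₂ e ↔ rel h n₁ (c • e') n₂ e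
  rel_smul_right : ∀ {y₁ y₂ : Y} {h : π y₁ = π y₂} {n₁ e'} {n₂ : N.Fiber y₂} {e} {c : H},
    rel h n₁ e' (c • n₂) e ↔ rel h n₁ e' n₂ (op c • e)
  rel_op_smul : ∀ {y₁ y₂ : Y} {h : π y₁ = π y₂} {n₁ e'} {n₂ : N.Fiber y₂} {e} (c : H),
    rel h n₁ e' n₂ e → rel h n₁ (op c • e') (op c • n₂) e
  rel_comp : ∀ {y₁ y₂ y₃ : Y} {h₁₂ : π y₁ = π y₂} {h₂₃ : π y₂ = π y₃} {n₁ n₂} {n₃ : N.Fiber y₃}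
    {e'₁₂ e'₂₃ e₁₂ e₂₃}, rel h₁₂ n₁ e'₁₂ n₂ e₁₂ → rel h₂₃ n₂ e'₂₃ n₃ e₂₃ →
    rel (h₁₂.trans h₂₃) n₁ (G'.comp h₁₂ h₂₃ e'₁₂ e'₂₃) n₃ (G.comp h₁₂ h₂₃ e₁₂ e₂₃)
  smooth : ∀ {n : ℕ} {v : Euc n} {p₁ p₂ : Euc n → Y} (h : ∀ w, π (p₁ w) = π (p₂ w))
    {n₁ : ∀ w, N.Fiber (p₁ w)} {e' : ∀ w, G'.E.Fiber ⟨(p₁ w, p₂ w), h w⟩}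
    {n₂ : ∀ w, N.Fiber (p₂ w)} {e : ∀ w, G.E.Fiber ⟨(p₁ w, p₂ w), h w⟩},
    (∀ w, rel (h w) (n₁ w) (e' w) (n₂ w) (e w)) → PlotNear p₁ v → PlotNear p₂ v →
    N.SmoothAt p₁ n₁ v → G'.E.SmoothAt (fun w => ⟨(p₁ w, p₂ w), h w⟩) e' v →
    N.SmoothAt p₂ n₂ v → G.E.SmoothAt (fun w => ⟨(p₁ w, p₂ w), h w⟩) e v

namespace Intertwiner

variable {G G' : BundleGerbe k H π} (P : Intertwiner G G') {y₁ y₂ : Y} {h : π y₁ = π y₂}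
  {n₁ : P.N.Fiber y₁} {e' : G'.E.Fiber ⟨(y₁, y₂), h⟩} {n₂ : P.N.Fiber y₂}
  {e : G.E.Fiber ⟨(y₁, y₂), h⟩}

variable {P}

theorem rel_smul_iff {c : H} : P.rel h (c • n₁) e' n₂ e ↔ P.rel h n₁ e' n₂ (c⁻¹ • e) := by
  constructor <;> intro hr
  · simpa using P.rel_smul c⁻¹ hr
  · simpa using P.rel_smul c hr

theorem rel_op_smul_iff {c : H} :
    P.rel h n₁ (op c • e') n₂ e ↔ P.rel h n₁ e' (op c⁻¹ • n₂) e := by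
  constructor <;> intro hr
  · simpa using P.rel_op_smul c⁻¹ hr
  · simpa using P.rel_op_smul c hr

/-- Multiply `n₁ e' = e n₂` on the right by `c` and move `c` to the far left on each side; the
results agree because the left action on `E` is free. -/
theorem φ_eq (hr : P.rel h n₁ e' n₂ e) :
    P.N.φ n₁ * G'.E.φ e' = G.E.φ e * P.N.φ n₂ := by
  ext c
  have h1 := P.rel_op_smul c hr
  rw [← G'.E.φ_smul, ← P.rel_op_smul_left, ← P.N.φ_smul, ← P.N.φ_smul, P.rel_smul_right,
    ← G.E.φ_smul] at h1
  have h2 := P.rel_smul (P.N.φ n₁ (G'.E.φ e' c)) hr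
  exact (G.E.smul_left_injective e ((P.existsUnique h _ _ _).unique h1 h2)).symm

/-- A factor on the left of `n₁` becomes, after applying `φ_{n₁}⁻¹`, a factor between `n₁` and `e'`.
-/
theorem rel_left_smul {c : H} (hr : P.rel h n₁ e' n₂ e) :
    P.rel h n₁ ((P.N.φ n₁)⁻¹ c • e') n₂ (c • e) := by
  rw [← P.rel_op_smul_left, ← P.N.φ_smul]
  convert! P.rel_smul c hr using 2
  exact (P.N.φ n₁).apply_symm_apply c

/-- For fixed `n₁` and `n₂`, multiplying `e'` by `d` multiplies `e` by `φ_{n₁}(d)`, so `e' ↦ e` is a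
bijection of torsors. This is what makes an intertwiner invertible. -/
theorem existsUnique_right (h : π y₁ = π y₂) (n₁ : P.N.Fiber y₁) (e : G.E.Fiber ⟨(y₁, y₂), h⟩)
    (n₂ : P.N.Fiber y₂) : ∃! e', P.rel h n₁ e' n₂ e := by
  obtain ⟨e'₀⟩ := G'.E.nonempty ⟨(y₁, y₂), h⟩
  obtain ⟨e₀, he₀, -⟩ := P.existsUnique h n₁ e'₀ n₂
  obtain ⟨c, rfl⟩ := G.E.exists_smul_eq e₀ e
  refine ⟨_, rel_left_smul he₀, fun e' he' => ?_⟩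
  obtain ⟨d, rfl⟩ := G'.E.exists_smul_eq ((P.N.φ n₁)⁻¹ c • e'₀) e'
  have h1 := rel_left_smul (P := P) (c := P.N.φ n₁ d) (rel_left_smul (c := c) he₀)
  rw [MulAut.inv_apply_self] at h1
  have h2 := (P.existsUnique h _ _ _).unique he' h1
  have : P.N.φ n₁ d = 1 := G.E.smul_left_injective (c • e₀) (by rw [← h2, one_smul])
  rw [(map_eq_one_iff _ (P.N.φ n₁).injective).1 this, one_smul]

theorem smooth_right {n : ℕ} {v : Euc n} {p₁ p₂ : Euc n → Y} (h : ∀ w, π (p₁ w) = π (p₂ w))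
    {n₁ : ∀ w, P.N.Fiber (p₁ w)} {e' : ∀ w, G'.E.Fiber ⟨(p₁ w, p₂ w), h w⟩}
    {n₂ : ∀ w, P.N.Fiber (p₂ w)} {e : ∀ w, G.E.Fiber ⟨(p₁ w, p₂ w), h w⟩}
    (hr : ∀ w, P.rel (h w) (n₁ w) (e' w) (n₂ w) (e w)) (hp₁ : PlotNear p₁ v)
    (hp₂ : PlotNear p₂ v) (hn₁ : P.N.SmoothAt p₁ n₁ v)
    (he : G.E.SmoothAt (fun w => ⟨(p₁ w, p₂ w), h w⟩) e v) (hn₂ : P.N.SmoothAt p₂ n₂ v) :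
    G'.E.SmoothAt (fun w => ⟨(p₁ w, p₂ w), h w⟩) e' v := by
  have hp : PlotNear (fun w => (⟨(p₁ w, p₂ w), h w⟩ : Y2 π)) v := plotNear_pair hp₁ hp₂ h
  -- Any smooth `e'₀` has a smooth partner `e₀`; writing `e = c e₀`, the solution is `e' =
  -- φ_{n₁}⁻¹(c) e'₀`.
  obtain ⟨e'₀, he'₀⟩ := G'.E.exists_smoothAt (fun w => (⟨(p₁ w, p₂ w), h w⟩ : Y2 π)) v
  choose e₀ hr₀ _ using fun w => P.existsUnique (h w) (n₁ w) (e'₀ w) (n₂ w)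
  obtain ⟨c, hc, hce⟩ := he.exists_smul (P.smooth h hr₀ hp₁ hp₂ hn₁ he'₀ hn₂) hp
  refine (he'₀.smul (Bibundle.smoothNear_φ_inv hn₁ hp₁ hc)).congr
    (Filter.Eventually.of_forall fun w => ?_)
  refine (existsUnique_right (h w) (n₁ w) (e w) (n₂ w)).unique (hr w) ?_
  rw [hce]
  exact rel_left_smul (hr₀ w)

/-- The inverse, with the bibundle `N⁻¹`. -/
def symm (P : Intertwiner G G') : Intertwiner G' G where
  N := P.N.inv
  rel h n₁ e n₂ e' := P.rel h n₁.val e' n₂.val e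
  existsUnique h n₁ e n₂ := existsUnique_right h n₁.val e n₂.val
  -- On `N⁻¹` left multiplication by `c` is right multiplication by `c⁻¹` on `N`, so the four
  -- equivariance laws of the relation are exchanged with one another.
  rel_smul {_ _ _ _ _ _ _} c hr := by
    refine P.rel_op_smul_left.2 ?_
    rwa [inv_smul_smul]
  rel_op_smul_left {_ _ h n₁ e n₂ e' c} := by
    refine (rel_smul_iff (c := c⁻¹)).trans ?_
    rw [inv_inv]
  rel_smul_right := rel_op_smul_iff.symm
  rel_op_smul {_ _ h n₁ e n₂ e'} c hr := by
    refine P.rel_smul_right.2 ?_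
    rwa [MulOpposite.unop_op, MulOpposite.op_inv, inv_smul_smul]
  rel_comp h₁ h₂ := P.rel_comp h₁ h₂
  smooth h := fun hr hp₁ hp₂ hn₁ he hn₂ => smooth_right h hr hp₁ hp₂
    (Bibundle.smoothAt_of_inv hp₁ hn₁) he (Bibundle.smoothAt_of_inv hp₂ hn₂)

end Intertwiner

/-- The intertwining bibundle of a stable isomorphism. -/
def StableIsoOver.toIntertwiner {G G' : BundleGerbe k H π} (S : StableIsoOver G G') :
    Intertwiner G G' where
  N := S.N
  rel := Transfers S.ι
  existsUnique {y₁ y₂} h n₁ e' n₂ := by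
    exact Bibundle.existsUnique_mk_eq (E := S.η.toBibundle) (F := G.E.Fiber ⟨(y₁, y₂), h⟩)
      (S.ι.toFun (x := ⟨(y₁, y₂), h⟩) (ProdFiber.mk H (ProdFiber.mk H n₁ e') (Flip.mk n₂)))
      (S.η.sec ⟨(y₁, y₂), h⟩)
  rel_smul {y₁ y₂ h n₁ e' n₂ e} c hr := by
    refine (S.ι.map_smul (x := ⟨(y₁, y₂), h⟩) c
      (ProdFiber.mk H (ProdFiber.mk H n₁ e') (Flip.mk n₂))).trans ?_
    refine (congrArg (c • ·) hr).trans ?_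
    -- Centrality of `ℓ⁻¹` carries `c` past it: `c [ℓ⁻¹, e] = [ℓ⁻¹ ◁ c, e] = [ℓ⁻¹, c e]`.
    refine (congrArg (fun z => ProdFiber.mk H z e) (S.η.isCentral.2 ⟨(y₁, y₂), h⟩ c)).trans ?_
    exact ProdFiber.mk_op_smul _ _ _
  rel_op_smul_left {y₁ y₂ h n₁ e' n₂ e c} := by
    refine Eq.congr (congrArg (fun z => S.ι.toFun (x := ⟨(y₁, y₂), h⟩)
      (ProdFiber.mk H z (Flip.mk n₂))) ?_) rfl
    exact ProdFiber.mk_op_smul _ _ _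
  rel_smul_right {y₁ y₂ h n₁ e' n₂ e c} := by
    have h1 := S.ι.map_op_smul (x := ⟨(y₁, y₂), h⟩) c
      (ProdFiber.mk H (ProdFiber.mk H n₁ e') (Flip.mk (c • n₂)))
    have h2 : op c • Flip.mk (c • n₂) = Flip.mk n₂ :=
      congrArg Flip.mk (inv_smul_smul c n₂)
    have h3 := h1.symm.trans (congrArg (fun z => S.ι.toFun (x := ⟨(y₁, y₂), h⟩)
      (ProdFiber.mk H (ProdFiber.mk H n₁ e') z)) h2)
    -- Acting by `c` from the right turns `(c n₂)⁻¹` into `n₂⁻¹` on one side and `e` into `e ◁ c` on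
    -- the other.
    refine (smul_left_cancel_iff (op c)).symm.trans ?_
    exact Eq.congr h3 rfl
  rel_op_smul {y₁ y₂ h n₁ e' n₂ e} c hr := by
    refine Eq.trans (congrArg (S.ι.toFun (x := ⟨(y₁, y₂), h⟩)) ?_) hr
    refine (ProdFiber.mk_op_smul (P := ProdFiber H (S.N.Fiber y₁) (G'.E.Fiber ⟨(y₁, y₂), h⟩))
      (ProdFiber.mk H n₁ e') c (Flip.mk (op c • n₂))).trans ?_
    exact congrArg (ProdFiber.mk H _) (congrArg Flip.mk (inv_smul_smul (op c) n₂))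
  rel_comp h₁ h₂ := S.compat _ _ _ _ _ _ _ _ _ _ _ h₁ h₂ (BundleGerbe.composes_comp _ _ _ _)
    (BundleGerbe.composes_comp _ _ _ _)
  smooth h := fun hr hp₁ hp₂ hn₁ he' hn₂ => by
    have hp := plotNear_pair (P := fun x => π x.1 = π x.2) hp₁ hp₂ h
    have h1 := RightBundle.smoothAt_mk (P := (S.N.pullback p₁).toRightBundle)
      (E := G'.E.toPrincipalBundle) (PrincipalBundle.smoothAt_pullback.2 hn₁) he' hp
    have h2 := Bibundle.smoothAt_inv (E := S.N.pullback p₂) hp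
      (PrincipalBundle.smoothAt_pullback.2 hn₂)
    have h3 := S.ι.smoothAt (RightBundle.smoothAt_mk
      (P := ((S.N.pullback p₁).mul G'.E).toRightBundle) h1 h2 hp) hp
    exact Bibundle.smoothAt_of_mk hp (S.η.smoothAt_sec hp)
      (h3.congr (Filter.Eventually.of_forall fun w => (hr w).symm))

/-! ### Pairings -/

/-- A smooth map `(q, n) ↦ [q, n]` which identifies `Q'` with `Q N`. -/
structure Pairing {X : CrossedModule k H m D} {B : Type*} [DiffeologicalSpace B]
    (Q Q' : DHBundle X B) (N : Bibundle k H B) where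
  toFun : ∀ {x}, Q.Fiber x → N.Fiber x → Q'.Fiber x
  map_smul : ∀ {x} (d : D) (q : Q.Fiber x) (n : N.Fiber x), toFun (d • q) n = d • toFun q n
  map_op_smul : ∀ {x} (c : H) (q : Q.Fiber x) (n : N.Fiber x),
    toFun (op c • q) n = toFun q (c • n)
  map_ψ : ∀ {x} (q : Q.Fiber x) (n : N.Fiber x), Q'.ψ (toFun q n) = Q.ψ q * N.φ n
  smooth : ∀ {n : ℕ} {v : Euc n} {p : Euc n → B} {q : ∀ w, Q.Fiber (p w)}
    {e : ∀ w, N.Fiber (p w)}, PlotNear p v → Q.SmoothAt p q v → N.SmoothAt p e v →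
    Q'.SmoothAt p (fun w => toFun (q w) (e w)) v

namespace Pairing

variable {X : CrossedModule k H m D} {B : Type*} [DiffeologicalSpace B]
  {Q Q' Q'' : DHBundle X B} {N : Bibundle k H B} (b : Pairing Q Q' N)

/-- For fixed `n`, the map `q ↦ [q, n]` is `D`-equivariant between `D`-torsors. -/
theorem bijective {x : B} (n : N.Fiber x) : Function.Bijective fun q => b.toFun q n := by
  obtain ⟨q₀⟩ := Q.nonempty x
  constructor
  · intro q q' hq
    dsimp only at hq
    obtain ⟨d, rfl⟩ := Q.exists_smul_eq q q'
    rw [b.map_smul] at hq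
    have : d = 1 := Q'.smul_left_injective (b.toFun q n) (by rw [← hq, one_smul])
    rw [this, one_smul]
  · intro q'
    obtain ⟨d, hd⟩ := Q'.exists_smul_eq (b.toFun q₀ n) q'
    exact ⟨d • q₀, by dsimp only; rw [b.map_smul, hd]⟩

theorem op_smul_toFun {x : B} (c : H) (q : Q.Fiber x) (n : N.Fiber x) :
    b.toFun q (op c • n) = op c • b.toFun q n := by
  rw [Q'.right_eq, b.map_ψ, ← b.map_smul, MulAut.mul_apply, ← Q.right_eq, b.map_op_smul,
    N.φ_smul]

theorem smoothAt_left {n : ℕ} {v : Euc n} {p : Euc n → B} {q : ∀ w, Q.Fiber (p w)}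
    {e : ∀ w, N.Fiber (p w)} (hp : PlotNear p v) (he : N.SmoothAt p e v)
    (h : Q'.SmoothAt p (fun w => b.toFun (q w) (e w)) v) : Q.SmoothAt p q v :=
  .of_equivariant (fun w x => b.toFun x (e w)) (fun w d x => b.map_smul d x (e w))
    (fun _ hs => b.smooth hp hs he) hp h

theorem exists_toFun_eq {x : B} (q' : Q'.Fiber x) (n : N.Fiber x) : ∃ q, b.toFun q n = q' :=
  (b.bijective n).2 q'

/-- The `q` with `[q, n] = q'`. -/
noncomputable def left {x : B} (q' : Q'.Fiber x) (n : N.Fiber x) : Q.Fiber x :=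
  ((b.bijective n).2 q').choose

theorem toFun_left {x : B} (q' : Q'.Fiber x) (n : N.Fiber x) : b.toFun (b.left q' n) n = q' :=
  ((b.bijective n).2 q').choose_spec

theorem left_eq_iff {x : B} {q' : Q'.Fiber x} {n : N.Fiber x} {q : Q.Fiber x} :
    b.left q' n = q ↔ q' = b.toFun q n := by
  rw [← (b.bijective n).1.eq_iff, b.toFun_left]

theorem left_toFun {x : B} (q : Q.Fiber x) (n : N.Fiber x) : b.left (b.toFun q n) n = q :=
  b.left_eq_iff.2 rfl

/-- The identification of `Q` with `Q' N⁻¹`. -/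
noncomputable def symm : Pairing Q' Q N.inv where
  toFun q' n := b.left q' n.val
  map_smul d q' n := by rw [b.left_eq_iff, b.map_smul, b.toFun_left]
  map_op_smul c q' n := by
    rw [b.left_eq_iff]
    have := b.op_smul_toFun c⁻¹ (b.left q' (op c⁻¹ • n.val)) n.val
    rw [b.toFun_left, MulOpposite.op_inv, eq_inv_smul_iff] at this
    exact this
  map_ψ q' n := by
    have := b.map_ψ (b.left q' n.val) n.val
    rw [b.toFun_left] at this
    exact (eq_mul_inv_of_mul_eq this.symm).trans
      (congrArg (Q'.ψ q' * ·) (Bibundle.φ_inv n.val).symm)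
  smooth {_ _ _ _ n} hp hq hn := by
    refine b.smoothAt_left hp (Bibundle.smoothAt_of_inv hp hn) ?_
    exact hq.congr (Filter.Eventually.of_forall fun w => b.toFun_left _ _)

/-- A pairing with `(N⁻¹)⁻¹` is a pairing with `N`. -/
def ofInvInv (b : Pairing Q Q' N.inv.inv) : Pairing Q Q' N where
  toFun q n := b.toFun q ⟨⟨n⟩⟩
  map_smul d q n := b.map_smul d q ⟨⟨n⟩⟩
  map_op_smul c q n := by
    refine (b.map_op_smul c q (Bibundle.mkInv (Bibundle.mkInv n))).trans ?_
    exact congrArg (fun z => b.toFun q ⟨⟨z • n⟩⟩) (inv_inv c)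
  map_ψ q n := by
    refine (b.map_ψ q (Bibundle.mkInv (Bibundle.mkInv n))).trans (congrArg (Q.ψ q * ·) ?_)
    refine (Bibundle.φ_inv (E := N.inv) ⟨n⟩).trans ?_
    refine (congrArg (·⁻¹) (Bibundle.φ_inv (E := N) n)).trans (inv_inv _)
  smooth hp hq hn := b.smooth hp hq (Bibundle.smoothAt_inv hp (Bibundle.smoothAt_inv hp hn))

/-- The composition with an isomorphism. -/
def trans (a : DHIso Q' Q'') : Pairing Q Q'' N where
  toFun q n := a.toFun (b.toFun q n)
  map_smul d q n := by rw [b.map_smul, a.map_smul]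
  map_op_smul c q n := by rw [b.map_op_smul]
  map_ψ q n := by rw [a.map_ψ, b.map_ψ]
  smooth hp hq hn := a.smoothAt (b.smooth hp hq hn) hp

/-- The isomorphism between two models of `Q N`. -/
noncomputable def iso (b : Pairing Q Q' N) (b' : Pairing Q Q'' N) : DHIso Q' Q'' := by
  -- Independence of the auxiliary `n` allows a pointwise arbitrary choice in the definition of the
  -- map and a smooth choice in the proof that it is smooth.
  have key : ∀ {x : B} (q' : Q'.Fiber x) (n n' : N.Fiber x),
      b'.toFun (b.left q' n) n = b'.toFun (b.left q' n') n' := fun q' n n' => by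
    obtain ⟨c, rfl⟩ := N.exists_smul_eq n n'
    rw [← b'.map_op_smul]
    congr 1
    rw [b.left_eq_iff, b.map_op_smul, b.toFun_left]
  exact .ofSmoothAt (fun x q' => b'.toFun (b.left q' (N.nonempty x).some) (N.nonempty x).some)
    (fun x d q' => by
      rw [← b'.map_smul]
      congr 1
      rw [b.left_eq_iff, b.map_smul, b.toFun_left])
    (fun x q' => by rw [b'.map_ψ, ← b.map_ψ, b.toFun_left])
    fun n p v q' hp hq' => by
      obtain ⟨r, hr⟩ := N.exists_smoothAt p v
      have hp' := PlotNear.of_isPlot hp (v := v)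
      refine (b'.smooth hp' (b.smoothAt_left (q := fun w => b.left (q' w) (r w)) hp' hr ?_)
        hr).congr (Filter.Eventually.of_forall fun w => key _ _ _)
      exact hq'.congr (Filter.Eventually.of_forall fun w => b.toFun_left _ _)

theorem iso_toFun (b : Pairing Q Q' N) (b' : Pairing Q Q'' N) {x : B} (q : Q.Fiber x)
    (n : N.Fiber x) : (b.iso b').toFun (b.toFun q n) = b'.toFun q n := by
  change b'.toFun (b.left (b.toFun q n) (N.nonempty x).some) (N.nonempty x).some = _
  obtain ⟨c, hc⟩ := N.exists_smul_eq n (N.nonempty x).some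
  rw [← hc, ← b'.map_op_smul]
  have : b.left (b.toFun q n) (c • n) = op c⁻¹ • q :=
    b.left_eq_iff.2 (by rw [b.map_op_smul, inv_smul_smul])
  rw [this, MulOpposite.op_inv, smul_inv_smul]

/-- The tautological pairing of `Q` and `N` with values in `Q N`. -/
noncomputable def tautological (Q : DHBundle X B) (N : Bibundle k H B) :
    Pairing Q (Q.mul N) N where
  toFun q n := ProdFiber.mk H q n
  map_smul _ _ _ := rfl
  map_op_smul _ _ _ := ProdFiber.mk_op_smul _ _ _
  map_ψ _ _ := rfl
  smooth hp hq hn := RightBundle.smoothAt_mk hq hn hp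

end Pairing

end Gerbes

end NonabelianGerbe
namespace NonabelianGerbe

section Gerbes

variable {k : ℕ} {H : Type u} [Group H] [TopologicalSpace H] [ChartedSpace (Euc k) H]
  [LieGroup (𝓡 k) ∞ H] {m : ℕ} {D : Type u} [Group D] [TopologicalSpace D]
  [ChartedSpace (Euc m) D] [LieGroup (𝓡 m) ∞ D]
  {M : Type*} {Y : Type*} [DiffeologicalSpace Y] {π : Y → M} {X : CrossedModule k H m D}
  {G G' : BundleGerbe k H π} {Q Q' : DHBundle X Y}

/-! ### The transformed action -/

namespace GerbeAction

/-- The pairing `b` intertwines the actions on `Q` and `Q'`: if `n₁ e' = e n₂`, then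
`[q, n₁] e' = [q e, n₂]`. -/
def IsIntertwined (P : Intertwiner G G') (b : Pairing Q Q' P.N) (K : GerbeAction G Q)
    (K' : GerbeAction G' Q') : Prop :=
  ∀ {y₁ y₂ : Y} {h : π y₁ = π y₂} {n₁ : P.N.Fiber y₁} {e' : G'.E.Fiber ⟨(y₁, y₂), h⟩}
    {n₂ : P.N.Fiber y₂} {e : G.E.Fiber ⟨(y₁, y₂), h⟩} (q : Q.Fiber y₁), P.rel h n₁ e' n₂ e →
    K'.act h (b.toFun q n₁) e' = b.toFun (K.act h q e) n₂

variable (P : Intertwiner G G') (b : Pairing Q Q' P.N) (K : GerbeAction G Q)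

/-- This is the well-definedness of `[q, n₁] e' = [q e, n₂]`: all admissible choices of `q`, `n₁`,
`n₂`, `e` have the same outcome. -/
theorem exists_transform {y₁ y₂ : Y} (h : π y₁ = π y₂) (x : Q'.Fiber y₁)
    (e' : G'.E.Fiber ⟨(y₁, y₂), h⟩) : ∃ x' : Q'.Fiber y₂, ∀ (q : Q.Fiber y₁) (n₁ : P.N.Fiber y₁)
      (n₂ : P.N.Fiber y₂) (e : G.E.Fiber ⟨(y₁, y₂), h⟩), b.toFun q n₁ = x → P.rel h n₁ e' n₂ e →
      x' = b.toFun (K.act h q e) n₂ := by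
  obtain ⟨m₁⟩ := P.N.nonempty y₁
  obtain ⟨m₂⟩ := P.N.nonempty y₂
  obtain ⟨e₀, he₀, -⟩ := P.existsUnique h m₁ e' m₂
  obtain ⟨q₀, rfl⟩ := (b.bijective m₁).2 x
  refine ⟨b.toFun (K.act h q₀ e₀) m₂, fun q n₁ n₂ e hq hr => ?_⟩
  obtain ⟨c, rfl⟩ := P.N.exists_smul_eq m₁ n₁
  obtain ⟨d, rfl⟩ := P.N.exists_smul_eq m₂ n₂
  rw [← b.map_op_smul] at hq
  have hq' : op c • q = q₀ := (b.bijective m₁).1 hq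
  -- With `n₁ = c m₁` and `n₂ = d m₂`, this yields `[q e, d m₂] = [q (e ◁ d), m₂] = [q (c e₀), m₂] =
  -- [(q ◁ c) e₀, m₂]`.
  have he : op d • e = c • e₀ :=
    (P.existsUnique h _ _ _).unique (P.rel_smul_right.1 hr) (P.rel_smul c he₀)
  rw [← b.map_op_smul, ← K.act_op_smul_right, he, ← K.act_op_smul, hq']

/-- The action on `Q' = Q N` with `[q, n₁] e' = [q e, n₂]` if `n₁ e' = e n₂`. -/
theorem exists_isIntertwined : ∃ K' : GerbeAction G' Q', IsIntertwined P b K K' := by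
  -- Each law of the new action follows from one of `K` after representing the points by auxiliary
  -- `n₁`, `n₂` (and `n₃`), since the result does not depend on them.
  choose f hf using fun {y₁ y₂ : Y} (h : π y₁ = π y₂) => K.exists_transform P b h
  have spec : ∀ {y₁ y₂ : Y} {h : π y₁ = π y₂} {n₁ : P.N.Fiber y₁} {e' : G'.E.Fiber ⟨(y₁, y₂), h⟩}
      {n₂ : P.N.Fiber y₂} {e : G.E.Fiber ⟨(y₁, y₂), h⟩} (q : Q.Fiber y₁), P.rel h n₁ e' n₂ e →
      f h (b.toFun q n₁) e' = b.toFun (K.act h q e) n₂ := fun q hr => hf _ _ _ q _ _ _ rfl hr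
  refine ⟨⟨f, ?_, ?_, ?_, ?_, ?_⟩, spec⟩
  · intro y₁ y₂ h d x e'
    obtain ⟨n₁⟩ := P.N.nonempty y₁
    obtain ⟨n₂⟩ := P.N.nonempty y₂
    obtain ⟨e, he, -⟩ := P.existsUnique h n₁ e' n₂
    obtain ⟨q, rfl⟩ := b.exists_toFun_eq x n₁
    rw [spec _ he, ← b.map_smul, spec _ he, K.act_smul, b.map_smul]
  · intro y₁ y₂ h c x e'
    obtain ⟨n₁⟩ := P.N.nonempty y₁
    obtain ⟨n₂⟩ := P.N.nonempty y₂
    obtain ⟨e, he, -⟩ := P.existsUnique h n₁ (c • e') n₂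
    obtain ⟨q, rfl⟩ := b.exists_toFun_eq x n₁
    rw [spec _ he, ← b.op_smul_toFun, spec _ (P.rel_op_smul_left.2 he)]
  · intro y₁ y₂ h x e'
    obtain ⟨n₁⟩ := P.N.nonempty y₁
    obtain ⟨n₂⟩ := P.N.nonempty y₂
    obtain ⟨e, he, -⟩ := P.existsUnique h n₁ e' n₂
    obtain ⟨q, rfl⟩ := b.exists_toFun_eq x n₁
    rw [spec _ he, b.map_ψ, b.map_ψ, K.ψ_act, mul_assoc, mul_assoc, Intertwiner.φ_eq he]
  · intro y₁ y₂ y₃ h₁₂ h₂₃ x e'₁₂ e'₂₃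
    obtain ⟨n₁⟩ := P.N.nonempty y₁
    obtain ⟨n₂⟩ := P.N.nonempty y₂
    obtain ⟨n₃⟩ := P.N.nonempty y₃
    obtain ⟨e₁₂, he₁₂, -⟩ := P.existsUnique h₁₂ n₁ e'₁₂ n₂
    obtain ⟨e₂₃, he₂₃, -⟩ := P.existsUnique h₂₃ n₂ e'₂₃ n₃
    obtain ⟨q, rfl⟩ := b.exists_toFun_eq x n₁
    rw [spec _ he₁₂, spec _ he₂₃, spec _ (P.rel_comp he₁₂ he₂₃), K.act_act]
  · intro n v p₁ p₂ h x e' hp₁ hp₂ hx he'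
    -- With smooth auxiliary lifts, `q` and `e` become smooth, and so does `[q e, n₂]`.
    obtain ⟨n₁, hn₁⟩ := P.N.exists_smoothAt p₁ v
    obtain ⟨n₂, hn₂⟩ := P.N.exists_smoothAt p₂ v
    choose e he _ using fun w => P.existsUnique (h w) (n₁ w) (e' w) (n₂ w)
    choose q hq using fun w => b.exists_toFun_eq (x w) (n₁ w)
    have hqs : Q.SmoothAt p₁ q v :=
      b.smoothAt_left hp₁ hn₁ (hx.congr (Filter.Eventually.of_forall hq))
    refine (b.smooth hp₂ (K.smooth h hp₁ hp₂ hqs (P.smooth h he hp₁ hp₂ hn₁ he' hn₂)) hn₂).congr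
      (Filter.Eventually.of_forall fun w => ?_)
    rw [← hq, spec _ (he w)]

variable {P b K}

theorem IsIntertwined.act_eq {K' K'' : GerbeAction G' Q'} (h' : IsIntertwined P b K K')
    (h'' : IsIntertwined P b K K'') {y₁ y₂ : Y} (h : π y₁ = π y₂) (x : Q'.Fiber y₁)
    (e' : G'.E.Fiber ⟨(y₁, y₂), h⟩) : K'.act h x e' = K''.act h x e' := by
  obtain ⟨n₁⟩ := P.N.nonempty y₁
  obtain ⟨n₂⟩ := P.N.nonempty y₂
  obtain ⟨e, he, -⟩ := P.existsUnique h n₁ e' n₂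
  obtain ⟨q, rfl⟩ := b.exists_toFun_eq x n₁
  rw [h' _ he, h'' _ he]

/-- Cancelling `n₂` in `[q, n₁] e' = [q e, n₂]` recovers the action on `Q` from the one on `Q'`. -/
theorem IsIntertwined.symm {K' : GerbeAction G' Q'} (h : IsIntertwined P b K K') :
    IsIntertwined P.symm b.symm K' K := by
  intro y₁ y₂ _ n₁ e n₂ e' x hr
  obtain ⟨q, rfl⟩ := b.exists_toFun_eq x n₁.val
  change K.act _ (b.left (b.toFun q n₁.val) n₁.val) e =
    b.left (K'.act _ (b.toFun q n₁.val) e') n₂.val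
  rw [b.left_toFun, h q hr, b.left_toFun]

theorem IsIntertwined.of_symm {K' : GerbeAction G' Q'} {b : Pairing Q' Q P.symm.N}
    (h : IsIntertwined P.symm b K' K) : IsIntertwined P b.symm.ofInvInv K K' := by
  intro y₁ y₂ _ n₁ e' n₂ e q hr
  exact IsIntertwined.symm h (n₁ := ⟨⟨n₁⟩⟩) (n₂ := ⟨⟨n₂⟩⟩) q hr

end GerbeAction

/-! ### Transformation of modules over a fixed base -/

/-- The module `L'` is a model of `L N`. -/
def Intertwiner.Related (P : Intertwiner G G') (L : GerbeModule X G) (L' : GerbeModule X G') :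
    Prop :=
  ∃ b : Pairing L.Q L'.Q P.N, GerbeAction.IsIntertwined P b L.str.action L'.str.action

namespace Intertwiner

variable {P : Intertwiner G G'} {L L₁ : GerbeModule X G} {L' L'₁ : GerbeModule X G'}

theorem exists_related (P : Intertwiner G G') (L : GerbeModule X G) :
    ∃ L' : GerbeModule X G', P.Related L L' := by
  obtain ⟨K, hK⟩ := L.str.action.exists_isIntertwined P (Pairing.tautological L.Q P.N)
  refine ⟨⟨_, TrivialBibundle.product m D _, K.toModuleStructure _⟩,
    Pairing.tautological L.Q P.N, fun q hr => ?_⟩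
  rw [ModuleStructure.action_toModuleStructure]
  exact hK q hr

/-- Passing to the inverse twice returns to the original because a pairing with `(N⁻¹)⁻¹` is a
pairing with `N`. -/
theorem related_symm_iff : P.symm.Related L' L ↔ P.Related L L' :=
  ⟨fun ⟨_, h⟩ => ⟨_, h.of_symm⟩, fun ⟨_, h⟩ => ⟨_, h.symm⟩⟩

/-- The canonical isomorphism `[q, n] ↦ [q, n]` between two models of `Q N` intertwines the actions,
since both are given by the same formula. -/
theorem Related.equivalent (h : P.Related L L') (h₁ : P.Related L L'₁) : L'.Equivalent L'₁ := by
  obtain ⟨b, hb⟩ := h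
  obtain ⟨b₁, hb₁⟩ := h₁
  refine GerbeModule.equivalent_iff.2 ⟨b.iso b₁, fun {y₁ y₂} h x e' => ?_⟩
  obtain ⟨n₁⟩ := P.N.nonempty y₁
  obtain ⟨n₂⟩ := P.N.nonempty y₂
  obtain ⟨e, he, -⟩ := P.existsUnique h n₁ e' n₂
  obtain ⟨q, rfl⟩ := b.exists_toFun_eq x n₁
  rw [hb q he, Pairing.iso_toFun, Pairing.iso_toFun, hb₁ q he]

theorem Related.trans (h : P.Related L L') (h' : L'.Equivalent L'₁) : P.Related L L'₁ := by
  obtain ⟨b, hb⟩ := h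
  obtain ⟨a, ha⟩ := GerbeModule.equivalent_iff.1 h'
  refine ⟨b.trans a, fun q hr => ?_⟩
  change L'₁.str.action.act _ (a.toFun _) _ = a.toFun _
  rw [← ha, hb q hr]

/-- Transformation with `N` is a bijection on equivalence classes of modules. -/
theorem exists_moduleClass_equiv (P : Intertwiner G G') :
    ∃ F : ModuleClass X G ≃ ModuleClass X G', ∀ (L : GerbeModule X G) (L' : GerbeModule X G'),
      F ⟦L⟧ = ⟦L'⟧ ↔ P.Related L L' := by
  choose T hT using fun L : GerbeModule X G => P.exists_related L
  have hcongr : ∀ {L L₁ : GerbeModule X G}, L.Equivalent L₁ → P.Related L₁ (T L) := fun h =>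
    -- `Related.trans` replaces only the target by an equivalent module; reversing the relation
    -- makes the source the target. Compatibility with equivalence and injectivity both rest on this
    -- reversal.
    related_symm_iff.1 ((related_symm_iff.2 (hT _)).trans h)
  let f : ModuleClass X G → ModuleClass X G' := Quotient.map T fun L L₁ h =>
    (hcongr h).equivalent (hT L₁)
  have hf : ∀ L L', f ⟦L⟧ = ⟦L'⟧ ↔ P.Related L L' := fun L L' =>
    ⟨fun h => (hT L).trans (Quotient.exact h), fun h => Quotient.sound ((hT L).equivalent h)⟩
  refine ⟨Equiv.ofBijective f ⟨?_, ?_⟩, hf⟩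
  · refine Quotient.ind₂ fun L L₁ h => Quotient.sound ?_
    have h1 := (hf L (T L₁)).1 h
    exact (related_symm_iff.2 h1).equivalent (related_symm_iff.2 (hT L₁))
  · refine Quotient.ind fun L' => ?_
    obtain ⟨L, hL⟩ := P.symm.exists_related L'
    exact ⟨⟦L⟧, (hf L L').2 (related_symm_iff.1 hL)⟩

end Intertwiner

/-! ### The transformed module -/

section Transform

variable (S : StableIsoOver G G') (L : GerbeModule X G) (I : TrivialBibundle m D Y)

/-- The pairing `(q, n) ↦ [[i⁻¹, q], n]`. -/
noncomputable def transformPairing : Pairing L.Q (transformQ S L I) S.toIntertwiner.N where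
  toFun q n := transformMk S L I q n
  map_smul d q n := congrArg (fun z => ProdFiber.mk H z n) ((I.toMulDH L.Q).map_smul d q)
  map_op_smul c q n := by
    refine Eq.trans ?_ (ProdFiber.mk_op_smul (P := (I.mulDH L.Q).Fiber _)
      ((I.toMulDH L.Q).toFun q) c n)
    rfl
  map_ψ q n := congrArg (· * S.N.φ n) ((I.toMulDH L.Q).map_ψ q)
  smooth hp hq hn := RightBundle.smoothAt_mk ((I.toMulDH L.Q).smoothAt hq hp) hn hp

variable {S L I}

/-- The second entries of `Acts` and the action determine each other, so the prescribed
identification is exactly the intertwining formula for the pairing `(q, n) ↦ [[i⁻¹, q], n]`. -/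
theorem isTransform_iff {Ξ : TrivialBibundle m D (Y2 π)}
    {K : ModuleStructure G' (transformQ S L I) (transformZ L I Ξ)} : IsTransform S L I K ↔
      GerbeAction.IsIntertwined S.toIntertwiner (transformPairing S L I) L.str.action
        K.action := by
  constructor
  · intro hK y₁ y₂ h n₁ e' n₂ e q hr
    exact K.acts_iff_act.1 (hK h q _ n₁ n₂ e' e (L.str.acts_iff_act.2 rfl) hr)
  · intro hK y₁ y₂ h q₁ q₂ n₁ n₂ e' e ha hr
    refine K.acts_iff_act.2 ?_
    rw [← L.str.acts_iff_act.1 ha]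
    exact hK q₁ hr

variable (S L I)

theorem existsUnique_isTransform (Ξ : TrivialBibundle m D (Y2 π)) :
    ∃! K : ModuleStructure G' (transformQ S L I) (transformZ L I Ξ), IsTransform S L I K := by
  obtain ⟨K, hK⟩ := L.str.action.exists_isIntertwined S.toIntertwiner (transformPairing S L I)
  refine ⟨K.toModuleStructure _, isTransform_iff.2 fun q hr => ?_, fun K' hK' => ?_⟩
  · rw [ModuleStructure.action_toModuleStructure]
    exact hK q hr
  · refine ModuleStructure.ext fun h x e' => ?_
    rw [ModuleStructure.action_toModuleStructure]
    exact GerbeAction.IsIntertwined.act_eq (isTransform_iff.1 hK') hK h x e'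

variable {S L I} in
theorem IsTransform.related {Ξ : TrivialBibundle m D (Y2 π)}
    {K : ModuleStructure G' (transformQ S L I) (transformZ L I Ξ)} (hK : IsTransform S L I K) :
    S.toIntertwiner.Related L ⟨transformQ S L I, transformZ L I Ξ, K⟩ :=
  ⟨transformPairing S L I, isTransform_iff.1 hK⟩

/-- Every choice of `I` and `ξ₁(η)` yields a model of `L N`, and models are unique up to
equivalence. This is the independence of `I`; conversely the product bibundle serves as `I`. -/
theorem corresponds_iff {L' : GerbeModule X G'} :
    Corresponds S L L' ↔ S.toIntertwiner.Related L L' := by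
  constructor
  · rintro ⟨I, Ξ, K, -, hK, h⟩
    exact (IsTransform.related hK).trans h
  · intro h
    obtain ⟨Ξ, hΞ⟩ := exists_isXi (L.Q.pullback p₁) S.η
    obtain ⟨K, hK, -⟩ := existsUnique_isTransform S L (.product m D Y) Ξ
    exact ⟨_, Ξ, K, hΞ, hK, (IsTransform.related hK).equivalent h⟩

end Transform

end Gerbes

end NonabelianGerbe
namespace NonabelianGerbe

/-! ### Smooth local sections -/

section Sections

variable {A Y : Type*} [DiffeologicalSpace A] [DiffeologicalSpace Y]

/-- A section of `q` which is smooth over an open set `dom`. -/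
structure SmoothLocalSection (q : A → Y) where
  dom : Set Y
  isOpen_dom : DOpen dom
  toFun : Y → A
  right_inv : ∀ y, q (toFun y) = y
  smooth : ∀ {n : ℕ} {p : Euc n → Y}, IsPlot p → (∀ v, p v ∈ dom) → IsPlot fun v => toFun (p v)

/-- `q` is surjective and has smooth sections locally. -/
def HasSmoothLocalSections (q : A → Y) : Prop :=
  ∀ y, ∃ σ : SmoothLocalSection q, y ∈ σ.dom

variable {q : A → Y} (σ : SmoothLocalSection q) {n : ℕ} {v : Euc n}

theorem SmoothLocalSection.plotNear {p : Euc n → Y} (hp : PlotNear p v) (hv : p v ∈ σ.dom) :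
    PlotNear (fun w => σ.toFun (p w)) v := by
  have hm := hp.eventually_mem σ.isOpen_dom hv
  obtain ⟨U, hU, h⟩ := hp
  exact ⟨_, Filter.inter_mem hU hm, fun r c hc hcU =>
    σ.smooth (h r c hc fun w => (hcU w).1) fun w => (hcU w).2⟩

theorem SmoothLocalSection.isOpen_preimage {V : Set A} (hV : DOpen V) :
    DOpen (σ.dom ∩ σ.toFun ⁻¹' V) := by
  refine Diffeology.isOpen_iff_preimages_plots.2 fun n p hp => isOpen_iff_mem_nhds.2 fun v hv => ?_
  have hp' := PlotNear.of_isPlot hp (v := v)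
  filter_upwards [hp'.eventually_mem σ.isOpen_dom hv.1,
    (σ.plotNear hp' hv.1).eventually_mem hV hv.2] with w h1 h2
  exact ⟨h1, h2⟩

end Sections

/-! ### Descent of equivalences, and fibre identifications from the units -/

section Descent

variable {k : ℕ} {H : Type u} [Group H] [TopologicalSpace H] [ChartedSpace (Euc k) H]
  [LieGroup (𝓡 k) ∞ H] {m : ℕ} {D : Type u} [Group D] [TopologicalSpace D]
  [ChartedSpace (Euc m) D] [LieGroup (𝓡 m) ∞ D]
  {M : Type*} {A Y : Type*} [DiffeologicalSpace A] [DiffeologicalSpace Y] {πA : A → M} {π : Y → M}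
  {X : CrossedModule k H m D} {G : BundleGerbe k H π} {q : MapOver πA π}

theorem MapOver.comm_eq {x₁ x₂ : A} (q : MapOver πA π) (h : π (q.toFun x₁) = π (q.toFun x₂)) :
    πA x₁ = πA x₂ := by
  rw [← q.comm, ← q.comm, h]

theorem MapOver.eq_comm {x₁ x₂ : A} (q : MapOver πA π) (h : πA x₁ = πA x₂) :
    π (q.toFun x₁) = π (q.toFun x₂) := by
  rw [q.comm, q.comm, h]

theorem Bibundle.φ_pullback {B : Type*} [DiffeologicalSpace B] {E : Bibundle k H B}
    (φ : SmoothMap A B) {x : A} (e : E.Fiber (φ x)) : (E.pullback φ).φ (x := x) e = E.φ e := by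
  ext h
  exact Bibundle.φ_eq (E := E.pullback φ) (x := x) (e := e) (E.φ_smul e h)

theorem BundleGerbe.comp_pullback {x₁ x₂ x₃ : A} (h₁₂ : πA x₁ = πA x₂) (h₂₃ : πA x₂ = πA x₃)
    (e₁₂ : G.E.Fiber ⟨(q.toFun x₁, q.toFun x₂), q.eq_comm h₁₂⟩)
    (e₂₃ : G.E.Fiber ⟨(q.toFun x₂, q.toFun x₃), q.eq_comm h₂₃⟩) :
    (G.pullback q).comp h₁₂ h₂₃ e₁₂ e₂₃ = G.comp (q.eq_comm h₁₂) (q.eq_comm h₂₃) e₁₂ e₂₃ := by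
  refine BundleGerbe.composes_iff.1 ?_
  exact BundleGerbe.composes_comp (G := G) (q.eq_comm h₁₂) (q.eq_comm h₂₃) e₁₂ e₂₃

/-- The pulled back unit is idempotent for the pulled back product, and idempotents are unique. -/
theorem BundleGerbe.unit_pullback (x : A) : (G.pullback q).unit x = G.unit (q.toFun x) :=
  (BundleGerbe.eq_unit ((BundleGerbe.comp_pullback (G := G) (q := q) rfl rfl _ _).trans
    (BundleGerbe.comp_unit_unit _))).symm

theorem GerbeModule.pullback_act (L : GerbeModule X G) {x₁ x₂ : A} (h : πA x₁ = πA x₂)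
    (z : L.Q.Fiber (q.toFun x₁)) (e : G.E.Fiber ⟨(q.toFun x₁, q.toFun x₂), q.eq_comm h⟩) :
    (L.pullback q).str.action.act h z e = L.str.action.act (q.eq_comm h) z e := by
  refine (L.pullback q).str.acts_iff_act.1 ?_
  exact L.str.acts_iff_act.2 rfl

/-- Equivalence of modules is local. -/
theorem GerbeModule.equivalent_of_pullback (hq : HasSmoothLocalSections q.toFun)
    {L L' : GerbeModule X G} (h : (L.pullback q).Equivalent (L'.pullback q)) :
    L.Equivalent L' := by
  obtain ⟨a, ha⟩ := GerbeModule.equivalent_iff.1 h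
  -- The point `y` is an independent variable with a proof of `q x = y`, so that the maps given by
  -- `a` at different points over the same `y` have literally the same type.
  obtain ⟨f, hf⟩ : ∃ f : ∀ (x : A) (y : Y), q.toFun x = y → L.Q.Fiber y → L'.Q.Fiber y,
      ∀ x, f x _ rfl = a.toFun (x := x) :=
    ⟨fun x y h => h ▸ a.toFun (x := x), fun x => rfl⟩
  have f_smul : ∀ {x y} (h : q.toFun x = y) (d : D) z, f x y h (d • z) = d • f x y h z := by
    rintro x _ rfl d z
    rw [hf]
    exact a.map_smul (x := x) d z
  have f_ψ : ∀ {x y} (h : q.toFun x = y) z, L'.Q.ψ (f x y h z) = L.Q.ψ z := by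
    rintro x _ rfl z
    rw [hf]
    exact a.map_ψ (x := x) z
  have f_act : ∀ {x₁ x₂ y₁ y₂} (h₁ : q.toFun x₁ = y₁) (h₂ : q.toFun x₂ = y₂) (h : π y₁ = π y₂) z e,
      f x₂ y₂ h₂ (L.str.action.act h z e) = L'.str.action.act h (f x₁ y₁ h₁ z) e := by
    rintro x₁ x₂ _ _ rfl rfl h z e
    rw [hf, hf]
    exact ((congrArg (a.toFun (x := x₂))
      (GerbeModule.pullback_act L (q.comm_eq h) z e).symm).trans (ha (q.comm_eq h) z e)).trans
      (GerbeModule.pullback_act L' (q.comm_eq h) _ e)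
  have f_eq : ∀ {x₁ x₂ y} (h₁ : q.toFun x₁ = y) (h₂ : q.toFun x₂ = y) z,
      f x₁ y h₁ z = f x₂ y h₂ z := by
    intro x₁ x₂ y h₁ h₂ z
    -- Two points over `y` give a point of `A^[2]`, and the unit over `(y, y)` acts trivially;
    -- compatibility with the actions thus contains the descent condition for `a`.
    have := f_act h₁ h₂ rfl z (G.unit y)
    rw [GerbeAction.act_unit, GerbeAction.act_unit] at this
    exact this.symm
  have f_smooth : ∀ {n : ℕ} {v : Euc n} {p' : Euc n → A} {p : Euc n → Y}
      (h : ∀ w, q.toFun (p' w) = p w) {z : ∀ w, L.Q.Fiber (p w)}, PlotNear p' v →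
      L.Q.SmoothAt p z v → L'.Q.SmoothAt p (fun w => f (p' w) (p w) (h w) (z w)) v := by
    intro n v p' p h z hp' hz
    obtain rfl : (fun w => q.toFun (p' w)) = p := funext h
    simp only [hf]
    have hz' := (PrincipalBundle.smoothAt_pullback (P := L.Q.toPrincipalBundle)
      (φ := q.toSmoothMap) (p := p')).2 hz
    exact (PrincipalBundle.smoothAt_pullback (P := L'.Q.toPrincipalBundle)
      (φ := q.toSmoothMap) (p := p')).1 (a.smoothAt hz' hp')
  -- The pointwise choice `s` need not be smooth; by `f_eq` it can be replaced near any point by a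
  -- smooth local section.
  choose σ hσ using hq
  let s : Y → A := fun y => (σ y).toFun y
  have hs : ∀ y, q.toFun (s y) = y := fun y => (σ y).right_inv y
  refine GerbeModule.equivalent_iff.2 ⟨.ofSmoothAt (fun y => f (s y) y (hs y))
    (fun y => f_smul (hs y)) (fun y => f_ψ (hs y)) fun n p v z hp hz => ?_, fun {y₁ y₂} h z e =>
      f_act (hs y₁) (hs y₂) h z e⟩
  refine (f_smooth (fun w => (σ (p v)).right_inv (p w))
    ((σ (p v)).plotNear (.of_isPlot hp) (hσ _)) hz).congr (Filter.Eventually.of_forall fun w => ?_)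
  exact f_eq _ _ _

/-! ### Descent of modules -/

namespace GerbeAction

variable {Q : DHBundle X A} (K : GerbeAction (G.pullback q) Q)

/-- The action of a module over the pulled back gerbe, with the points of `Y` as variables. -/
def actOver : ∀ {x₁ x₂ : A} {y₁ y₂ : Y} (_ : q.toFun x₁ = y₁) (_ : q.toFun x₂ = y₂)
    (h : π y₁ = π y₂), Q.Fiber x₁ → G.E.Fiber ⟨(y₁, y₂), h⟩ → Q.Fiber x₂
  | _, _, _, _, rfl, rfl, h, z, e => K.act (q.comm_eq h) z e

variable {x₁ x₂ x₃ : A} {y y₁ y₂ y₃ : Y} (h₁ : q.toFun x₁ = y₁) (h₂ : q.toFun x₂ = y₂)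
  (h₃ : q.toFun x₃ = y₃) (h : π y₁ = π y₂) (h' : π y₂ = π y₃)

theorem actOver_smul (d : D) (z : Q.Fiber x₁) (e : G.E.Fiber ⟨(y₁, y₂), h⟩) :
    K.actOver h₁ h₂ h (d • z) e = d • K.actOver h₁ h₂ h z e := by
  subst h₁ h₂
  exact K.act_smul _ d z e

theorem actOver_op_smul (c : H) (z : Q.Fiber x₁) (e : G.E.Fiber ⟨(y₁, y₂), h⟩) :
    K.actOver h₁ h₂ h (op c • z) e = K.actOver h₁ h₂ h z (c • e) := by
  subst h₁ h₂
  exact K.act_op_smul _ c z e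

theorem ψ_actOver (z : Q.Fiber x₁) (e : G.E.Fiber ⟨(y₁, y₂), h⟩) :
    Q.ψ (K.actOver h₁ h₂ h z e) = Q.ψ z * G.E.φ e := by
  subst h₁ h₂
  refine (K.ψ_act _ z e).trans (congrArg (Q.ψ z * ·) ?_)
  exact Bibundle.φ_pullback q.two (x := ⟨(x₁, x₂), q.comm_eq h⟩) e

theorem actOver_actOver (z : Q.Fiber x₁) (e : G.E.Fiber ⟨(y₁, y₂), h⟩)
    (e' : G.E.Fiber ⟨(y₂, y₃), h'⟩) : K.actOver h₂ h₃ h' (K.actOver h₁ h₂ h z e) e' =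
      K.actOver h₁ h₃ (h.trans h') z (G.comp h h' e e') := by
  subst h₁ h₂ h₃
  refine (K.act_act _ _ z e e').trans (congrArg (K.act _ z) ?_)
  exact BundleGerbe.comp_pullback (G := G) (q := q) (q.comm_eq h) (q.comm_eq h') e e'

theorem smoothAt_actOver {n : ℕ} {v : Euc n} {p'₁ p'₂ : Euc n → A} {p₁ p₂ : Euc n → Y}
    (h₁ : ∀ w, q.toFun (p'₁ w) = p₁ w) (h₂ : ∀ w, q.toFun (p'₂ w) = p₂ w)
    (h : ∀ w, π (p₁ w) = π (p₂ w)) {z : ∀ w, Q.Fiber (p'₁ w)}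
    {e : ∀ w, G.E.Fiber ⟨(p₁ w, p₂ w), h w⟩} (hp₁ : PlotNear p'₁ v) (hp₂ : PlotNear p'₂ v)
    (hz : Q.SmoothAt p'₁ z v) (he : G.E.SmoothAt (fun w => ⟨(p₁ w, p₂ w), h w⟩) e v) :
    Q.SmoothAt p'₂ (fun w => K.actOver (h₁ w) (h₂ w) (h w) (z w) (e w)) v := by
  obtain rfl : (fun w => q.toFun (p'₁ w)) = p₁ := funext h₁
  obtain rfl : (fun w => q.toFun (p'₂ w)) = p₂ := funext h₂
  exact K.smooth (fun w => q.comm_eq (h w)) hp₁ hp₂ hz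
    ((PrincipalBundle.smoothAt_pullback (P := G.E.toPrincipalBundle) (φ := q.two)
      (p := fun w => ⟨(p'₁ w, p'₂ w), q.comm_eq (h w)⟩)).2 he)

/-- The canonical isomorphism between the fibres over two points with the same image in `Y`. -/
noncomputable def transport (h₁ : q.toFun x₁ = y) (h₂ : q.toFun x₂ = y) (z : Q.Fiber x₁) :
    Q.Fiber x₂ :=
  K.actOver h₁ h₂ rfl z (G.unit y)

/-- Associativity turns a transport followed by an action into the action of unit times `e`. The
coherence of the transports is the case where `e` is itself a unit. -/
theorem actOver_transport (h₁' : q.toFun x₂ = y₁) (h₂ : q.toFun x₃ = y₂) (z : Q.Fiber x₁)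
    (e : G.E.Fiber ⟨(y₁, y₂), h⟩) :
    K.actOver h₁' h₂ h (K.transport h₁ h₁' z) e = K.actOver h₁ h₂ h z e := by
  rw [transport, actOver_actOver, BundleGerbe.comp_eq_right h (BundleGerbe.comp_unit_unit _)]

theorem transport_actOver (h₂' : q.toFun x₃ = y₂) (z : Q.Fiber x₁)
    (e : G.E.Fiber ⟨(y₁, y₂), h⟩) :
    K.transport h₂ h₂' (K.actOver h₁ h₂ h z e) = K.actOver h₁ h₂' h z e := by
  rw [transport, actOver_actOver, BundleGerbe.comp_eq_left h (BundleGerbe.comp_unit_unit _)]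

theorem transport_self (h₁ : q.toFun x₁ = y) (z : Q.Fiber x₁) : K.transport h₁ h₁ z = z := by
  subst h₁
  refine Eq.trans ?_ (K.act_unit z)
  exact congrArg (K.act rfl z) (BundleGerbe.unit_pullback (G := G) x₁).symm

variable (h₁ : q.toFun x₁ = y) (h₂ : q.toFun x₂ = y) (h₃ : q.toFun x₃ = y)

theorem transport_transport (z : Q.Fiber x₁) :
    K.transport h₂ h₃ (K.transport h₁ h₂ z) = K.transport h₁ h₃ z :=
  K.actOver_transport _ _ _ _ _ _

theorem transport_smul (d : D) (z : Q.Fiber x₁) :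
    K.transport h₁ h₂ (d • z) = d • K.transport h₁ h₂ z :=
  K.actOver_smul _ _ _ _ _ _

theorem ψ_transport (z : Q.Fiber x₁) : Q.ψ (K.transport h₁ h₂ z) = Q.ψ z := by
  rw [transport, ψ_actOver, BundleGerbe.φ_unit, mul_one]

theorem transport_op_smul (c : H) (z : Q.Fiber x₁) :
    K.transport h₁ h₂ (op c • z) = op c • K.transport h₁ h₂ z := by
  rw [Q.right_eq, Q.right_eq, ψ_transport, transport_smul]

theorem transport_eq_iff {z : Q.Fiber x₁} {z' : Q.Fiber x₂} :
    K.transport h₁ h₂ z = z' ↔ z = K.transport h₂ h₁ z' := by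
  constructor
  · rintro rfl
    rw [transport_transport, transport_self]
  · rintro rfl
    rw [transport_transport, transport_self]

theorem smoothAt_transport {n : ℕ} {v : Euc n} {p'₁ p'₂ : Euc n → A} {p : Euc n → Y}
    (h₁ : ∀ w, q.toFun (p'₁ w) = p w) (h₂ : ∀ w, q.toFun (p'₂ w) = p w)
    {z : ∀ w, Q.Fiber (p'₁ w)} (hp : PlotNear p v) (hp₁ : PlotNear p'₁ v) (hp₂ : PlotNear p'₂ v)
    (hz : Q.SmoothAt p'₁ z v) :
    Q.SmoothAt p'₂ (fun w => K.transport (h₁ w) (h₂ w) (z w)) v :=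
  K.smoothAt_actOver h₁ h₂ (fun _ => rfl) hp₁ hp₂ hz (BundleGerbe.smoothAt_unit hp)

end GerbeAction

end Descent

end NonabelianGerbe
namespace NonabelianGerbe

/-! ### The descended bundle and its action -/

section Descent

variable {k : ℕ} {H : Type u} [Group H] [TopologicalSpace H] [ChartedSpace (Euc k) H]
  [LieGroup (𝓡 k) ∞ H] {m : ℕ} {D : Type u} [Group D] [TopologicalSpace D]
  [ChartedSpace (Euc m) D] [LieGroup (𝓡 m) ∞ D]
  {M : Type*} {A Y : Type*} [DiffeologicalSpace A] [DiffeologicalSpace Y] {πA : A → M} {π : Y → M}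
  {X : CrossedModule k H m D} {G : BundleGerbe k H π} {q : MapOver πA π}

namespace GerbeAction

variable {Q : DHBundle X A} (K : GerbeAction (G.pullback q) Q)
  (s : Y → A) (hs : ∀ y, q.toFun (s y) = y)

/-- The section of the descended bundle given by a section `t` of `Q` and a local section of `q`. -/
noncomputable def descendSection (σ : SmoothLocalSection q.toFun) (t : LocalSection Q.Fiber) :
    LocalSection fun y => Q.Fiber (s y) where
  dom := σ.dom ∩ σ.toFun ⁻¹' t.dom
  isOpen_dom := σ.isOpen_preimage t.isOpen_dom
  val y := K.transport (σ.right_inv y) (hs y) (t.val (σ.toFun y))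

theorem transport_descendSection (σ σ' : SmoothLocalSection q.toFun) (t : LocalSection Q.Fiber)
    (y : Y) : K.transport (hs y) (σ'.right_inv y) ((K.descendSection s hs σ t).val y) =
      K.transport (σ.right_inv y) (σ'.right_inv y) (t.val (σ.toFun y)) :=
  K.transport_transport _ _ _ _

/-- The bundle on `Y` obtained from a module over the gerbe pulled back along `q`. -/
noncomputable def descend (hq : HasSmoothLocalSections q.toFun) : DHBundle X Y where
  Fiber y := Q.Fiber (s y)
  torsor y := Q.torsor (s y)
  -- The set-theoretic section `s` only names the fibres. Smoothness comes from atlas sections of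
  -- `Q` along smooth `σ`, transported into these fibres.
  atlas := {r | ∃ σ, ∃ t ∈ Q.atlas, r = K.descendSection s hs σ t}
  cover y := by
    obtain ⟨σ, hσ⟩ := hq y
    obtain ⟨t, ht, hy⟩ := Q.cover (σ.toFun y)
    exact ⟨_, ⟨σ, t, ht, rfl⟩, hσ, hy⟩
  transition := by
    rintro _ ⟨σ, t, ht, rfl⟩ _ ⟨σ', t', ht', rfl⟩
    choose g hg using fun y => Q.exists_smul_eq ((K.descendSection s hs σ' t').val y)
      ((K.descendSection s hs σ t).val y)
    refine ⟨g, SmoothOn.of_smoothNear fun n p v hp hW => ?_, fun y _ => (hg y).symm⟩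
    have hp' := PlotNear.of_isPlot hp (v := v)
    have h1 := σ.plotNear hp' (hW v).1.1
    have h2 := σ'.plotNear hp' (hW v).2.1
    -- Both sections are transported to the fibres over `σ'`, where one is a smooth lift and the
    -- other an atlas section of `Q`; equivariance of transport preserves their quotient.
    refine (K.smoothAt_transport (fun w => σ.right_inv (p w)) (fun w => σ'.right_inv (p w)) hp' h1
      h2 (PrincipalBundle.smoothAt_val ht (hW v).1.2)).smoothNear
      (PrincipalBundle.smoothAt_val ht' (hW v).2.2) h2 (Filter.Eventually.of_forall fun w => ?_)
    rw [← K.transport_descendSection s hs, ← hg, transport_smul, transport_descendSection,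
      transport_self]
  rightAction y := Q.rightAction (s y)
  smulComm y := Q.smulComm (s y)
  right_smooth := by
    rintro _ ⟨σ, t, ht, rfl⟩
    obtain ⟨a, ha, h⟩ := Q.right_smooth t ht
    refine ⟨fun y => a (σ.toFun y), fun n p c hp hW hc =>
      ha n _ c (σ.smooth hp fun w => (hW w).1) (fun w => (hW w).2) hc, fun y hy c => ?_⟩
    refine (K.transport_op_smul _ _ c _).symm.trans ?_
    rw [h _ hy.2 c, transport_smul]
    rfl
  ψ {y} := Q.ψ (x := s y)
  ψ_smul {y} := Q.ψ_smul (x := s y)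
  right_eq {y} := Q.right_eq (x := s y)
  ψ_smooth := by
    rintro _ ⟨σ, t, ht, rfl⟩ n p c hp hW hc
    refine (Q.ψ_smooth t ht n _ c (σ.smooth hp fun w => (hW w).1) (fun w => (hW w).2) hc).congr
      fun w => ?_
    exact DFunLike.congr_fun (K.ψ_transport _ _ _) _
  ψ_inv_smooth := by
    rintro _ ⟨σ, t, ht, rfl⟩ n p c hp hW hc
    refine (Q.ψ_inv_smooth t ht n _ c (σ.smooth hp fun w => (hW w).1)
      (fun w => (hW w).2) hc).congr fun w => ?_
    exact DFunLike.congr_fun (congrArg _ (K.ψ_transport _ _ _)) _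

variable {s hs} (hq : HasSmoothLocalSections q.toFun)

/-- Smoothness may be tested through any local section `σ` around the point, because transport
between the fibres over two smooth local sections preserves smooth lifts. -/
theorem smoothAt_descend_iff (σ : SmoothLocalSection q.toFun) {n : ℕ} {v : Euc n}
    {p : Euc n → Y} (hp : PlotNear p v) (hv : p v ∈ σ.dom) {z : ∀ w, Q.Fiber (s (p w))} :
    (K.descend s hs hq).SmoothAt p z v ↔ Q.SmoothAt (fun w => σ.toFun (p w))
      (fun w => K.transport (hs (p w)) (σ.right_inv (p w)) (z w)) v := by
  have hσ := σ.plotNear hp hv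
  constructor
  · rintro ⟨_, ⟨σ', t, ht, rfl⟩, hv', g, hg, hgs⟩
    refine ((K.smoothAt_transport (fun w => σ'.right_inv (p w)) (fun w => σ.right_inv (p w)) hp
      (σ'.plotNear hp hv'.1) hσ (PrincipalBundle.smoothAt_val ht hv'.2)).smul hg).congr ?_
    filter_upwards [hgs] with w hw
    rw [hw, ← K.transport_descendSection s hs]
    exact K.transport_smul _ _ _ _
  · intro h
    obtain ⟨t, ht, hvt, g, hg, hgs⟩ := h
    refine ⟨_, ⟨σ, t, ht, rfl⟩, ⟨hv, hvt⟩, g, hg, ?_⟩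
    filter_upwards [hgs] with w hw
    refine (K.transport_eq_iff _ _).1 hw |>.trans (K.transport_smul _ _ _ _)

/-- The action of the gerbe on the descended bundle. -/
noncomputable def descendAction : GerbeAction G (K.descend s hs hq) where
  act {y₁ y₂} h z e := K.actOver (hs y₁) (hs y₂) h z e
  act_smul h d z e := K.actOver_smul _ _ h d z e
  act_op_smul h c z e := K.actOver_op_smul _ _ h c z e
  ψ_act h z e := K.ψ_actOver _ _ h z e
  act_act h h' z e e' := K.actOver_actOver _ _ _ h h' z e e'
  smooth {n v p₁ p₂} h {z e} hp₁ hp₂ hz he := by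
    obtain ⟨σ₁, h₁⟩ := hq (p₁ v)
    obtain ⟨σ₂, h₂⟩ := hq (p₂ v)
    have hz' := (K.smoothAt_descend_iff hq σ₁ hp₁ h₁).1 hz
    refine (K.smoothAt_descend_iff hq σ₂ hp₂ h₂).2 ?_
    refine (K.smoothAt_actOver (fun w => σ₁.right_inv (p₁ w)) (fun w => σ₂.right_inv (p₂ w)) h
      (σ₁.plotNear hp₁ h₁) (σ₂.plotNear hp₂ h₂) hz' he).congr
      (Filter.Eventually.of_forall fun w => ?_)
    exact (K.transport_actOver _ _ _ _ _ _).trans (K.actOver_transport _ _ _ _ _ _).symm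

/-- The module over the gerbe on `Y` obtained by descent. -/
noncomputable def descendModule (s : Y → A) (hs : ∀ y, q.toFun (s y) = y)
    (hq : HasSmoothLocalSections q.toFun) : GerbeModule X G :=
  ⟨K.descend s hs hq, .product m D _, (K.descendAction hq).toModuleStructure _⟩

theorem descendModule_act {y₁ y₂ : Y} (h : π y₁ = π y₂) (z : Q.Fiber (s y₁))
    (e : G.E.Fiber ⟨(y₁, y₂), h⟩) :
    (K.descendModule s hs hq).str.action.act h z e = K.actOver (hs y₁) (hs y₂) h z e :=
  ModuleStructure.action_toModuleStructure (K.descendAction hq) z e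

theorem descendModule_pullback_act {x₁ x₂ : A} (h : πA x₁ = πA x₂) (z : Q.Fiber (s (q.toFun x₁)))
    (e : G.E.Fiber ⟨(q.toFun x₁, q.toFun x₂), q.eq_comm h⟩) :
    ((K.descendModule s hs hq).pullback q).str.action.act h z e =
      K.actOver (hs (q.toFun x₁)) (hs (q.toFun x₂)) (q.eq_comm h) z e :=
  (GerbeModule.pullback_act (K.descendModule s hs hq) h z e).trans
    (K.descendModule_act hq (q.eq_comm h) z e)

end GerbeAction

/-- Modules descend along maps with local sections. -/
theorem GerbeModule.exists_pullback_equivalent (hq : HasSmoothLocalSections q.toFun)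
    (L : GerbeModule X (G.pullback q)) :
    ∃ L' : GerbeModule X G, (L'.pullback q).Equivalent L := by
  choose σ hσ using hq
  let s : Y → A := fun y => (σ y).toFun y
  have hs : ∀ y, q.toFun (s y) = y := fun y => (σ y).right_inv y
  have hq : HasSmoothLocalSections q.toFun := fun y => ⟨σ y, hσ y⟩
  let K := L.str.action
  refine ⟨K.descendModule s hs hq,
    -- The pulled back bundle has over `x` the fibre of the given one over `s (q x)`, a point with
    -- the same image as `x`; transport connects the two.
    GerbeModule.equivalent_iff.2 ⟨.ofSmoothAt (fun x z => K.transport (hs (q.toFun x)) rfl z)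
      (fun x d z => K.transport_smul _ _ d z) (fun x z => K.ψ_transport _ _ z)
      fun n p v z hp hz => ?_, fun {x₁ x₂} h z e => ?_⟩⟩
  · have hp' := PlotNear.of_isPlot hp (v := v)
    have hqp := hp'.comp q.toSmoothMap
    have hz' := (K.smoothAt_descend_iff hq _ hqp (hσ (q.toFun (p v)))).1
      ((PrincipalBundle.smoothAt_pullback (P := (K.descend s hs hq).toPrincipalBundle)
        (φ := q.toSmoothMap) (p := p)).1 hz)
    -- The transport out of the fibres over `s` is factored through the fibres over one smooth local
    -- section.
    refine (K.smoothAt_transport (fun w => (σ (q.toFun (p v))).right_inv (q.toFun (p w)))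
      (fun w => rfl) hqp ((σ (q.toFun (p v))).plotNear hqp (hσ _)) hp' hz').congr
      (Filter.Eventually.of_forall fun w => ?_)
    exact (K.transport_transport _ _ _ _).symm
  · refine (congrArg (K.transport (hs (q.toFun x₂)) rfl)
      (K.descendModule_pullback_act hq h z e)).trans ?_
    refine (K.transport_actOver _ _ _ _ z e).trans ?_
    exact (K.actOver_transport _ _ rfl rfl z e).symm

/-- Pull-back along a map with local sections is a bijection on equivalence classes of modules. -/
theorem GerbeModule.exists_pullback_equiv (hq : HasSmoothLocalSections q.toFun)
    (X : CrossedModule k H m D) (G : BundleGerbe k H π) :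
    ∃ Φ : ModuleClass X G ≃ ModuleClass X (G.pullback q), ∀ L : GerbeModule X G,
      Φ ⟦L⟧ = ⟦L.pullback q⟧ := by
  have h : ∀ L L' : GerbeModule X G, L.Equivalent L' → (L.pullback q).Equivalent (L'.pullback q) := by
    intro L L' hL
    obtain ⟨a, ha⟩ := GerbeModule.equivalent_iff.1 hL
    refine GerbeModule.equivalent_iff.2 ⟨.ofSmoothAt (fun x => a.toFun (x := q.toFun x))
      (fun x => a.map_smul (x := q.toFun x)) (fun x => a.map_ψ (x := q.toFun x))
      fun n p v z hp hz => ?_, fun {x₁ x₂} h z e => ?_⟩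
    · exact (PrincipalBundle.smoothAt_pullback (P := L'.Q.toPrincipalBundle)
        (φ := q.toSmoothMap) (p := p)).2 (a.smoothAt ((PrincipalBundle.smoothAt_pullback
        (P := L.Q.toPrincipalBundle) (φ := q.toSmoothMap) (p := p)).1 hz)
        ((PlotNear.of_isPlot hp).comp q.toSmoothMap))
    · exact ((congrArg (a.toFun (x := q.toFun x₂)) (L.pullback_act h z e)).trans
        (ha (q.eq_comm h) z e)).trans (L'.pullback_act h _ e).symm
  refine ⟨.ofBijective (Quotient.map (fun L => L.pullback q) h) ⟨?_, ?_⟩, fun L => rfl⟩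
  · rintro ⟨L⟩ ⟨L'⟩ hLL
    exact Quotient.sound (GerbeModule.equivalent_of_pullback hq (Quotient.exact hLL))
  · rintro ⟨L⟩
    obtain ⟨L', hL'⟩ := GerbeModule.exists_pullback_equivalent hq L
    exact ⟨⟦L'⟧, Quotient.sound hL'⟩

end Descent

end NonabelianGerbe
namespace NonabelianGerbe

/-! ### Local sections of submersions -/

section Submersions

variable {a b c : ℕ} {M : Type*} [TopologicalSpace M] [ChartedSpace (Euc a) M]
  {Y : Type*} [TopologicalSpace Y] [ChartedSpace (Euc b) Y]
  {Y' : Type*} [TopologicalSpace Y'] [ChartedSpace (Euc c) Y'] {π : Y → M} {π' : Y' → M}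

/-- A submersion has a smooth local section through every point. -/
theorem exists_contMDiffOn_section [IsManifold (𝓡 a) ∞ M] [IsManifold (𝓡 b) ∞ Y]
    (hπ : Manifold.IsSubmersion (𝓡 b) (𝓡 a) ∞ π) (y : Y) :
    ∃ U : Set M, IsOpen U ∧ π y ∈ U ∧ ∃ σ : M → Y, ContMDiffOn (𝓡 a) (𝓡 b) ∞ σ U ∧
      ∀ x ∈ U, π (σ x) = x := by
  have h := hπ.isSubmersionAt y
  -- In adapted charts the submersion is the first projection of a product.
  have hw : ∀ z ∈ h.domChart.target, h.codChart (π (h.domChart.symm z)) = (h.equiv z).1 :=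
    fun z hz =>
      have hz' : z ∈ (h.domChart.extend (𝓡 b)).target := by simpa using hz
      h.writtenInCharts hz'
  -- The local section keeps the complementary coordinate of `y` fixed and varies the base
  -- coordinate `u`.
  let g : Euc a → Euc b := fun u => h.equiv.symm (u, (h.equiv (h.domChart y)).2)
  have hg : ContDiff ℝ ∞ g := h.equiv.symm.contDiff.comp (contDiff_id.prodMk contDiff_const)
  refine ⟨h.codChart.source ∩ h.codChart ⁻¹' (g ⁻¹' h.domChart.target),
    h.codChart.isOpen_inter_preimage (h.domChart.open_target.preimage hg.continuous),
    ⟨h.mem_codChart_source, ?_⟩, fun x => h.domChart.symm (g (h.codChart x)), ?_, ?_⟩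
  · have h1 := hw _ (h.domChart.map_source h.mem_domChart_source)
    rw [h.domChart.left_inv h.mem_domChart_source] at h1
    rw [Set.mem_preimage, Set.mem_preimage, h1]
    simpa [g] using h.domChart.map_source h.mem_domChart_source
  · exact (contMDiffOn_symm_of_mem_maximalAtlas h.domChart_mem_maximalAtlas).comp
      (hg.contMDiff.comp_contMDiffOn
        ((contMDiffOn_of_mem_maximalAtlas h.codChart_mem_maximalAtlas).mono Set.inter_subset_left))
      fun x hx => hx.2
  · intro x hx
    refine h.codChart.injOn (h.source_subset_preimage_source (h.domChart.map_target hx.2)) hx.1 ?_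
    rw [hw _ hx.2]
    simp [g]

theorem DOpen.of_isOpen [DiffeologicalSpace Y] [IsManifoldDiffeology b Y] {U : Set Y}
    (hU : IsOpen U) : DOpen U :=
  Diffeology.isOpen_iff_preimages_plots.2 fun _ p hp =>
    hU.preimage ((IsManifoldDiffeology.isPlot_iff (n := b) p).1 hp).continuous

variable [IsManifold (𝓡 a) ∞ M] [IsManifold (𝓡 c) ∞ Y']
  [DiffeologicalSpace Y] [IsManifoldDiffeology b Y] [DiffeologicalSpace Y']
  [IsManifoldDiffeology c Y']

/-- A smooth map lifts locally along a surjective submersion. -/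
theorem exists_local_lift (hπ : ContMDiff (𝓡 b) (𝓡 a) ∞ π)
    (hπ' : Manifold.IsSubmersion (𝓡 c) (𝓡 a) ∞ π') (hs : Function.Surjective π') (y : Y) :
    ∃ W : Set Y, DOpen W ∧ y ∈ W ∧ ∃ s : Y → Y', (∀ y, π' (s y) = π y) ∧
      ∀ {n : ℕ} {p : Euc n → Y}, IsPlot p → (∀ v, p v ∈ W) → IsPlot fun v => s (p v) := by
  classical
  obtain ⟨y', hy'⟩ := hs (π y)
  obtain ⟨U, hU, hyU, σ, hσ, hπσ⟩ := exists_contMDiffOn_section hπ' y'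
  choose r hr using hs
  refine ⟨π ⁻¹' U, .of_isOpen (b := b) (hU.preimage hπ.continuous), by rwa [hy'] at hyU,
    -- A lift is needed at all points, while smoothness is needed only over `W`; outside `U` any
    -- preimage will do.
    fun y => if π y ∈ U then σ (π y) else r (π y), fun y => ?_, fun {n p} hp hpW => ?_⟩
  · dsimp only
    split_ifs with h
    · exact hπσ _ h
    · exact hr _
  · have h1 := (IsManifoldDiffeology.isPlot_iff (n := b) p).1 hp
    refine (IsManifoldDiffeology.isPlot_iff (n := c) _).2 ?_
    refine (hσ.comp_contMDiff (hπ.comp h1) hpW).congr fun v => ?_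
    exact if_pos (hpW v)

/-- A local lift `s` of `π` through `π'` gives the section `y ↦ (y, s y)`. The submersion property
of `π'` therefore provides the sections of the projection to `Y`. -/
theorem FibreProduct.hasSmoothLocalSections_fst (hπ : ContMDiff (𝓡 b) (𝓡 a) ∞ π)
    (hπ' : Manifold.IsSubmersion (𝓡 c) (𝓡 a) ∞ π') (hs : Function.Surjective π') :
    HasSmoothLocalSections (FibreProduct.fst π π').toFun := fun y => by
  obtain ⟨W, hW, hy, s, hs, h⟩ := exists_local_lift hπ hπ' hs y
  exact ⟨⟨W, hW, fun y => ⟨(y, s y), (hs y).symm⟩, fun _ => rfl, fun hp hpW => ⟨hp, h hp hpW⟩⟩, hy⟩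

theorem FibreProduct.hasSmoothLocalSections_snd (hπ : ContMDiff (𝓡 b) (𝓡 a) ∞ π)
    (hπ' : Manifold.IsSubmersion (𝓡 c) (𝓡 a) ∞ π') (hs : Function.Surjective π') :
    HasSmoothLocalSections (FibreProduct.snd π' π).toFun := fun y => by
  obtain ⟨W, hW, hy, s, hs, h⟩ := exists_local_lift hπ hπ' hs y
  exact ⟨⟨W, hW, fun y => ⟨(s y, y), hs y⟩, fun _ => rfl, fun hp hpW => ⟨h hp hpW, hp⟩⟩, hy⟩

end Submersions

/-! ### Bijections of module classes and the main theorem -/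

section Classes

variable {k : ℕ} {H : Type u} [Group H] [TopologicalSpace H] [ChartedSpace (Euc k) H]
  [LieGroup (𝓡 k) ∞ H] {m : ℕ} {D : Type u} [Group D] [TopologicalSpace D]
  [ChartedSpace (Euc m) D] [LieGroup (𝓡 m) ∞ D]
  {M : Type*} {Y : Type*} [DiffeologicalSpace Y] {π : Y → M}
  {X : CrossedModule k H m D} {G G' : BundleGerbe k H π}

theorem StableIsoOver.exists_moduleClass_equiv (S : StableIsoOver G G') :
    ∃ F : ModuleClass X G ≃ ModuleClass X G', ∀ (L : GerbeModule X G) (L' : GerbeModule X G'),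
      F ⟦L⟧ = ⟦L'⟧ ↔ Corresponds S L L' := by
  obtain ⟨F, hF⟩ := S.toIntertwiner.exists_moduleClass_equiv (X := X)
  exact ⟨F, fun L L' => (hF L L').trans (corresponds_iff S L).symm⟩

end Classes

end NonabelianGerbe

theorem mainTheorem9
    -- the Lie groups `H` and `D` and the crossed module
    {k : ℕ} {H : Type u} [Group H] [TopologicalSpace H]
    [ChartedSpace (EuclideanSpace ℝ (Fin k)) H] [LieGroup (𝓡 k) ∞ H]
    {m : ℕ} {D : Type u} [Group D] [TopologicalSpace D]
    [ChartedSpace (EuclideanSpace ℝ (Fin m)) D] [LieGroup (𝓡 m) ∞ D]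
    (X : NonabelianGerbe.CrossedModule k H m D)
    -- the manifolds `M`, `Y`, `Y'`
    {a b c : ℕ}
    {M : Type*} [TopologicalSpace M] [ChartedSpace (EuclideanSpace ℝ (Fin a)) M]
    [IsManifold (𝓡 a) ∞ M]
    {Y : Type*} [TopologicalSpace Y] [ChartedSpace (EuclideanSpace ℝ (Fin b)) Y]
    [IsManifold (𝓡 b) ∞ Y] [DiffeologicalSpace Y] [IsManifoldDiffeology b Y]
    {Y' : Type*} [TopologicalSpace Y'] [ChartedSpace (EuclideanSpace ℝ (Fin c)) Y']
    [IsManifold (𝓡 c) ∞ Y'] [DiffeologicalSpace Y'] [IsManifoldDiffeology c Y']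
    -- the submersions onto `M`
    (π : Y → M) (hπ : Manifold.IsSubmersion (𝓡 b) (𝓡 a) ∞ π) (hπs : Function.Surjective π)
    (π' : Y' → M) (hπ' : Manifold.IsSubmersion (𝓡 c) (𝓡 a) ∞ π') (hπs' : Function.Surjective π')
    (G : BundleGerbe k H π) :
    -- stably isomorphic bundle gerbes over `Y` and `Y'` have the same classes of modules, where
    -- modules correspond if on `Y ×_M Y'` their pull-backs correspond by `Q ↦ I Q N`
    (∀ (G' : BundleGerbe k H π') (S : StableIso G G'),
      ∃ F : ModuleClass X G ≃ ModuleClass X G', ∀ (L : GerbeModule X G) (L' : GerbeModule X G'),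
        F ⟦L⟧ = ⟦L'⟧ ↔ Corresponds S (L.pullback (FibreProduct.fst π π'))
          (L'.pullback (FibreProduct.snd π π'))) ∧
    -- the case `Y' = Y`, with `N` on `Y` and `η` on `Y^[2]`: the transformed module
    (∀ (G' : BundleGerbe k H π) (S : StableIsoOver G G'),
      (∀ (L : GerbeModule X G) (I : TrivialBibundle m D Y) (Ξ : TrivialBibundle m D (Y2 π)),
        IsXi (L.Q.pullback p₁) S.η Ξ →
          ∃! K : ModuleStructure G' (transformQ S L I) (transformZ L I Ξ), IsTransform S L I K) ∧
      ∃ F : ModuleClass X G ≃ ModuleClass X G', ∀ (L : GerbeModule X G) (L' : GerbeModule X G'),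
        F ⟦L⟧ = ⟦L'⟧ ↔ Corresponds S L L') := by
  refine ⟨fun G' S => ?_, fun G' S => ⟨fun L I Ξ _ => existsUnique_isTransform S L I Ξ,
    S.exists_moduleClass_equiv⟩⟩
  obtain ⟨F, hF⟩ := S.exists_moduleClass_equiv (X := X)
  obtain ⟨Φ, hΦ⟩ := GerbeModule.exists_pullback_equiv
    (FibreProduct.hasSmoothLocalSections_fst hπ.contMDiff hπ' hπs') X G
  obtain ⟨Φ', hΦ'⟩ := GerbeModule.exists_pullback_equiv
    (FibreProduct.hasSmoothLocalSections_snd hπ'.contMDiff hπ hπs) X G'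
  -- Pull back to `Y ×_M Y'`, transform there with `N`, and descend to `Y'`; the correspondence
  -- becomes the equation `F (Φ ⟦L⟧) = Φ' ⟦L'⟧`.
  refine ⟨(Φ.trans F).trans Φ'.symm, fun L L' => ?_⟩
  rw [← hF, ← hΦ, ← hΦ', Equiv.trans_apply, Equiv.trans_apply, Equiv.symm_apply_eq]
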